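/- Let $\mathbf k$ be a field of characteristic zero. For a $\mathbb Z$-graded vector space $V$ (homological grading, $(\Sigma V)_i=V_{i-1}$), an $L_\infty$ structure on $V$ is a continuous derivation $m$ of the completed symmetric algebra $\hat S\Sigma^{-1}V^*$ of homological degree $-1$, with vanishing constant term and $m^2=0$; dually, it is a linear map $m\colon S(\Sigma V)\to\Sigma V$ of degree $-1$ with $m(1)=0$ whose associated coderivation of the symmetric coalgebra $S(\Sigma V)$ squares to zero. An $L_\infty$ map $V\to W$ is a continuous dg algebra map $\hat S\Sigma^{-1}W^*\to\hat S\Sigma^{-1}V^*$ preserving the augmentation ideals; it is an $L_\infty$ quasi-isomorphism if its linear part is a quasi-isomorphism; two $L_\infty$ maps are homotopic if they are Sullivan homotopic, i.e. are the endpoints of a dg algebra map, preserving augmentation ideals, into $\hat S\Sigma^{-1}V^*\otimes\mathbf k[t,dt]$. Let $(I,m)$ be an $L_\infty$ algebra. Let $\Sigma C_{\mathrm{CE}}(I,I)=\operatorname{Der}(\hat S\Sigma^{-1}I^*)$, a dg Lie algebra with the commutator (Gerstenhaber) bracket and the differential $[m,-]$, and let $\Sigma\overline C_{\mathrm{CE}}(I,I)$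 be its dg Lie subalgebra of derivations with vanishing constant term. Derivations are identified with linear maps $S(\Sigma I)\to\Sigma I$. Let $$I\xrightarrow{\ \iota\ }\Sigma\overline C_{\mathrm{CE}}(I,I)\hookrightarrow\Sigma C_{\mathrm{CE}}(I,I)\qquad(1)$$ be the sequence in which the second map is the inclusion and $\iota$ is the $L_\infty$ map whose components are $\iota_n(x_1,\dots,x_n)=\bigl(y_1\cdots y_r\mapsto m(x_1\cdots x_n\,y_1\cdots y_r)\bigr)_{r\ge1}$, $n\ge 1$, with zero constant term. For an $L_\infty$ algebra $U$ and an $L_\infty$ map $f\colon U\to\Sigma C_{\mathrm{CE}}(I,I)$, the extension $I\to V\to U$ corresponding to $f$ is $V=I\oplus U$ with the $L_\infty$ structure whose component in $\Sigma U$ is that of $U$ (and vanishes if some argument lies in $\Sigma I$), and whose component in $\Sigma I$ sends $u\cdot x$, $u\in S(\Sigma U)$, $x\in S(\Sigma I)$, to $\varepsilon(u)\,m(x)+f(u)(x)$, where $\varepsilon$ is the counit. The universal $L_\infty$ extension $$e\colon\quad I\to V\to\Sigma C_{\mathrm{CE}}(I,I)\qquad(2)$$ is the extension corresponding to the identity map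 of $\Sigma C_{\mathrm{CE}}(I,I)$. **Theorem.** All the structures in (1) and (2) are $L_\infty$ structures, all the maps in (1) and (2) are $L_\infty$ maps, and the sequences (1) and (2) are homotopy equivalent: there is an $L_\infty$ quasi-isomorphism $\beta\colon\Sigma\overline C_{\mathrm{CE}}(I,I)\to V$ such that the diagram formed by (1), (2), the identity of $I$, $\beta$ and the identity of $\Sigma C_{\mathrm{CE}}(I,I)$ commutes up to homotopy of $L_\infty$ maps. -/

import Mathlib

open scoped DirectSum TensorProduct

/-!
Graded vector spaces are families `V : ℤ → Type*` of vector spaces over a field `k` (homological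
grading), with total space `⨁ i, V i`. The representing complete cdga `Ŝ(Σ⁻¹V*)` of an
`L∞` algebra structure on `V` is the linear dual of the conilpotent cocommutative coalgebra `S(ΣV)`;
complete cdgas and conilpotent cocommutative dg coalgebras are anti-equivalent by linear duality,
and everything is written on the coalgebra side. Thus continuous derivations of `Ŝ(Σ⁻¹V*)` are
coderivations of `S(ΣV)`, i.e. linear maps `S(ΣV) → ΣV`, and continuous algebra maps
`Ŝ(Σ⁻¹W*) → Ŝ(Σ⁻¹V*)` are coalgebra maps `S(ΣV) → S(ΣW)`, i.e. linear maps
`S(ΣV) → ΣW` vanishing on `1`.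
-/

set_option linter.unusedSectionVars false

namespace LInf

noncomputable section

/-- The Koszul sign `(-1)ⁿ`, as a scalar. -/
def sgn (k : Type*) [Field k] (n : ℤ) : k := ((n.negOnePow : ℤ) : k)

section SymmetricCoalgebra

variable (k : Type*) [Field k] (W : ℤ → Type*) [∀ i, AddCommGroup (W i)] [∀ i, Module k (W i)]

/-- Graded commutativity `xy = (-1)^{|x||y|} yx` of homogeneous generators. -/
inductive SymRel : TensorAlgebra k (⨁ i, W i) → TensorAlgebra k (⨁ i, W i) → Prop
  | comm (i j : ℤ) (x : W i) (y : W j) :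
      SymRel
        (TensorAlgebra.ι k (DirectSum.lof k ℤ W i x) * TensorAlgebra.ι k (DirectSum.lof k ℤ W j y))
        (sgn k (i * j) •
          (TensorAlgebra.ι k (DirectSum.lof k ℤ W j y) *
            TensorAlgebra.ι k (DirectSum.lof k ℤ W i x)))

/-- The graded symmetric algebra `S(W)` of the graded vector space `W`. -/
abbrev SymAlg : Type _ := RingQuot (SymRel k W)

/-- The inclusion of generators `W → S(W)`. -/
def gen : (⨁ i, W i) →ₗ[k] SymAlg k W :=
  (RingQuot.mkAlgHom k (SymRel k W)).toLinearMap ∘ₗ TensorAlgebra.ι k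

/-- A homogeneous generator of degree `i`. -/
abbrev gen₁ (i : ℤ) (x : W i) : SymAlg k W := gen k W (DirectSum.lof k ℤ W i x)

theorem gen_comm (i j : ℤ) (x : W i) (y : W j) :
    gen₁ k W i x * gen₁ k W j y = sgn k (i * j) • (gen₁ k W j y * gen₁ k W i x) := by
  have h := RingQuot.mkAlgHom_rel k (SymRel.comm (k := k) i j x y)
  simp only [map_mul, map_smul] at h
  exact h

variable {k W} in
/-- The universal property of `S(W)`: algebra maps out of `S(W)`. -/
def symLift {A : Type*} [Semiring A] [Algebra k A] (f : (⨁ i, W i) →ₗ[k] A)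
    (hf : ∀ i j (x : W i) (y : W j),
      f (DirectSum.lof k ℤ W i x) * f (DirectSum.lof k ℤ W j y) =
        sgn k (i * j) • (f (DirectSum.lof k ℤ W j y) * f (DirectSum.lof k ℤ W i x))) :
    SymAlg k W →ₐ[k] A :=
  RingQuot.liftAlgHom k ⟨TensorAlgebra.lift k f, by
    rintro _ _ ⟨i, j, x, y⟩
    simpa using hf i j x y⟩

variable {k W} in
theorem symLift_gen {A : Type*} [Semiring A] [Algebra k A] (f : (⨁ i, W i) →ₗ[k] A)
    (hf : ∀ i j (x : W i) (y : W j),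
      f (DirectSum.lof k ℤ W i x) * f (DirectSum.lof k ℤ W j y) =
        sgn k (i * j) • (f (DirectSum.lof k ℤ W j y) * f (DirectSum.lof k ℤ W i x)))
    (x : ⨁ i, W i) : symLift f hf (gen k W x) = f x := by
  have : symLift f hf (RingQuot.mkAlgHom k (SymRel k W) (TensorAlgebra.ι k x)) = f x := by
    unfold symLift
    rw [RingQuot.liftAlgHom_mkAlgHom_apply, TensorAlgebra.lift_ι_apply]
  exact this

/-- The product `x₁ ⋯ xₙ` of a list of homogeneous elements. -/
def mon (l : List (Σ i, W i)) : SymAlg k W := (l.map fun x => gen₁ k W x.1 x.2).prod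

/-- The total degree of the product `x₁ ⋯ xₙ`. -/
def mdeg (l : List (Σ i, W i)) : ℤ := (l.map Sigma.fst).sum

@[simp] theorem mon_nil : mon k W [] = 1 := rfl
@[simp] theorem mon_cons (x : Σ i, W i) (l : List (Σ i, W i)) :
    mon k W (x :: l) = gen₁ k W x.1 x.2 * mon k W l := by simp [mon]
@[simp] theorem mdeg_nil : mdeg W [] = 0 := rfl
@[simp] theorem mdeg_cons (x : Σ i, W i) (l : List (Σ i, W i)) :
    mdeg W (x :: l) = x.1 + mdeg W l := by simp [mdeg]
theorem mon_append (l l' : List (Σ i, W i)) : mon k W (l ++ l') = mon k W l * mon k W l' := by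
  simp [mon]
theorem mdeg_append (l l' : List (Σ i, W i)) : mdeg W (l ++ l') = mdeg W l + mdeg W l' := by
  simp [mdeg]

/-- The part of `S(W)` of total degree `n`. -/
def grade (n : ℤ) : Submodule k (SymAlg k W) := Submodule.span k {s | ∃ l, mdeg W l = n ∧ mon k W l = s}

theorem mon_mem (l : List (Σ i, W i)) : mon k W l ∈ grade k W (mdeg W l) :=
  Submodule.subset_span ⟨l, rfl, rfl⟩

theorem gen_mem (i : ℤ) (x : W i) : gen₁ k W i x ∈ grade k W i := by
  simpa using mon_mem k W [⟨i, x⟩]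

instance : SetLike.GradedMonoid (grade k W) where
  one_mem := mon_mem k W []
  mul_mem i j a b ha hb := by
    have h : grade k W i * grade k W j ≤ grade k W (i + j) := by
      unfold grade
      rw [Submodule.span_mul_span]
      refine Submodule.span_mono ?_
      rintro _ ⟨_, ⟨l, rfl, rfl⟩, _, ⟨l', rfl, rfl⟩, rfl⟩
      exact ⟨l ++ l', mdeg_append W l l', mon_append k W l l'⟩
    exact h (Submodule.mul_mem_mul ha hb)

/-- The inclusion of generators, with values in the direct sum of the graded parts. -/
def toGraded : (⨁ i, W i) →ₗ[k] ⨁ n, grade k W n :=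
  DirectSum.lmap fun i =>
    ((gen k W) ∘ₗ DirectSum.lof k ℤ W i).codRestrict (grade k W i) (gen_mem k W i)

theorem toGraded_lof (i : ℤ) (x : W i) : toGraded k W (DirectSum.lof k ℤ W i x) =
    DirectSum.of (fun n => grade k W n) i ⟨gen₁ k W i x, gen_mem k W i x⟩ := by
  unfold toGraded
  rw [DirectSum.lmap_lof]; rfl

/-- The decomposition of `S(W)` into its graded parts. -/
def gradeHom : SymAlg k W →ₐ[k] ⨁ n, grade k W n :=
  symLift (W := W) (toGraded k W) (by
    intro i j x y
    simp only [toGraded_lof, DirectSum.of_mul_of]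
    rw [← DirectSum.of_smul]
    refine DirectSum.of_eq_of_gradedMonoid_eq (Sigma.subtype_ext (add_comm _ _) ?_)
    exact gen_comm k W i j x y)

theorem gradeHom_mon (l : List (Σ i, W i)) :
    gradeHom k W (mon k W l) =
      DirectSum.of (fun n => grade k W n) (mdeg W l) ⟨mon k W l, mon_mem k W l⟩ := by
  induction l with
  | nil => simp; rfl
  | cons x l ih =>
    have h : gradeHom k W (mon k W (x :: l)) =
        gradeHom k W (gen₁ k W x.1 x.2) * gradeHom k W (mon k W l) := by
      rw [mon_cons, map_mul]
    rw [h, ih]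
    have h' : gradeHom k W (gen₁ k W x.1 x.2) = toGraded k W (DirectSum.lof k ℤ W x.1 x.2) :=
      symLift_gen (W := W) _ _ _
    rw [h', toGraded_lof, DirectSum.of_mul_of]
    exact DirectSum.of_eq_of_gradedMonoid_eq (Sigma.subtype_ext (mdeg_cons W x l).symm
      (mon_cons k W x l).symm)


theorem gradeHom_mem (i : ℤ) (s : SymAlg k W) (hs : s ∈ grade k W i) :
    ∃ h : s ∈ grade k W i, gradeHom k W s = DirectSum.of (fun n => grade k W n) i ⟨s, h⟩ := by
  unfold grade at hs
  induction hs using Submodule.span_induction with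
  | mem s hs =>
    obtain ⟨l, rfl, rfl⟩ := hs
    exact ⟨mon_mem k W l, gradeHom_mon k W l⟩
  | zero => exact ⟨zero_mem _, by rw [map_zero]; exact (map_zero _).symm⟩
  | add s t _ _ h1 h2 =>
    obtain ⟨h1, e1⟩ := h1
    obtain ⟨h2, e2⟩ := h2
    exact ⟨add_mem h1 h2, by rw [map_add, e1, e2, ← map_add]; rfl⟩
  | smul c s _ h =>
    obtain ⟨h, e⟩ := h
    exact ⟨Submodule.smul_mem _ c h, by rw [map_smul, e, ← DirectSum.of_smul]; rfl⟩

variable {k W} in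
theorem sym_algHom_ext {A : Type*} [Semiring A] [Algebra k A] {f g : SymAlg k W →ₐ[k] A}
    (h : ∀ i x, f (gen₁ k W i x) = g (gen₁ k W i x)) : f = g := by
  apply RingQuot.ringQuot_ext'
  apply TensorAlgebra.hom_ext
  apply DirectSum.linearMap_ext
  intro i
  ext x
  exact h i x

/-- The grading of `S(W)` by total degree. -/
instance : GradedAlgebra (grade k W) :=
  GradedAlgebra.ofAlgHom _ (gradeHom k W)
    (by
      apply sym_algHom_ext
      intro i x
      obtain ⟨h, e⟩ := gradeHom_mem k W i _ (gen_mem k W i x)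
      rw [AlgHom.comp_apply, e, DirectSum.coeAlgHom_of]
      rfl)
    (fun i x => (gradeHom_mem k W i x.1 x.2).2)

theorem span_mon : Submodule.span k (Set.range (mon k W)) = ⊤ := by
  have h : ∀ i, grade k W i ≤ Submodule.span k (Set.range (mon k W)) := by
    intro i
    refine Submodule.span_mono ?_
    rintro _ ⟨l, -, rfl⟩
    exact ⟨l, rfl⟩
  rw [eq_top_iff, ← (DirectSum.Decomposition.isInternal (grade k W)).submodule_iSup_eq_top]
  exact iSup_le h

open GradedTensorProduct in
/-- The coproduct as the algebra map `S(W) → S(W) ⊗ S(W)` (tensor product of graded algebras, with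
the Koszul sign) for which the generators are primitive: `x ↦ x ⊗ 1 + 1 ⊗ x`. -/
def comulHom : SymAlg k W →ₐ[k] (grade k W ᵍ⊗[k] grade k W) :=
  symLift (W := W) (((includeLeft (grade k W) (grade k W)).toLinearMap +
      (includeRight (grade k W) (grade k W)).toLinearMap) ∘ₗ gen k W) (by
    intro i j x y
    have h1 : ∀ (a b : SymAlg k W), (a ᵍ⊗ₜ[k] (1 : SymAlg k W) * b ᵍ⊗ₜ[k] (1 : SymAlg k W) :
        grade k W ᵍ⊗[k] grade k W) = (a * b) ᵍ⊗ₜ[k] (1 : SymAlg k W) := fun a b =>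
      (map_mul (includeLeft (grade k W) (grade k W)) a b).symm
    have h2 : ∀ (a b : SymAlg k W), ((1 : SymAlg k W) ᵍ⊗ₜ[k] a * (1 : SymAlg k W) ᵍ⊗ₜ[k] b :
        grade k W ᵍ⊗[k] grade k W) = (1 : SymAlg k W) ᵍ⊗ₜ[k] (a * b) := fun a b =>
      (map_mul (includeRight (grade k W) (grade k W)) a b).symm
    have h3 : ∀ (a b : SymAlg k W), (a ᵍ⊗ₜ[k] (1 : SymAlg k W) * (1 : SymAlg k W) ᵍ⊗ₜ[k] b :
        grade k W ᵍ⊗[k] grade k W) = a ᵍ⊗ₜ[k] b := fun a b => by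
      rw [tmul_one_mul_one_tmul]
    have h4 : ∀ (i j : ℤ) (x : W i) (y : W j),
        ((1 : SymAlg k W) ᵍ⊗ₜ[k] gen₁ k W i x * gen₁ k W j y ᵍ⊗ₜ[k] (1 : SymAlg k W) :
          grade k W ᵍ⊗[k] grade k W) =
        sgn k (i * j) • (gen₁ k W j y ᵍ⊗ₜ[k] gen₁ k W i x) := fun i j x y => by
      have := tmul_coe_mul_coe_tmul (R := k) (grade k W) (grade k W) (1 : SymAlg k W)
        ⟨_, gen_mem k W i x⟩ ⟨_, gen_mem k W j y⟩ 1
      rw [one_mul, mul_one] at this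
      rw [this, Units.smul_def, ← Int.cast_smul_eq_zsmul k]
      rfl
    have h5 : sgn k (i * j) * sgn k (j * i) = 1 := by
      rw [mul_comm j i]
      unfold sgn
      rw [← Int.cast_mul, ← Units.val_mul, Int.units_mul_self]
      simp
    simp only [LinearMap.comp_apply, LinearMap.add_apply, AlgHom.toLinearMap_apply,
      includeLeft_apply, includeRight_apply, add_mul, mul_add, h1, h2, h3, h4,
      gen_comm k W i j x y, smul_add, smul_smul, h5, one_smul]
    simp only [GradedTensorProduct.tmul, ← TensorProduct.smul_tmul', TensorProduct.tmul_smul,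
      map_smul]
    abel)

/-- The (unshuffle) coproduct of `S(W)`:
`x₁ ⋯ xₙ ↦ ∑ ± x_{i₁} ⋯ x_{iₚ} ⊗ x_{j₁} ⋯ x_{jᵩ}` over all splittings of `{1, …, n}`. -/
def comul : SymAlg k W →ₗ[k] SymAlg k W ⊗[k] SymAlg k W :=
  (GradedTensorProduct.of k (grade k W) (grade k W)).symm.toLinearMap ∘ₗ (comulHom k W).toLinearMap


theorem comul_one : comul k W 1 = 1 ⊗ₜ 1 := by
  unfold comul
  rw [LinearMap.comp_apply, AlgHom.toLinearMap_apply, map_one]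
  rfl

/-- The coproduct of a monomial is a combination of tensor products of monomials of
complementary length and degree. -/
theorem comul_mon (l : List (Σ i, W i)) :
    comul k W (mon k W l) ∈ Submodule.span k {z | ∃ l₁ l₂, l₁.length + l₂.length = l.length ∧
      mdeg W l₁ + mdeg W l₂ = mdeg W l ∧ mon k W l₁ ⊗ₜ[k] mon k W l₂ = z} := by
  induction l with
  | nil =>
    rw [mon_nil, comul_one]
    exact Submodule.subset_span ⟨[], [], rfl, rfl, rfl⟩
  | cons x l ih =>
    have key : ∀ z : SymAlg k W ⊗[k] SymAlg k W,
        z ∈ Submodule.span k {z | ∃ l₁ l₂, l₁.length + l₂.length = l.length ∧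
          mdeg W l₁ + mdeg W l₂ = mdeg W l ∧ mon k W l₁ ⊗ₜ[k] mon k W l₂ = z} →
        (GradedTensorProduct.of k (grade k W) (grade k W)).symm
          (comulHom k W (gen₁ k W x.1 x.2) * GradedTensorProduct.of k (grade k W) (grade k W) z) ∈
          Submodule.span k {z | ∃ l₁ l₂, l₁.length + l₂.length = (x :: l).length ∧
          mdeg W l₁ + mdeg W l₂ = mdeg W (x :: l) ∧ mon k W l₁ ⊗ₜ[k] mon k W l₂ = z} := by
      intro z hz
      induction hz using Submodule.span_induction with
      | zero => rw [map_zero, mul_zero, map_zero]; exact zero_mem _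
      | add u v _ _ hu hv => rw [map_add, mul_add, map_add]; exact add_mem hu hv
      | smul c u _ hu => rw [map_smul, mul_smul_comm, map_smul]; exact Submodule.smul_mem _ c hu
      | mem z hz =>
        obtain ⟨l₁, l₂, h1, h2, rfl⟩ := hz
        have hx : comulHom k W (gen₁ k W x.1 x.2) =
            (gen₁ k W x.1 x.2 ᵍ⊗ₜ[k] (1 : SymAlg k W) + (1 : SymAlg k W) ᵍ⊗ₜ[k] gen₁ k W x.1 x.2 :
              grade k W ᵍ⊗[k] grade k W) := by
          unfold comulHom
          exact symLift_gen (W := W) _ _ _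
        have e1 := GradedTensorProduct.tmul_one_mul_coe_tmul (R := k) (grade k W) (grade k W)
          (gen₁ k W x.1 x.2) (⟨_, mon_mem k W l₁⟩ : grade k W (mdeg W l₁)) (mon k W l₂)
        have e2 := GradedTensorProduct.tmul_coe_mul_coe_tmul (R := k) (grade k W) (grade k W)
          (1 : SymAlg k W) (⟨_, gen_mem k W x.1 x.2⟩ : grade k W x.1)
          (⟨_, mon_mem k W l₁⟩ : grade k W (mdeg W l₁)) (mon k W l₂)
        rw [hx, add_mul, map_add]
        refine add_mem ?_ ?_
        · rw [e1]
          refine Submodule.subset_span ⟨x :: l₁, l₂, ?_, ?_, ?_⟩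
          · simp only [List.length_cons]; omega
          · simp only [mdeg_cons]; omega
          · rw [mon_cons]; rfl
        · rw [e2, one_mul, Units.smul_def, ← Int.cast_smul_eq_zsmul k, map_smul]
          refine Submodule.smul_mem _ _ ?_
          refine Submodule.subset_span ⟨l₁, x :: l₂, ?_, ?_, ?_⟩
          · simp only [List.length_cons]; omega
          · simp only [mdeg_cons]; omega
          · rw [mon_cons]; rfl
    have := key _ ih
    have e : comul k W (mon k W (x :: l)) = (GradedTensorProduct.of k (grade k W) (grade k W)).symm
          (comulHom k W (gen₁ k W x.1 x.2) *
            GradedTensorProduct.of k (grade k W) (grade k W) (comul k W (mon k W l))) := by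
      rw [mon_cons]
      unfold comul
      simp only [LinearMap.comp_apply, AlgHom.toLinearMap_apply, map_mul]
      rfl
    rw [e]
    exact this


/-- The counit `S(W) → k`, killing all generators. -/
def counit : SymAlg k W →ₐ[k] k := symLift (W := W) 0 (by simp)

theorem counit_gen_mul (x : ⨁ i, W i) (s : SymAlg k W) : counit k W (gen k W x * s) = 0 := by
  rw [map_mul]
  have : counit k W (gen k W x) = 0 := symLift_gen (W := W) _ _ _
  rw [this, zero_mul]

/-- The projection `S(W) → W` which is the identity on `S¹(W) = W` and zero on `Sⁿ(W)`, `n ≠ 1`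
(the algebra map `S(W) → k ⊕ W` to the trivial square-zero extension, followed by the projection).
These are the Taylor coefficients of the identity map of `S(W)`. -/
def proj : SymAlg k W →ₗ[k] ⨁ i, W i :=
  letI : Module kᵐᵒᵖ (⨁ i, W i) := Module.compHom _ ((RingHom.id k).fromOpposite mul_comm)
  haveI : IsCentralScalar k (⨁ i, W i) := ⟨fun _ _ => rfl⟩
  TrivSqZeroExt.sndHom k (⨁ i, W i) ∘ₗ
    (symLift (W := W) (TrivSqZeroExt.inrHom k (⨁ i, W i)) (by simp)).toLinearMap

theorem proj_gen (x : ⨁ i, W i) : proj k W (gen k W x) = x := by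
  let : Module kᵐᵒᵖ (⨁ i, W i) := Module.compHom _ ((RingHom.id k).fromOpposite mul_comm)
  have : IsCentralScalar k (⨁ i, W i) := ⟨fun _ _ => rfl⟩
  unfold proj
  simp only [LinearMap.comp_apply, AlgHom.toLinearMap_apply]
  rw [symLift_gen (W := W)]
  simp

theorem proj_one : proj k W 1 = 0 := by
  let : Module kᵐᵒᵖ (⨁ i, W i) := Module.compHom _ ((RingHom.id k).fromOpposite mul_comm)
  have : IsCentralScalar k (⨁ i, W i) := ⟨fun _ _ => rfl⟩
  unfold proj
  simp only [LinearMap.comp_apply, AlgHom.toLinearMap_apply, map_one]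
  simp

theorem proj_gen_mul_gen (x y : ⨁ i, W i) (s : SymAlg k W) : 
    proj k W (gen k W x * gen k W y * s) = 0 := by
  let : Module kᵐᵒᵖ (⨁ i, W i) := Module.compHom _ ((RingHom.id k).fromOpposite mul_comm)
  have : IsCentralScalar k (⨁ i, W i) := ⟨fun _ _ => rfl⟩
  unfold proj
  simp only [LinearMap.comp_apply, AlgHom.toLinearMap_apply, map_mul]
  rw [symLift_gen (W := W), symLift_gen (W := W)]
  simp

variable {k W}

/-- Convolution product `a * b = μ ∘ (a ⊗ b) ∘ Δ`. -/
def conv {A : Type*} [Semiring A] [Algebra k A] (a b : SymAlg k W →ₗ[k] A) :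
    SymAlg k W →ₗ[k] A :=
  LinearMap.mul' k A ∘ₗ TensorProduct.map a b ∘ₗ comul k W

/-- Convolution powers `a * ⋯ * a`; the zeroth one is the counit. -/
def convPow {A : Type*} [Semiring A] [Algebra k A] (a : SymAlg k W →ₗ[k] A) :
    ℕ → (SymAlg k W →ₗ[k] A)
  | 0 => Algebra.linearMap k A ∘ₗ (counit k W).toLinearMap
  | n + 1 => conv a (convPow a n)

theorem conv_mon_mem {A : Type*} [Semiring A] [Algebra k A] (a b : SymAlg k W →ₗ[k] A)
    (l : List (Σ i, W i)) (P : Submodule k A)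
    (h : ∀ l₁ l₂, l₁.length + l₂.length = l.length → mdeg W l₁ + mdeg W l₂ = mdeg W l →
      a (mon k W l₁) * b (mon k W l₂) ∈ P) : conv a b (mon k W l) ∈ P := by
  have := comul_mon k W l
  have h2 : Submodule.span k {z | ∃ l₁ l₂, l₁.length + l₂.length = l.length ∧
      mdeg W l₁ + mdeg W l₂ = mdeg W l ∧ mon k W l₁ ⊗ₜ[k] mon k W l₂ = z} ≤
      P.comap (LinearMap.mul' k A ∘ₗ TensorProduct.map a b) := by
    rw [Submodule.span_le]
    rintro _ ⟨l₁, l₂, h1, h2, rfl⟩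
    exact h l₁ l₂ h1 h2
  exact h2 this

/-- If `a 1 = 0` then the `n`-th convolution power of `a` vanishes on products of less than `n`
generators. -/
theorem convPow_eq_zero {A : Type*} [Semiring A] [Algebra k A] (a : SymAlg k W →ₗ[k] A)
    (ha : a 1 = 0) (n : ℕ) (l : List (Σ i, W i)) (hl : l.length < n) :
    convPow a n (mon k W l) = 0 := by
  induction n generalizing l with
  | zero => omega
  | succ n ih =>
    refine (Submodule.mem_bot k).1 (conv_mon_mem a _ l ⊥ fun l₁ l₂ h _ => ?_)
    rw [Submodule.mem_bot]
    cases l₁ with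
    | nil => rw [mon_nil, ha, zero_mul]
    | cons x l₁ =>
      rw [ih l₂ (by simp only [List.length_cons] at h; omega), mul_zero]

theorem convPow_finite {A : Type*} [Semiring A] [Algebra k A] (a : SymAlg k W →ₗ[k] A)
    (ha : a 1 = 0) (s : SymAlg k W) : ∃ N, ∀ n, N ≤ n → convPow a n s = 0 := by
  have hs : s ∈ Submodule.span k (Set.range (mon k W)) := by rw [span_mon]; trivial
  induction hs using Submodule.span_induction with
  | mem s hs =>
    obtain ⟨l, rfl⟩ := hs
    exact ⟨l.length + 1, fun n hn => convPow_eq_zero a ha n l (by omega)⟩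
  | zero => exact ⟨0, fun n _ => map_zero _⟩
  | add s t _ _ h1 h2 =>
    obtain ⟨N, h1⟩ := h1
    obtain ⟨M, h2⟩ := h2
    exact ⟨max N M, fun n hn => by rw [map_add, h1 n (by omega), h2 n (by omega), add_zero]⟩
  | smul c s _ h =>
    obtain ⟨N, h⟩ := h
    exact ⟨N, fun n hn => by rw [map_smul, h n hn, smul_zero]⟩

/-- The part `a - a(1) ε` of `a` that vanishes on `1` (equal to `a` if `a 1 = 0`). -/
def reduced {M : Type*} [AddCommGroup M] [Module k M] (a : SymAlg k W →ₗ[k] M) :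
    SymAlg k W →ₗ[k] M :=
  a - (counit k W).toLinearMap.smulRight (a 1)

theorem reduced_one {M : Type*} [AddCommGroup M] [Module k M] (a : SymAlg k W →ₗ[k] M) :
    reduced a 1 = 0 := by
  simp [reduced]

theorem convExp_support {A : Type*} [Ring A] [Algebra k A] (a : SymAlg k W →ₗ[k] A)
    (s : SymAlg k W) :
    (Function.support fun n : ℕ => (n.factorial : k)⁻¹ • convPow (reduced a) n s).Finite := by
  obtain ⟨N, hN⟩ := convPow_finite (reduced a) (reduced_one a) s
  refine (Set.finite_lt_nat N).subset fun n hn => ?_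
  by_contra h
  exact hn (by simp only [hN n (not_lt.1 h), smul_zero])

/-- The convolution exponential `∑ₙ a^{*n} / n!` of a map `a` with `a 1 = 0`; the sum is finite on
every element. (For general `a`, it is applied to the part of `a` vanishing on `1`.) -/
def convExp {A : Type*} [Ring A] [Algebra k A] (a : SymAlg k W →ₗ[k] A) : SymAlg k W →ₗ[k] A where
  toFun s := ∑ᶠ n : ℕ, (n.factorial : k)⁻¹ • convPow (reduced a) n s
  map_add' s t := by
    rw [← finsum_add_distrib (convExp_support a s) (convExp_support a t)]
    simp only [map_add, smul_add]
  map_smul' c s := by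
    rw [RingHom.id_apply, smul_finsum' c (convExp_support a s)]
    simp only [map_smul, smul_comm c]

end SymmetricCoalgebra

section Graded

/-- Taylor coefficients: linear maps `S(W) → U` from the symmetric coalgebra of `W` to the
(total space `⨁ Uᵢ` of the) graded vector space `U`. The restriction to `Sⁿ(W)` is the `n`-th
component. -/
abbrev Cochain (k : Type*) [Field k] (W U : ℤ → Type*) [∀ i, AddCommGroup (W i)]
    [∀ i, Module k (W i)] [∀ i, AddCommGroup (U i)] [∀ i, Module k (U i)] : Type _ :=
  SymAlg k W →ₗ[k] ⨁ i, U i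

variable {k : Type*} [Field k]
  {W : ℤ → Type*} [∀ i, AddCommGroup (W i)] [∀ i, Module k (W i)]
  {U : ℤ → Type*} [∀ i, AddCommGroup (U i)] [∀ i, Module k (U i)]

/-- The coderivation of `S(W)` with Taylor coefficients `φ`:
`x₁ ⋯ xₙ ↦ ∑ ± φ(x_{i₁} ⋯ x_{iₚ}) x_{j₁} ⋯ x_{jᵩ}`. -/
def coder (φ : Cochain k W W) : SymAlg k W →ₗ[k] SymAlg k W :=
  conv (gen k W ∘ₗ φ) LinearMap.id

/-- The coalgebra map `S(W) → S(U)` with Taylor coefficients `f` (where `f 1 = 0`):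
`x₁ ⋯ xₙ ↦ ∑ ± f(x_{P₁}) ⋯ f(x_{Pᵣ})` over all partitions of `{1, …, n}` into blocks. -/
def coalgHom (f : Cochain k W U) : SymAlg k W →ₗ[k] SymAlg k U :=
  convExp (gen k U ∘ₗ f)

/-- The algebra and coalgebra map `S(W) → S(U)` induced by a linear map `W → U` of degree `0`. -/
def symMap (f : ∀ i, W i →ₗ[k] U i) : SymAlg k W →ₐ[k] SymAlg k U :=
  symLift (W := W) (gen k U ∘ₗ DirectSum.lmap f) (by
    intro i j x y
    simp only [LinearMap.comp_apply, DirectSum.lmap_lof]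
    exact gen_comm k U i j _ _)

variable (k W U) in
/-- The linear maps `S(W) → U` that are homogeneous of degree `d`. -/
def homDeg (d : ℤ) : Submodule k (Cochain k W U) where
  carrier := {φ | ∀ n, ∀ s ∈ grade k W n, φ s ∈ LinearMap.range (DirectSum.lof k ℤ U (n + d))}
  add_mem' h h' n s hs := add_mem (h n s hs) (h' n s hs)
  zero_mem' _ _ _ := zero_mem _
  smul_mem' c _ h n s hs := Submodule.smul_mem _ c (h n s hs)

theorem range_lof_congr {m n : ℤ} (h : m = n) {w : ⨁ i, W i}
    (hw : w ∈ LinearMap.range (DirectSum.lof k ℤ W m)) :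
    w ∈ LinearMap.range (DirectSum.lof k ℤ W n) := by
  subst h; exact hw

theorem gen_mem_grade {n : ℤ} {w : ⨁ i, W i} (hw : w ∈ LinearMap.range (DirectSum.lof k ℤ W n)) :
    gen k W w ∈ grade k W n := by
  obtain ⟨x, rfl⟩ := hw
  exact gen_mem k W n x

theorem coder_mem {e n : ℤ} {φ : Cochain k W W} (hφ : φ ∈ homDeg k W W e)
    {s : SymAlg k W} (hs : s ∈ grade k W n) : coder φ s ∈ grade k W (n + e) := by
  have h : grade k W n ≤ (grade k W (n + e)).comap (coder φ) := by
    conv_lhs => unfold grade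
    rw [Submodule.span_le]
    rintro _ ⟨l, rfl, rfl⟩
    refine conv_mon_mem (gen k W ∘ₗ φ) LinearMap.id l
      (grade k W (mdeg W l + e)) fun l₁ l₂ _ h2 => ?_
    have h3 := SetLike.mul_mem_graded (A := grade k W)
      (gen_mem_grade (hφ _ _ (mon_mem k W l₁))) (mon_mem k W l₂)
    rw [show mdeg W l₁ + e + mdeg W l₂ = mdeg W l + e by omega] at h3
    exact h3
  exact h hs

theorem coder_add (φ ψ : Cochain k W W) : coder (φ + ψ) = coder φ + coder ψ := by
  simp only [coder, conv, LinearMap.comp_add, TensorProduct.map_add_left, LinearMap.add_comp]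

theorem coder_smul (c : k) (φ : Cochain k W W) : coder (c • φ) = c • coder φ := by
  simp only [coder, conv, LinearMap.comp_smul, TensorProduct.map_smul_left, LinearMap.smul_comp]

theorem coder_one (φ : Cochain k W W) : coder φ 1 = gen k W (φ 1) := by
  simp [coder, conv, comul_one]

/-- The Taylor coefficients of the graded commutator `[D_φ, D_ψ] = D_φ D_ψ - (-1)^{de} D_ψ D_φ` of
the coderivations with Taylor coefficients `φ`, `ψ` of degrees `d`, `e`. -/
def gerst (d e : ℤ) (φ ψ : Cochain k W W) : Cochain k W W :=
  φ ∘ₗ coder ψ - sgn k (d * e) • (ψ ∘ₗ coder φ)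

theorem gerst_mem {d e l : ℤ} (h : d + e = l) {φ ψ : Cochain k W W}
    (hφ : φ ∈ homDeg k W W d) (hψ : ψ ∈ homDeg k W W e) : gerst d e φ ψ ∈ homDeg k W W l := by
  subst h
  refine sub_mem ?_ (Submodule.smul_mem _ _ ?_)
  · intro n s hs
    have := hφ _ _ (coder_mem hψ hs)
    rwa [show n + e + d = n + (d + e) by omega] at this
  · intro n s hs
    have := hψ _ _ (coder_mem hφ hs)
    rwa [show n + d + e = n + (d + e) by omega] at this

theorem counit_eq_zero {n : ℤ} (hn : n ≠ 0) {s : SymAlg k W} (hs : s ∈ grade k W n) :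
    counit k W s = 0 := by
  unfold grade at hs
  induction hs using Submodule.span_induction with
  | mem s hs =>
    obtain ⟨l, rfl, rfl⟩ := hs
    cases l with
    | nil => exact absurd rfl hn
    | cons x l => rw [mon_cons]; exact counit_gen_mul k W _ _
  | zero => exact map_zero _
  | add s t _ _ h1 h2 => rw [map_add, h1, h2, add_zero]
  | smul c s _ h => rw [map_smul, h, smul_zero]

theorem counit_smulRight_mem {d : ℤ} {w : ⨁ i, U i}
    (hw : w ∈ LinearMap.range (DirectSum.lof k ℤ U d)) :
    (counit k W).toLinearMap.smulRight w ∈ homDeg k W U d := by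
  intro n s hs
  rw [LinearMap.smulRight_apply, AlgHom.toLinearMap_apply]
  rcases eq_or_ne n 0 with rfl | hn
  · exact Submodule.smul_mem _ _ (range_lof_congr (by omega) hw)
  · rw [counit_eq_zero hn hs, zero_smul]
    exact zero_mem _

/-- `q` is an `L∞` structure: the coderivation `D_q` of `S(W)`, `W = ΣV`, has degree `-1`, vanishes
on `1` (no constant term) and satisfies `D_q² = 0`, i.e. `D_q` is a Maurer-Cartan element in the
graded Lie algebra of coderivations without constant term. -/
def IsLInfty (q : Cochain k W W) : Prop :=
  q ∈ homDeg k W W (-1) ∧ q 1 = 0 ∧ coder q ∘ₗ coder q = 0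

/-- `f` is (the collection of Taylor coefficients of) an `L∞` map: it has degree `0`, vanishes on
`1`, and the corresponding coalgebra map commutes with the differentials. -/
def IsLInftyMap (q : Cochain k W W) (q' : Cochain k U U)
    (f : Cochain k W U) : Prop :=
  f ∈ homDeg k W U 0 ∧ f 1 = 0 ∧ coalgHom f ∘ₗ coder q = coder q' ∘ₗ coalgHom f

/-- The linear part `x ↦ f x` of the `L∞` map `f` is injective and surjective on homology, with
respect to the linear parts of the two `L∞` structures. -/
def IsQuasiIso (q : Cochain k W W) (q' : Cochain k U U)
    (f : Cochain k W U) : Prop :=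
  (∀ x, q (gen k W x) = 0 → (∃ y, f (gen k W x) = q' (gen k U y)) → ∃ z, x = q (gen k W z)) ∧
  (∀ y, q' (gen k U y) = 0 → ∃ x z, q (gen k W x) = 0 ∧ y = f (gen k W x) + q' (gen k U z))

/-- The strict `L∞` map given by a linear map of degree `0`. -/
def strictMap (f : ∀ i, W i →ₗ[k] U i) : Cochain k W U :=
  DirectSum.lmap f ∘ₗ proj k W

/-- The Taylor coefficients of the composition of two `L∞` maps. -/
def compMap {T : ℤ → Type*} [∀ i, AddCommGroup (T i)] [∀ i, Module k (T i)]
    (g : Cochain k U T) (f : Cochain k W U) :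
    Cochain k W T :=
  g ∘ₗ coalgHom f

/-- Evaluation at `t` of a polynomial `∑ₙ mₙ tⁿ` with coefficients in `M`. -/
def polyEval (M : Type*) [AddCommGroup M] [Module k M] (t : k) : (ℕ →₀ M) →ₗ[k] M :=
  Finsupp.lsum k fun n => t ^ n • LinearMap.id

/-- The value at `t` of the derivative of a polynomial `∑ₙ mₙ tⁿ` with coefficients in `M`. -/
def polyDeriv (M : Type*) [AddCommGroup M] [Module k M] (t : k) : (ℕ →₀ M) →ₗ[k] M :=
  Finsupp.lsum k fun n => ((n : k) * t ^ (n - 1)) • LinearMap.id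

/-- Sullivan homotopy of `L∞` maps. A map of representing complete cdgas with values in
`Ŝ(Σ⁻¹V*) ⊗ k[t, dt]` is of the form `F_t + B_t dt`, where `F_t` and `B_t` are polynomial in `t` on
every element of `S(ΣV)`. It is an augmentation preserving dg algebra map if and only if `F_t` is
dually an `L∞` map for all `t` (with Taylor coefficients `a_t`), `B_t` is dually a coderivation along
`F_t` of degree `1` vanishing on `1` (with Taylor coefficients `b_t`, so that `B_t = b_t * F_t`) and
`dF_t/dt = D B_t + B_t D`. The last equation is between coderivations along `F_t`, and is expressed
through Taylor coefficients. -/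
def Homotopic (q : Cochain k W W) (q' : Cochain k U U)
    (f g : Cochain k W U) : Prop :=
  ∃ a b : SymAlg k W →ₗ[k] (ℕ →₀ ⨁ i, U i),
    polyEval _ 0 ∘ₗ a = f ∧ polyEval _ 1 ∘ₗ a = g ∧
    ∀ t : k,
      IsLInftyMap q q' (polyEval _ t ∘ₗ a) ∧
      polyEval _ t ∘ₗ b ∈ homDeg k W U 1 ∧ (polyEval _ t ∘ₗ b) 1 = 0 ∧
      polyDeriv _ t ∘ₗ a =
        q' ∘ₗ conv (gen k U ∘ₗ polyEval _ t ∘ₗ b) (coalgHom (polyEval _ t ∘ₗ a)) +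
          (polyEval _ t ∘ₗ b) ∘ₗ coder q

/-- Two sequences of `L∞` algebras and maps `X → Y → Z` (maps `i`, `p`) and `X' → Y' → Z'` (maps `i'`,
`p'`) are homotopy equivalent through `α`, `β`, `γ`: these are `L∞` quasi-isomorphisms
`X → X'`, `Y → Y'`, `Z → Z'` and the two squares commute up to homotopy. -/
def IsSeqHomotopyEquiv
    {X Y Z X' Y' Z' : ℤ → Type*}
    [∀ i, AddCommGroup (X i)] [∀ i, Module k (X i)] [∀ i, AddCommGroup (Y i)] [∀ i, Module k (Y i)]
    [∀ i, AddCommGroup (Z i)] [∀ i, Module k (Z i)]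
    [∀ i, AddCommGroup (X' i)] [∀ i, Module k (X' i)]
    [∀ i, AddCommGroup (Y' i)] [∀ i, Module k (Y' i)]
    [∀ i, AddCommGroup (Z' i)] [∀ i, Module k (Z' i)]
    (qX : Cochain k X X) (qY : Cochain k Y Y) (qZ : Cochain k Z Z)
    (i : Cochain k X Y) (p : Cochain k Y Z)
    (qX' : Cochain k X' X') (qY' : Cochain k Y' Y') (qZ' : Cochain k Z' Z')
    (i' : Cochain k X' Y') (p' : Cochain k Y' Z')
    (α : Cochain k X X') (β : Cochain k Y Y') (γ : Cochain k Z Z') : Prop :=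
  (IsLInftyMap qX qX' α ∧ IsQuasiIso qX qX' α) ∧
  (IsLInftyMap qY qY' β ∧ IsQuasiIso qY qY' β) ∧
  (IsLInftyMap qZ qZ' γ ∧ IsQuasiIso qZ qZ' γ) ∧
  Homotopic qX qY' (compMap β i) (compMap i' α) ∧
  Homotopic qY qZ' (compMap γ p) (compMap p' β)

end Graded

section CE

variable {k : Type*} [Field k]

/-- The suspension `(ΣV)ᵢ = Vᵢ₋₁`. -/
abbrev Susp (V : ℤ → Type*) : ℤ → Type _ := fun i => V (i - 1)

/-- The `L∞` structure of a dg Lie algebra `g` with differential `d` of degree `-1` and bracket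
`br i j (i + j)`: the only nonzero components are `sx ↦ - s(dx)` and
`(sx)(sy) ↦ (-1)^{|x|} s[x, y]`, where `s` is the suspension, so that `sx` has degree `i` if
`x` has degree `i - 1`. -/
def dglaOp (g : ℤ → Type*) [∀ i, AddCommGroup (g i)] [∀ i, Module k (g i)]
    (d : ∀ i, g i →ₗ[k] g (i - 1)) (br : ∀ i j l, i + j = l → g i →ₗ[k] g j →ₗ[k] g l) :
    Cochain k (Susp g) (Susp g) :=
  DirectSum.toModule k ℤ (⨁ i, Susp g i)
      (fun i => -(DirectSum.lof k ℤ (Susp g) (i - 1) ∘ₗ d (i - 1))) ∘ₗ proj k (Susp g) +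
  (2 : k)⁻¹ • (TensorProduct.lift
      (DirectSum.toModule k ℤ ((⨁ i, Susp g i) →ₗ[k] ⨁ i, Susp g i) fun i =>
        LinearMap.flip (DirectSum.toModule k ℤ (Susp g i →ₗ[k] ⨁ i, Susp g i) fun j =>
          LinearMap.flip (sgn k (i - 1) •
            (br (i - 1) (j - 1) (i + j - 1 - 1) (by ring)).compr₂
              (DirectSum.lof k ℤ (Susp g) (i + j - 1))))) ∘ₗ
    TensorProduct.map (proj k (Susp g)) (proj k (Susp g)) ∘ₗ comul k (Susp g))

variable {V : ℤ → Type*} [∀ i, AddCommGroup (V i)] [∀ i, Module k (V i)]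

variable (k V) in
/-- The degree `d` part of the graded vector space of (continuous) derivations of `Ŝ(Σ⁻¹V*)`,
i.e. of coderivations of `S(ΣV)`, given by their Taylor coefficients. -/
def der (d : ℤ) : Submodule k (Cochain k (Susp V) (Susp V)) :=
  homDeg k (Susp V) (Susp V) d

variable (k V) in
/-- The derivations with vanishing constant term. -/
def derBar (d : ℤ) : Submodule k (Cochain k (Susp V) (Susp V)) :=
  der k V d ⊓ LinearMap.ker (LinearMap.applyₗ (1 : SymAlg k (Susp V)))

variable (k V) in
/-- The graded vector space `ΣC_CE(V,V) = Der Ŝ(Σ⁻¹V*)`. -/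
abbrev Der : ℤ → Type _ := fun d => der k V d

variable (k V) in
/-- The graded vector space underlying the suspended truncated Chevalley-Eilenberg complex: the
derivations of `Ŝ(Σ⁻¹V*)` with vanishing constant term. -/
abbrev DerBar : ℤ → Type _ := fun d => derBar k V d

theorem derBar_le (d : ℤ) : derBar k V d ≤ der k V d := inf_le_left

theorem der_gerst {i j l : ℤ} (h : i + j = l) {φ ψ : Cochain k (Susp V) (Susp V)}
    (hφ : φ ∈ der k V i) (hψ : ψ ∈ der k V j) : gerst i j φ ψ ∈ der k V l := gerst_mem h hφ hψ

theorem derBar_gerst {i j l : ℤ} (h : i + j = l) {φ ψ : Cochain k (Susp V) (Susp V)}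
    (hφ : φ ∈ derBar k V i) (hψ : ψ ∈ derBar k V j) : gerst i j φ ψ ∈ derBar k V l := by
  refine ⟨der_gerst h hφ.1 hψ.1, ?_⟩
  have h1 : φ 1 = 0 := hφ.2
  have h2 : ψ 1 = 0 := hψ.2
  simp [gerst, coder_one, h1, h2]

/-- The Gerstenhaber bracket (commutator of coderivations) as a bilinear map, on a graded subspace
of the coderivations closed under it. -/
def gerstBracket (S : ℤ → Submodule k (Cochain k (Susp V) (Susp V)))
    (hS : ∀ {i j l : ℤ}, i + j = l → ∀ {φ ψ}, φ ∈ S i → ψ ∈ S j → gerst i j φ ψ ∈ S l)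
    (i j l : ℤ) (h : i + j = l) : S i →ₗ[k] S j →ₗ[k] S l :=
  LinearMap.mk₂ k (fun φ ψ => ⟨gerst i j φ.1 ψ.1, hS h φ.2 ψ.2⟩)
    (fun φ φ' ψ => Subtype.ext (by
      simp only [gerst, Submodule.coe_add, coder_add, LinearMap.add_comp, LinearMap.comp_add,
        smul_add]
      abel))
    (fun c φ ψ => Subtype.ext (by
      simp only [gerst, Submodule.coe_smul, coder_smul, LinearMap.smul_comp, LinearMap.comp_smul,
        smul_sub, smul_comm c]))
    (fun φ ψ ψ' => Subtype.ext (by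
      simp only [gerst, Submodule.coe_add, coder_add, LinearMap.add_comp, LinearMap.comp_add,
        smul_add]
      abel))
    (fun c φ ψ => Subtype.ext (by
      simp only [gerst, Submodule.coe_smul, coder_smul, LinearMap.smul_comp, LinearMap.comp_smul,
        smul_sub, smul_comm c]))

/-- The `L∞` structure of the dg Lie algebra `ΣC_CE(V,V)`, for an `L∞` algebra `(V, m)`: the
differential is `[m, ·]`, the bracket is the Gerstenhaber bracket. -/
def ceOp {m : Cochain k (Susp V) (Susp V)} (hm : IsLInfty m) :
    Cochain k (Susp (Der k V)) (Susp (Der k V)) :=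
  dglaOp (Der k V)
    (fun i => gerstBracket (der k V) der_gerst (-1) i (i - 1) (by ring) ⟨m, hm.1⟩)
    (gerstBracket (der k V) der_gerst)

/-- The `L∞` structure of the sub dg Lie algebra of `ΣC_CE(V,V)` of derivations with vanishing
constant term (the suspended truncated Chevalley-Eilenberg complex). -/
def ceBarOp {m : Cochain k (Susp V) (Susp V)} (hm : IsLInfty m) :
    Cochain k (Susp (DerBar k V)) (Susp (DerBar k V)) :=
  dglaOp (DerBar k V)
    (fun i => gerstBracket (derBar k V) derBar_gerst (-1) i (i - 1) (by ring) ⟨m, hm.1, hm.2.1⟩)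
    (gerstBracket (derBar k V) derBar_gerst)

/-- The (suspended) inclusion of derivations with vanishing constant term into all derivations. -/
def ceInclusion (i : ℤ) : Susp (DerBar k V) i →ₗ[k] Susp (Der k V) i :=
  Submodule.inclusion (derBar_le (i - 1))

variable (k V) in
/-- A suspended derivation, regarded as a linear map `S(ΣV) → ΣV`. -/
def evalDer : (⨁ i, Susp (Der k V) i) →ₗ[k]
    Cochain k (Susp V) (Susp V) :=
  DirectSum.toModule k ℤ _ fun i => (der k V (i - 1)).subtype

section Extension

variable {U : ℤ → Type*} [∀ i, AddCommGroup (U i)] [∀ i, Module k (U i)]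

/-- The inclusion of the fiber `V → V ⊕ U`, suspended. -/
def inFib (i : ℤ) : Susp V i →ₗ[k] Susp (fun i => V i × U i) i := LinearMap.inl k _ _
/-- The inclusion `U → V ⊕ U`, suspended. -/
def inBase (i : ℤ) : Susp U i →ₗ[k] Susp (fun i => V i × U i) i := LinearMap.inr k _ _
/-- The projection `V ⊕ U → V`, suspended. -/
def prFib (i : ℤ) : Susp (fun i => V i × U i) i →ₗ[k] Susp V i := LinearMap.fst k _ _
/-- The projection to the base `V ⊕ U → U`, suspended. -/
def prBase (i : ℤ) : Susp (fun i => V i × U i) i →ₗ[k] Susp U i := LinearMap.snd k _ _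

/-- The structure on `V ⊕ U` of the extension `V → V ⊕ U → U` of `(U, q)` by `(V, m)`
corresponding to an `L∞` map `f : U → ΣC_CE(V,V)`. On `u ∈ S(ΣU)`, `x ∈ S(ΣV)` the
component in `ΣU` is `q` (and vanishes if a factor from `V` is present), and the component in `ΣV` is
`ε(u) m(x) + f(u)(x)`. In other words, over the base `Ŝ(Σ⁻¹U*)` the derivation `m` is perturbed by
the Maurer-Cartan element in `Ŝ(Σ⁻¹U*)₊ ⊗ Der Ŝ(Σ⁻¹V*)` given by `f`. -/
def extOp (m : Cochain k (Susp V) (Susp V))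
    (q : Cochain k (Susp U) (Susp U))
    (f : Cochain k (Susp U) (Susp (Der k V))) :
    Cochain k (Susp fun i => V i × U i) (Susp fun i => V i × U i) :=
  DirectSum.lmap (inFib (U := U)) ∘ₗ
      (m ∘ₗ (symMap (prFib (U := U))).toLinearMap +
        TensorProduct.lift (evalDer k V) ∘ₗ
          TensorProduct.map (f ∘ₗ (symMap (prBase (V := V))).toLinearMap)
            (symMap (prFib (U := U))).toLinearMap ∘ₗ
          comul k (Susp fun i => V i × U i)) +
    DirectSum.lmap (inBase (V := V)) ∘ₗ q ∘ₗ (symMap (prBase (V := V))).toLinearMap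

end Extension

/-- The total space `V ⊕ ΣC_CE(V,V)` of the universal extension with fiber `(V, m)`: the extension
corresponding to the identity map of `ΣC_CE(V,V)`. -/
def universalOp {m : Cochain k (Susp V) (Susp V)} (hm : IsLInfty m) :
    Cochain k (Susp fun i => V i × Der k V i) (Susp fun i => V i × Der k V i) :=
  extOp (U := Der k V) m (ceOp hm) (proj k (Susp (Der k V)))

/-- `twist m s` is the linear map `t ↦ m(st) - ε(t) m(s) - ε(s) m(t)`. -/
def twist (m : Cochain k (Susp V) (Susp V)) :
    SymAlg k (Susp V) →ₗ[k] Cochain k (Susp V) (Susp V) :=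
  (LinearMap.mul k (SymAlg k (Susp V))).compr₂ m -
    LinearMap.smulRightₗ (counit k (Susp V)).toLinearMap ∘ₗ m -
    (counit k (Susp V)).toLinearMap.smulRight m

theorem twist_apply (m : Cochain k (Susp V) (Susp V)) (s t : SymAlg k (Susp V)) :
    twist m s t = m (s * t) - counit k (Susp V) t • m s - counit k (Susp V) s • m t := by
  simp [twist]

theorem twist_mem {m : Cochain k (Susp V) (Susp V)} (hm : IsLInfty m) (n : ℤ)
    (s : grade k (Susp V) n) : twist m s ∈ derBar k V (n - 1) := by
  refine ⟨fun p t ht => ?_, ?_⟩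
  · rw [twist_apply]
    refine sub_mem (sub_mem ?_ ?_) ?_
    · exact range_lof_congr (by omega) (hm.1 _ _ (SetLike.mul_mem_graded s.2 ht))
    · exact counit_smulRight_mem (hm.1 _ _ s.2) p t ht
    · rcases eq_or_ne n 0 with rfl | hn
      · exact Submodule.smul_mem _ _ (range_lof_congr (by omega) (hm.1 _ _ ht))
      · rw [counit_eq_zero hn s.2, zero_smul]
        exact zero_mem _
  · change twist m s 1 = 0
    rw [twist_apply, hm.2.1]
    simp

/-- The canonical (non-strict) `L∞` map from `(V, m)` to its suspended truncated Chevalley-Eilenberg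
complex: its `n`-th component, `n ≥ 1`, sends `x₁ ⋯ xₙ` to the derivation with components
`y₁ ⋯ yᵣ ↦ m(x₁ ⋯ xₙ y₁ ⋯ yᵣ)`, `r ≥ 1`, and with vanishing constant term. -/
def toTruncCE {m : Cochain k (Susp V) (Susp V)} (hm : IsLInfty m) :
    Cochain k (Susp V) (Susp (DerBar k V)) :=
  DirectSum.lmap (fun n => (twist m ∘ₗ (grade k (Susp V) n).subtype).codRestrict
      (derBar k V (n - 1)) (twist_mem hm n)) ∘ₗ
    (DirectSum.decomposeLinearEquiv (grade k (Susp V))).toLinearMap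

end CE
end
end LInf

/-! The map `β` is the strict inclusion of the derivations without constant term into the second
summand of `V`. It is strict because the fiber component of the structure on `V` evaluates a
derivation on elements of `S(ΣI)`, and these derivations vanish on `1`. The linear differential of
`V` sends a pair (fiber element `w`, derivation `u`) to a pair with fiber component `u(1) + m(w)`.
So constant derivations map isomorphically onto the fiber, the quotient of `V` by the image of `β`
is acyclic, and `β` is a quasi-isomorphism (`IsSplit.isQuasiIso_reduction`). The square over the
base commutes strictly.

The square under the fiber needs a homotopy. It is the path `extPath` of maps `I → V` with fiber
component `t x` and base component `y ↦ m((1-t)^{|x|} x y) - (1-t) ε(y) m(x)`, from which the value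
at `x = 1` is removed. Here `|x|` is the number of factors of `x`. At `t = 0` it is `β` after `ι`,
and at `t = 1` it is the inclusion of the fiber. In the fiber, the `L∞` equation is the binomial
theorem `conv_scale_scale`: distributing factors with weights `1-t` and `t` gives total weight `1`,
which leaves `m - (1-t) m = t m`. In the base, it is the Maurer-Cartan equation
`bconv_preLie_scaledTwist`, a consequence of `m ∘ D_m = 0` evaluated on products. The `dt` component
of the homotopy sends `x` to the constant derivation with value `x`, for every `t`. Inserting it
into the structure of `V` gives the `t`-derivative of the path, up to a term cancelled by
precomposition with `D_m` (`IsSplit.extStr_comp_conv_gen`, `IsSplit.homotopic_extPath`).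

The dg Lie structure enters only through one equation. Let `Θ` send `1` to `m`, a suspended
derivation to itself and longer products to zero. Then `evSusp_comp_dglaOp` says that the structure
`q` on derivations satisfies `ev ∘ q = -(Θτ * Θ)` for the pre-Lie product, where `τ` is the sign
operator. Associativity of composition in `End S(ΣI)` turns this into `q ∘ D_q = 0`, and evaluation
on `S(ΣI)` turns it into the square-zero equation on `V`.

Sums over unshuffles are never written out. Each convolution identity is proved by splitting off one
generator (`comul_gen_mul`), and convolution exponentials are characterised by the resulting
recursion (`eq_of_conv_recursion`). -/

namespace LInf
noncomputable section

/-! ### Koszul signs depend only on parity. -/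

section Signs

variable {k : Type*} [Field k]

theorem sgn_congr {a b : ℤ} (h : Even (a - b)) : sgn k a = sgn k b := by
  unfold sgn
  rw [(Int.negOnePow_eq_iff a b).2 h]

theorem sgn_add (a b : ℤ) : sgn k (a + b) = sgn k a * sgn k b := by
  unfold sgn
  rw [Int.negOnePow_add]
  push_cast
  rfl

@[simp] theorem sgn_zero : sgn k 0 = 1 := by simp [sgn]

theorem sgn_of_even {a : ℤ} (h : Even a) : sgn k a = 1 := by
  rw [← sgn_zero]
  exact sgn_congr (by simpa using h)

theorem sgn_of_odd {a : ℤ} (h : Odd a) : sgn k a = -1 := by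
  unfold sgn
  rw [Int.negOnePow_odd a h]
  simp

@[simp] theorem sgn_neg_one : sgn k (-1) = -1 := sgn_of_odd (by decide)

@[simp] theorem sgn_mul_self (a : ℤ) : sgn k a * sgn k a = 1 := by
  rw [← sgn_add]
  exact sgn_of_even ⟨a, rfl⟩

end Signs

/-! ### Coproduct recursion, coassociativity and cocommutativity, in terms of convolutions. -/

section Convolution

variable {k : Type*} [Field k] {W : ℤ → Type*} [∀ i, AddCommGroup (W i)] [∀ i, Module k (W i)]

theorem mon_induction {P : SymAlg k W → Prop} (one : P 1)
    (gen_mul : ∀ i (x : W i) s, P s → P (gen₁ k W i x * s))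
    (add : ∀ s t, P s → P t → P (s + t)) (smul : ∀ (c : k) s, P s → P (c • s))
    (s : SymAlg k W) : P s := by
  have hs : s ∈ Submodule.span k (Set.range (mon k W)) := by rw [span_mon]; trivial
  induction hs using Submodule.span_induction with
  | mem s hs =>
    obtain ⟨l, rfl⟩ := hs
    induction l with
    | nil => exact one
    | cons x l ih => rw [mon_cons]; exact gen_mul _ _ _ ih
  | zero => simpa using smul 0 1 one
  | add s t _ _ h1 h2 => exact add _ _ h1 h2
  | smul c s _ h => exact smul _ _ h

theorem grade_induction {P : SymAlg k W → Prop}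
    (homog : ∀ n, ∀ s ∈ grade k W n, P s)
    (add : ∀ s t, P s → P t → P (s + t)) (s : SymAlg k W) : P s := by
  induction s using DirectSum.Decomposition.inductionOn (grade k W) with
  | zero => exact homog 0 0 (zero_mem _)
  | homogeneous s => exact homog _ _ s.2
  | add s t h1 h2 => exact add _ _ h1 h2

theorem linearMap_ext_grade {M : Type*} [AddCommGroup M] [Module k M] {f g : SymAlg k W →ₗ[k] M}
    (h : ∀ n, ∀ s ∈ grade k W n, f s = g s) : f = g := by
  ext1 s
  exact grade_induction (P := fun s => f s = g s) h
    (fun s t h1 h2 => by rw [map_add, map_add, h1, h2]) s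

variable {U : ℤ → Type*} [∀ i, AddCommGroup (U i)] [∀ i, Module k (U i)]

theorem symMap_gen (f : ∀ i, W i →ₗ[k] U i) (x : ⨁ i, W i) :
    symMap f (gen k W x) = gen k U (DirectSum.lmap f x) :=
  symLift_gen (W := W) _ _ _

theorem symMap_gen₁ (f : ∀ i, W i →ₗ[k] U i) (i : ℤ) (x : W i) :
    symMap f (gen₁ k W i x) = gen₁ k U i (f i x) := by
  rw [symMap_gen, DirectSum.lmap_lof]

theorem symMap_mem (f : ∀ i, W i →ₗ[k] U i) {n : ℤ} {s : SymAlg k W} (hs : s ∈ grade k W n) :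
    symMap f s ∈ grade k U n := by
  have h : grade k W n ≤ (grade k U n).comap (symMap f).toLinearMap := by
    conv_lhs => unfold grade
    rw [Submodule.span_le]
    rintro _ ⟨l, rfl, rfl⟩
    change symMap f (mon k W l) ∈ grade k U (mdeg W l)
    clear hs
    induction l with
    | nil => rw [mon_nil, map_one]; exact mon_mem k U []
    | cons x l ih =>
      rw [mon_cons, map_mul, mdeg_cons, symMap_gen₁]
      exact SetLike.mul_mem_graded (gen_mem k U _ _) ih
  exact h hs

theorem counit_gen (x : ⨁ i, W i) : counit k W (gen k W x) = 0 := symLift_gen (W := W) _ _ _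

theorem counit_symMap (f : ∀ i, W i →ₗ[k] U i) (s : SymAlg k W) :
    counit k U (symMap f s) = counit k W s := by
  have : (counit k U).comp (symMap f) = counit k W := by
    apply sym_algHom_ext
    intro i x
    rw [AlgHom.comp_apply, symMap_gen, counit_gen, counit_gen]
  exact DFunLike.congr_fun this s

theorem symMap_comp {T : ℤ → Type*} [∀ i, AddCommGroup (T i)] [∀ i, Module k (T i)]
    (g : ∀ i, U i →ₗ[k] T i) (f : ∀ i, W i →ₗ[k] U i) (s : SymAlg k W) :
    symMap g (symMap f s) = symMap (fun i => g i ∘ₗ f i) s := by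
  have : (symMap g).comp (symMap f) = symMap (fun i => g i ∘ₗ f i) := by
    apply sym_algHom_ext
    intro i x
    rw [AlgHom.comp_apply, symMap_gen₁, symMap_gen₁, symMap_gen₁]
    rfl
  exact DFunLike.congr_fun this s

theorem symMap_id (s : SymAlg k W) : symMap (fun i => (LinearMap.id : W i →ₗ[k] W i)) s = s := by
  have : symMap (fun i => (LinearMap.id : W i →ₗ[k] W i)) = AlgHom.id k _ := by
    apply sym_algHom_ext
    intro i x
    rw [symMap_gen₁]
    rfl
  exact DFunLike.congr_fun this s

theorem symMap_zero (s : SymAlg k W) :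
    symMap (fun i => (0 : W i →ₗ[k] U i)) s = algebraMap k _ (counit k W s) := by
  have : symMap (fun i => (0 : W i →ₗ[k] U i)) = (Algebra.ofId k _).comp (counit k W) := by
    apply sym_algHom_ext
    intro i x
    rw [symMap_gen₁, AlgHom.comp_apply, counit_gen]
    simp [gen₁]
  exact DFunLike.congr_fun this s

theorem proj_gen_mul (x : ⨁ i, W i) (s : SymAlg k W) :
    proj k W (gen k W x * s) = counit k W s • x := by
  induction s using mon_induction with
  | one => rw [mul_one, proj_gen, map_one, one_smul]
  | gen_mul i y s _ => rw [← mul_assoc, proj_gen_mul_gen, counit_gen_mul, zero_smul]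
  | add s t h1 h2 => rw [mul_add, map_add, map_add, add_smul, h1, h2]
  | smul c s h => rw [mul_smul_comm, map_smul, map_smul, h, smul_assoc]

theorem proj_symMap (f : ∀ i, W i →ₗ[k] U i) (s : SymAlg k W) :
    proj k U (symMap f s) = DirectSum.lmap f (proj k W s) := by
  induction s using mon_induction with
  | one => rw [map_one, proj_one, proj_one, map_zero]
  | gen_mul i y s _ =>
    rw [map_mul, symMap_gen, proj_gen_mul, proj_gen_mul, map_smul, counit_symMap]
  | add s t h1 h2 => simp only [map_add, h1, h2]
  | smul c s h => simp only [map_smul, h]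

variable (k W) in
/-- The operator `s ↦ (-1)^{d|s|} s` on `S(W)`. -/
def tau (d : ℤ) : SymAlg k W →ₐ[k] SymAlg k W :=
  symMap fun i => sgn k (d * i) • (LinearMap.id : W i →ₗ[k] W i)

theorem tau_gen_mul (d i : ℤ) (x : W i) (s : SymAlg k W) :
    tau k W d (gen₁ k W i x * s) = sgn k (d * i) • (gen₁ k W i x * tau k W d s) := by
  unfold tau
  rw [map_mul, symMap_gen₁]
  simp [gen₁]

theorem tau_of_mem (d : ℤ) {n : ℤ} {s : SymAlg k W} (hs : s ∈ grade k W n) :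
    tau k W d s = sgn k (d * n) • s := by
  have h : grade k W n ≤
      LinearMap.eqLocus (tau k W d).toLinearMap (sgn k (d * n) • LinearMap.id) := by
    conv_lhs => unfold grade
    rw [Submodule.span_le]
    rintro _ ⟨l, rfl, rfl⟩
    change tau k W d (mon k W l) = sgn k (d * mdeg W l) • mon k W l
    clear hs
    induction l with
    | nil => simp
    | cons x l ih =>
      rw [mon_cons, tau_gen_mul, ih, mdeg_cons, mul_add, sgn_add, mul_smul_comm, smul_smul]
  exact h hs

theorem tau_tau (d e : ℤ) (s : SymAlg k W) : tau k W d (tau k W e s) = tau k W (d + e) s := by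
  refine DFunLike.congr_fun (linearMap_ext_grade (f := (tau k W d).toLinearMap ∘ₗ
    (tau k W e).toLinearMap) (g := (tau k W (d + e)).toLinearMap) fun n s hs => ?_) s
  simp only [LinearMap.comp_apply, AlgHom.toLinearMap_apply, tau_of_mem _ hs, map_smul]
  rw [smul_smul, ← sgn_add]
  congr 2
  ring

theorem tau_of_even {d : ℤ} (h : Even d) (s : SymAlg k W) : tau k W d s = s := by
  refine DFunLike.congr_fun (linearMap_ext_grade (f := (tau k W d).toLinearMap)
    (g := LinearMap.id) fun n s hs => ?_) s
  rw [AlgHom.toLinearMap_apply, tau_of_mem _ hs, sgn_of_even (h.mul_right n), one_smul]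
  rfl

theorem counit_tau (d : ℤ) (s : SymAlg k W) : counit k W (tau k W d s) = counit k W s :=
  counit_symMap _ _

/-- The generator is primitive and the coproduct is multiplicative, so `x` joins either the left or
the right factor. In the second case it passes the left factor, and `tau` records the sign. This
recursion is the engine for all identities about convolutions. -/
theorem comul_gen_mul (i : ℤ) (x : W i) (s : SymAlg k W) :
    comul k W (gen₁ k W i x * s) =
      TensorProduct.map (LinearMap.mulLeft k (gen₁ k W i x)) LinearMap.id (comul k W s) +
      TensorProduct.map (tau k W i).toLinearMap (LinearMap.mulLeft k (gen₁ k W i x))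
        (comul k W s) := by
  have hof : ∀ a b : SymAlg k W, GradedTensorProduct.of k (grade k W) (grade k W) (a ⊗ₜ b) =
      (a ᵍ⊗ₜ[k] b : grade k W ᵍ⊗[k] grade k W) := fun _ _ => rfl
  have key : ∀ z : SymAlg k W ⊗[k] SymAlg k W,
      comulHom k W (gen₁ k W i x) * GradedTensorProduct.of k (grade k W) (grade k W) z =
      GradedTensorProduct.of k (grade k W) (grade k W)
        (TensorProduct.map (LinearMap.mulLeft k (gen₁ k W i x)) LinearMap.id z +
          TensorProduct.map (tau k W i).toLinearMap (LinearMap.mulLeft k (gen₁ k W i x)) z) := by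
    intro z
    have hx : comulHom k W (gen₁ k W i x) =
        (gen₁ k W i x ᵍ⊗ₜ[k] (1 : SymAlg k W) + (1 : SymAlg k W) ᵍ⊗ₜ[k] gen₁ k W i x :
          grade k W ᵍ⊗[k] grade k W) := symLift_gen (W := W) _ _ _
    rw [hx]
    induction z using TensorProduct.induction_on with
    | zero => simp only [map_zero, mul_zero, add_zero]
    | add u v hu hv =>
      simp only [map_add, mul_add] at hu hv ⊢
      rw [hu, hv]
      abel
    | tmul a b =>
      revert a
      refine grade_induction ?_ ?_
      · intro n a ha
        have e1 := GradedTensorProduct.tmul_one_mul_coe_tmul (R := k) (grade k W) (grade k W)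
          (gen₁ k W i x) (⟨_, ha⟩ : grade k W n) b
        have e2 := GradedTensorProduct.tmul_coe_mul_coe_tmul (R := k) (grade k W) (grade k W)
          (1 : SymAlg k W) (⟨_, gen_mem k W i x⟩ : grade k W i) (⟨_, ha⟩ : grade k W n) b
        rw [one_mul, Units.smul_def, ← Int.cast_smul_eq_zsmul k] at e2
        rw [TensorProduct.map_tmul, TensorProduct.map_tmul, AlgHom.toLinearMap_apply,
          tau_of_mem _ ha, map_add, ← TensorProduct.smul_tmul', map_smul, hof, hof, hof, add_mul,
          e1, e2]
        rfl
      · intro a a' h1 h2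
        simp only [TensorProduct.add_tmul, map_add, mul_add] at h1 h2 ⊢
        rw [h1, h2]
        abel
  unfold comul
  simp only [LinearMap.comp_apply, AlgHom.toLinearMap_apply, map_mul, LinearEquiv.coe_coe]
  rw [LinearEquiv.symm_apply_eq, ← key, LinearEquiv.apply_symm_apply]

variable {P Q R : Type*} [AddCommGroup P] [Module k P] [AddCommGroup Q] [Module k Q]
  [AddCommGroup R] [Module k R]

/-- The convolution `B ∘ (a ⊗ b) ∘ Δ` of `a` and `b` along a bilinear map `B`. -/
def bconv (B : P →ₗ[k] Q →ₗ[k] R) (a : SymAlg k W →ₗ[k] P) (b : SymAlg k W →ₗ[k] Q) :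
    SymAlg k W →ₗ[k] R :=
  TensorProduct.lift B ∘ₗ TensorProduct.map a b ∘ₗ comul k W

theorem conv_eq_bconv {A : Type*} [Ring A] [Algebra k A] (a b : SymAlg k W →ₗ[k] A) :
    conv a b = bconv (LinearMap.mul k A) a b := rfl

section bconv
variable (B : P →ₗ[k] Q →ₗ[k] R)

theorem bconv_one (a : SymAlg k W →ₗ[k] P) (b : SymAlg k W →ₗ[k] Q) :
    bconv B a b 1 = B (a 1) (b 1) := by
  simp [bconv, comul_one]

theorem bconv_add_left (a a' : SymAlg k W →ₗ[k] P) (b : SymAlg k W →ₗ[k] Q) :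
    bconv B (a + a') b = bconv B a b + bconv B a' b := by
  simp only [bconv, TensorProduct.map_add_left, LinearMap.add_comp, LinearMap.comp_add]

theorem bconv_add_right (a : SymAlg k W →ₗ[k] P) (b b' : SymAlg k W →ₗ[k] Q) :
    bconv B a (b + b') = bconv B a b + bconv B a b' := by
  simp only [bconv, TensorProduct.map_add_right, LinearMap.add_comp, LinearMap.comp_add]

theorem bconv_smul_left (c : k) (a : SymAlg k W →ₗ[k] P) (b : SymAlg k W →ₗ[k] Q) :
    bconv B (c • a) b = c • bconv B a b := by
  simp only [bconv, TensorProduct.map_smul_left, LinearMap.smul_comp, LinearMap.comp_smul]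

theorem bconv_smul_right (c : k) (a : SymAlg k W →ₗ[k] P) (b : SymAlg k W →ₗ[k] Q) :
    bconv B a (c • b) = c • bconv B a b := by
  simp only [bconv, TensorProduct.map_smul_right, LinearMap.smul_comp, LinearMap.comp_smul]

theorem bconv_neg_left (a : SymAlg k W →ₗ[k] P) (b : SymAlg k W →ₗ[k] Q) :
    bconv B (-a) b = -bconv B a b := by
  rw [← neg_one_smul k, bconv_smul_left, neg_one_smul]

theorem bconv_neg_right (a : SymAlg k W →ₗ[k] P) (b : SymAlg k W →ₗ[k] Q) :
    bconv B a (-b) = -bconv B a b := by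
  rw [← neg_one_smul k, bconv_smul_right, neg_one_smul]

theorem bconv_sub_left (a a' : SymAlg k W →ₗ[k] P) (b : SymAlg k W →ₗ[k] Q) :
    bconv B (a - a') b = bconv B a b - bconv B a' b := by
  rw [sub_eq_add_neg, bconv_add_left, bconv_neg_left, sub_eq_add_neg]

theorem bconv_sub_right (a : SymAlg k W →ₗ[k] P) (b b' : SymAlg k W →ₗ[k] Q) :
    bconv B a (b - b') = bconv B a b - bconv B a b' := by
  rw [sub_eq_add_neg, bconv_add_right, bconv_neg_right, sub_eq_add_neg]

theorem bconv_zero_left (b : SymAlg k W →ₗ[k] Q) : bconv B 0 b = 0 := by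
  simp [bconv]

theorem bconv_zero_right (a : SymAlg k W →ₗ[k] P) : bconv B a 0 = 0 := by
  simp [bconv]

theorem comp_bconv {R' : Type*} [AddCommGroup R'] [Module k R'] (g : R →ₗ[k] R')
    (a : SymAlg k W →ₗ[k] P) (b : SymAlg k W →ₗ[k] Q) :
    g ∘ₗ bconv B a b = bconv (B.compr₂ g) a b := by
  unfold bconv
  rw [← LinearMap.comp_assoc, TensorProduct.lift_compr₂]

theorem bconv_comp_comp {P' Q' : Type*} [AddCommGroup P'] [Module k P'] [AddCommGroup Q']
    [Module k Q'] (f : P' →ₗ[k] P) (g : Q' →ₗ[k] Q)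
    (a : SymAlg k W →ₗ[k] P') (b : SymAlg k W →ₗ[k] Q') :
    bconv B (f ∘ₗ a) (g ∘ₗ b) = bconv (B.compl₁₂ f g) a b := by
  unfold bconv
  rw [TensorProduct.map_comp, LinearMap.comp_assoc, ← LinearMap.comp_assoc _ _ (TensorProduct.lift B)]
  congr 1
  ext
  simp

variable (k) in
/-- Left multiplication by a homogeneous generator. -/
abbrev lgen (i : ℤ) (x : W i) : SymAlg k W →ₗ[k] SymAlg k W := LinearMap.mulLeft k (gen₁ k W i x)

variable (k W) in
/-- The operator `tau` as a linear map. -/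
abbrev tauL (d : ℤ) : SymAlg k W →ₗ[k] SymAlg k W := (tau k W d).toLinearMap

theorem bconv_lgen (a : SymAlg k W →ₗ[k] P) (b : SymAlg k W →ₗ[k] Q) (i : ℤ) (x : W i) :
    bconv B a b ∘ₗ lgen k i x =
      bconv B (a ∘ₗ lgen k i x) b + bconv B (a ∘ₗ tauL k W i) (b ∘ₗ lgen k i x) := by
  ext1 s
  have h1 : ∀ z, TensorProduct.map (a ∘ₗ lgen k i x) b z =
      TensorProduct.map a b (TensorProduct.map (lgen k i x) LinearMap.id z) := fun z => by
    rw [← LinearMap.comp_apply, ← TensorProduct.map_comp, LinearMap.comp_id]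
  have h2 : ∀ z, TensorProduct.map (a ∘ₗ tauL k W i) (b ∘ₗ lgen k i x) z =
      TensorProduct.map a b (TensorProduct.map (tauL k W i) (lgen k i x) z) := fun z => by
    rw [← LinearMap.comp_apply, ← TensorProduct.map_comp]
  simp only [bconv, LinearMap.comp_apply, LinearMap.add_apply]
  rw [h1, h2, LinearMap.mulLeft_apply, comul_gen_mul, map_add, map_add]

theorem bconv_gen_mul (a : SymAlg k W →ₗ[k] P) (b : SymAlg k W →ₗ[k] Q) (i : ℤ) (x : W i)
    (s : SymAlg k W) : bconv B a b (gen₁ k W i x * s) =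
      bconv B (a ∘ₗ lgen k i x) b s + bconv B (a ∘ₗ tauL k W i) (b ∘ₗ lgen k i x) s :=
  DFunLike.congr_fun (bconv_lgen B a b i x) s

theorem tauL_comp_lgen (d i : ℤ) (x : W i) :
    tauL k W d ∘ₗ lgen k i x = sgn k (d * i) • (lgen k i x ∘ₗ tauL k W d) := by
  ext1 s
  simp only [LinearMap.comp_apply, LinearMap.smul_apply, LinearMap.mulLeft_apply,
    AlgHom.toLinearMap_apply, tau_gen_mul]

theorem tauL_comm (d i : ℤ) : tauL k W d ∘ₗ tauL k W i = tauL k W i ∘ₗ tauL k W d := by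
  ext1 s
  simp only [LinearMap.comp_apply, AlgHom.toLinearMap_apply, tau_tau, add_comm]

theorem comp_tauL_comp_lgen (a : SymAlg k W →ₗ[k] P) (d i : ℤ) (x : W i) :
    (a ∘ₗ tauL k W d) ∘ₗ lgen k i x = sgn k (d * i) • ((a ∘ₗ lgen k i x) ∘ₗ tauL k W d) := by
  ext1 s
  simp only [LinearMap.comp_apply, LinearMap.smul_apply, LinearMap.mulLeft_apply,
    AlgHom.toLinearMap_apply, tau_gen_mul, map_smul]

theorem comp_tauL_comm (a : SymAlg k W →ₗ[k] P) (d i : ℤ) :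
    (a ∘ₗ tauL k W d) ∘ₗ tauL k W i = (a ∘ₗ tauL k W i) ∘ₗ tauL k W d := by
  rw [LinearMap.comp_assoc, tauL_comm d i, LinearMap.comp_assoc]

theorem bconv_tau_apply (d : ℤ) (s : SymAlg k W) :
    ∀ (a : SymAlg k W →ₗ[k] P) (b : SymAlg k W →ₗ[k] Q),
      bconv B a b (tau k W d s) = bconv B (a ∘ₗ tauL k W d) (b ∘ₗ tauL k W d) s := by
  induction s using mon_induction with
  | one =>
    intro a b
    simp only [bconv_one, LinearMap.comp_apply, AlgHom.toLinearMap_apply, map_one]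
  | gen_mul i x s ih =>
    intro a b
    rw [tau_gen_mul, map_smul, bconv_gen_mul, bconv_gen_mul, ih, ih]
    rw [comp_tauL_comp_lgen, comp_tauL_comp_lgen, comp_tauL_comm, bconv_smul_left,
      bconv_smul_right, LinearMap.smul_apply, LinearMap.smul_apply, smul_add]
  | add s t h1 h2 => intro a b; simp only [map_add, h1, h2]
  | smul c s h => intro a b; simp only [map_smul, h]

theorem bconv_tau (d : ℤ) (a : SymAlg k W →ₗ[k] P) (b : SymAlg k W →ₗ[k] Q) :
    bconv B a b ∘ₗ tauL k W d = bconv B (a ∘ₗ tauL k W d) (b ∘ₗ tauL k W d) := by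
  ext1 s
  exact bconv_tau_apply B d s a b

end bconv

/-- Coassociativity. -/
theorem bconv_assoc {P Q R X Y Z : Type*} [AddCommGroup P] [Module k P] [AddCommGroup Q] [Module k Q]
    [AddCommGroup R] [Module k R] [AddCommGroup X] [Module k X] [AddCommGroup Y] [Module k Y]
    [AddCommGroup Z] [Module k Z]
    (B₁ : X →ₗ[k] R →ₗ[k] Z) (B₂ : P →ₗ[k] Q →ₗ[k] X)
    (B₃ : P →ₗ[k] Y →ₗ[k] Z) (B₄ : Q →ₗ[k] R →ₗ[k] Y)
    (h : ∀ p q r, B₁ (B₂ p q) r = B₃ p (B₄ q r))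
    (a : SymAlg k W →ₗ[k] P) (b : SymAlg k W →ₗ[k] Q) (c : SymAlg k W →ₗ[k] R) :
    bconv B₁ (bconv B₂ a b) c = bconv B₃ a (bconv B₄ b c) := by
  ext1 s
  -- The maps must stay general: splitting off a generator replaces them by composites with
  -- multiplication by it and with `tau`.
  revert a b c
  induction s using mon_induction with
  | one => intro a b c; simp only [bconv_one, h]
  | gen_mul i x s ih =>
    intro a b c
    simp only [bconv_gen_mul, bconv_lgen, bconv_tau, bconv_add_left, bconv_add_right,
      LinearMap.add_apply, ih, add_assoc]
  | add s t h1 h2 => intro a b c; simp only [map_add, h1, h2]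
  | smul c s h => intro a b c; simp only [map_smul, h]

/-- Graded cocommutativity. -/
theorem bconv_comm {P Q P' Q' R : Type*} [AddCommGroup P] [Module k P] [AddCommGroup Q] [Module k Q]
    [AddCommGroup P'] [Module k P'] [AddCommGroup Q'] [Module k Q'] [AddCommGroup R] [Module k R]
    (B : P →ₗ[k] Q →ₗ[k] R) (B' : Q' →ₗ[k] P' →ₗ[k] R)
    (a : SymAlg k W →ₗ[k] P) (b : SymAlg k W →ₗ[k] Q)
    (a' : SymAlg k W →ₗ[k] P') (b' : SymAlg k W →ₗ[k] Q')
    (h : ∀ i j, ∀ s ∈ grade k W i, ∀ t ∈ grade k W j, B (a s) (b t) = sgn k (i * j) • B' (b' t) (a' s)) :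
    bconv B a b = bconv B' b' a' := by
  ext1 s
  revert a b a' b' h
  induction s using mon_induction with
  | one =>
    intro a b a' b' h
    have := h 0 0 1 (mon_mem k W []) 1 (mon_mem k W [])
    simpa [bconv_one] using this
  | gen_mul i x s ih =>
    intro a b a' b' h
    -- Transposition exchanges the term with `x` on the left and the term with `x` on the right. The
    -- operator `tau` moves to the other map, where it accounts for the sign of moving `x`.
    rw [bconv_gen_mul, bconv_gen_mul,
      ih (a ∘ₗ lgen k i x) b (a' ∘ₗ lgen k i x) (b' ∘ₗ tauL k W i),
      ih (a ∘ₗ tauL k W i) (b ∘ₗ lgen k i x) a' (b' ∘ₗ lgen k i x), add_comm]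
    · intro n l s hs t ht
      have := h n (i + l) s hs _ (SetLike.mul_mem_graded (gen_mem k W i x) ht)
      simp only [LinearMap.comp_apply, AlgHom.toLinearMap_apply, tau_of_mem _ hs, map_smul,
        LinearMap.mulLeft_apply, LinearMap.smul_apply, this, smul_smul]
      rw [← sgn_add, sgn_congr (b := n * l)]
      exact ⟨i * n, by ring⟩
    · intro n l s hs t ht
      have := h (i + n) l _ (SetLike.mul_mem_graded (gen_mem k W i x) hs) t ht
      simp only [LinearMap.comp_apply, AlgHom.toLinearMap_apply, tau_of_mem _ ht, map_smul,
        LinearMap.mulLeft_apply, this, smul_smul, LinearMap.smul_apply]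
      rw [← sgn_add, add_mul, add_comm]
  | add s t h1 h2 =>
    intro a b a' b' h
    rw [map_add, map_add, h1 a b a' b' h, h2 a b a' b' h]
  | smul c s h1 =>
    intro a b a' b' h
    rw [map_smul, map_smul, h1 a b a' b' h]

theorem bconv_congr {P Q P' Q' R : Type*} [AddCommGroup P] [Module k P] [AddCommGroup Q] [Module k Q]
    [AddCommGroup P'] [Module k P'] [AddCommGroup Q'] [Module k Q'] [AddCommGroup R] [Module k R]
    {B : P →ₗ[k] Q →ₗ[k] R} {B' : P' →ₗ[k] Q' →ₗ[k] R}
    {a : SymAlg k W →ₗ[k] P} {b : SymAlg k W →ₗ[k] Q}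
    {a' : SymAlg k W →ₗ[k] P'} {b' : SymAlg k W →ₗ[k] Q'}
    (h : ∀ i j, ∀ s ∈ grade k W i, ∀ t ∈ grade k W j, B (a s) (b t) = B' (a' s) (b' t)) :
    bconv B a b = bconv B' a' b' := by
  have : TensorProduct.lift B ∘ₗ TensorProduct.map a b =
      TensorProduct.lift B' ∘ₗ TensorProduct.map a' b' := by
    apply TensorProduct.ext
    refine linearMap_ext_grade fun i s hs => linearMap_ext_grade fun j t ht => ?_
    simpa using h i j s hs t ht
  unfold bconv
  rw [← LinearMap.comp_assoc, this, LinearMap.comp_assoc]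

theorem bconv_counit_left (B : P →ₗ[k] Q →ₗ[k] R) (p : P) (b : SymAlg k W →ₗ[k] Q) :
    bconv B ((counit k W).toLinearMap.smulRight p) b = B p ∘ₗ b := by
  ext1 s
  revert b
  induction s using mon_induction with
  | one => intro b; simp [bconv_one]
  | gen_mul i x s ih =>
    intro b
    have h1 : (counit k W).toLinearMap.smulRight p ∘ₗ lgen k i x = 0 := by
      ext1 s; simp [counit_gen]
    have h2 : (counit k W).toLinearMap.smulRight p ∘ₗ tauL k W i =
        (counit k W).toLinearMap.smulRight p := by
      ext1 s; simp [counit_tau]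
    rw [bconv_gen_mul, h1, h2, bconv_zero_left, ih]
    simp
  | add s t h1 h2 => intro b; simp only [map_add, h1, h2]
  | smul c s h => intro b; simp only [map_smul, h]

/-- Cocommutativity reduces this to the left counit law. No sign appears, because the counit lives
in degree `0`. -/
theorem bconv_counit_right (B : P →ₗ[k] Q →ₗ[k] R) (a : SymAlg k W →ₗ[k] P) (q : Q) :
    bconv B a ((counit k W).toLinearMap.smulRight q) = B.flip q ∘ₗ a := by
  rw [← bconv_counit_left (B := B.flip)]
  refine bconv_comm _ _ _ _ _ _ fun i j s hs t ht => ?_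
  rcases eq_or_ne j 0 with rfl | hj
  · simp
  · simp [counit_eq_zero hj ht]

end Convolution
end
end LInf

namespace LInf
noncomputable section

/-! ### Coderivations and coalgebra morphisms, determined by their Taylor coefficients. -/

section Coderivations

variable {k : Type*} [Field k] {W : ℤ → Type*} [∀ i, AddCommGroup (W i)] [∀ i, Module k (W i)]
  {U : ℤ → Type*} [∀ i, AddCommGroup (U i)] [∀ i, Module k (U i)]
  {P Q R : Type*} [AddCommGroup P] [Module k P] [AddCommGroup Q] [Module k Q]
  [AddCommGroup R] [Module k R]

theorem conv_assoc {A : Type*} [Ring A] [Algebra k A] (a b c : SymAlg k W →ₗ[k] A) :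
    conv (conv a b) c = conv a (conv b c) :=
  bconv_assoc _ _ _ _ (fun p q r => by simp [mul_assoc]) a b c

theorem conv_comp_comp {A : Type*} [Ring A] [Algebra k A] (p : P →ₗ[k] A) (q : Q →ₗ[k] A)
    (r : P ⊗[k] Q →ₗ[k] A) (h : ∀ x y, p x * q y = r (x ⊗ₜ y))
    (a : SymAlg k W →ₗ[k] P) (b : SymAlg k W →ₗ[k] Q) (s : SymAlg k W) :
    conv (p ∘ₗ a) (q ∘ₗ b) s = r (TensorProduct.map a b (comul k W s)) := by
  have e : LinearMap.mul' k A ∘ₗ TensorProduct.map p q = r := by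
    ext x y
    exact h x y
  rw [← e, conv, TensorProduct.map_comp]
  rfl

theorem algHom_comp_conv {A B : Type*} [Ring A] [Algebra k A] [Ring B] [Algebra k B]
    (g : A →ₐ[k] B) (a b : SymAlg k W →ₗ[k] A) :
    g.toLinearMap ∘ₗ conv a b = conv (g.toLinearMap ∘ₗ a) (g.toLinearMap ∘ₗ b) := by
  rw [conv_eq_bconv, conv_eq_bconv, comp_bconv, bconv_comp_comp]
  congr 1
  ext a b
  simp

theorem mul_comm_grade {i j : ℤ} {s t : SymAlg k W} (hs : s ∈ grade k W i) (ht : t ∈ grade k W j) :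
    s * t = sgn k (i * j) • (t * s) := by
  have h1 : ∀ (n : ℤ) (x : W n) (l : List (Σ i, W i)),
      gen₁ k W n x * mon k W l = sgn k (n * mdeg W l) • (mon k W l * gen₁ k W n x) := by
    intro n x l
    induction l with
    | nil => simp
    | cons y l ih =>
      rw [mon_cons, mdeg_cons, ← mul_assoc, gen_comm, smul_mul_assoc, mul_assoc, ih, mul_smul_comm,
        smul_smul, ← sgn_add, ← mul_add, mul_assoc]
  have h2 : ∀ l l' : List (Σ i, W i), mon k W l * mon k W l' =
      sgn k (mdeg W l * mdeg W l') • (mon k W l' * mon k W l) := by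
    intro l l'
    induction l with
    | nil => simp
    | cons y l ih =>
      rw [mon_cons, mdeg_cons, mul_assoc, ih, mul_smul_comm, ← mul_assoc, h1, smul_mul_assoc,
        smul_smul, ← sgn_add, ← add_mul, mul_assoc, add_comm]
  unfold grade at hs ht
  induction hs using Submodule.span_induction with
  | zero => simp
  | add s s' _ _ e1 e2 => rw [add_mul, e1, e2, mul_add, smul_add]
  | smul c s _ e => rw [smul_mul_assoc, e, mul_smul_comm, smul_comm]
  | mem s hs =>
    obtain ⟨l, rfl, rfl⟩ := hs
    induction ht using Submodule.span_induction with
    | zero => simp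
    | add s s' _ _ e1 e2 => rw [add_mul, mul_add, e1, e2, smul_add]
    | smul c s _ e => rw [smul_mul_assoc, mul_smul_comm, e, smul_comm]
    | mem t ht =>
      obtain ⟨l', rfl, rfl⟩ := ht
      exact h2 l l'

/-- A coderivation of degree `d` of the coalgebra `S(W)`. -/
structure IsCoderOp (d : ℤ) (T : SymAlg k W →ₗ[k] SymAlg k W) : Prop where
  mem : ∀ n, ∀ s ∈ grade k W n, T s ∈ grade k W (n + d)
  counit_apply : ∀ s, counit k W (T s) = 0
  comul_apply : ∀ s, comul k W (T s) = TensorProduct.map T LinearMap.id (comul k W s) +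
    TensorProduct.map (tauL k W d) T (comul k W s)

theorem IsCoderOp.bconv_comp {d : ℤ} {T : SymAlg k W →ₗ[k] SymAlg k W} (hT : IsCoderOp d T)
    (B : P →ₗ[k] Q →ₗ[k] R) (a : SymAlg k W →ₗ[k] P) (b : SymAlg k W →ₗ[k] Q) :
    bconv B a b ∘ₗ T = bconv B (a ∘ₗ T) b + bconv B (a ∘ₗ tauL k W d) (b ∘ₗ T) := by
  ext1 s
  have h1 : ∀ z, TensorProduct.map (a ∘ₗ T) b z =
      TensorProduct.map a b (TensorProduct.map T LinearMap.id z) := fun z => by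
    rw [← LinearMap.comp_apply, ← TensorProduct.map_comp, LinearMap.comp_id]
  have h2 : ∀ z, TensorProduct.map (a ∘ₗ tauL k W d) (b ∘ₗ T) z =
      TensorProduct.map a b (TensorProduct.map (tauL k W d) T z) := fun z => by
    rw [← LinearMap.comp_apply, ← TensorProduct.map_comp]
  simp only [bconv, LinearMap.comp_apply, LinearMap.add_apply]
  rw [h1, h2, hT.comul_apply, map_add, map_add]

theorem IsCoderOp.comp_tau {d : ℤ} {T : SymAlg k W →ₗ[k] SymAlg k W} (hT : IsCoderOp d T) (e : ℤ)
    (s : SymAlg k W) : T (tau k W e s) = sgn k (d * e) • tau k W e (T s) := by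
  induction s using grade_induction with
  | homog n s hs =>
    rw [tau_of_mem _ hs, tau_of_mem _ (hT.mem _ _ hs), map_smul, smul_smul, ← sgn_add]
    congr 1
    refine sgn_congr ⟨-(d * e), by ring⟩
  | add s t h1 h2 => simp only [map_add, h1, h2, smul_add]

/-- A morphism of graded coalgebras `S(W) → S(U)`. -/
structure IsCoalgOp (F : SymAlg k W →ₗ[k] SymAlg k U) : Prop where
  mem : ∀ n, ∀ s ∈ grade k W n, F s ∈ grade k U n
  counit_apply : ∀ s, counit k U (F s) = counit k W s
  comul_apply : ∀ s, comul k U (F s) = TensorProduct.map F F (comul k W s)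

theorem IsCoalgOp.bconv_comp {F : SymAlg k W →ₗ[k] SymAlg k U} (hF : IsCoalgOp F)
    (B : P →ₗ[k] Q →ₗ[k] R) (a : SymAlg k U →ₗ[k] P) (b : SymAlg k U →ₗ[k] Q) :
    bconv B a b ∘ₗ F = bconv B (a ∘ₗ F) (b ∘ₗ F) := by
  ext1 s
  simp only [bconv, LinearMap.comp_apply]
  rw [hF.comul_apply, TensorProduct.map_comp, LinearMap.comp_apply]

theorem IsCoalgOp.comp_tau {F : SymAlg k W →ₗ[k] SymAlg k U} (hF : IsCoalgOp F) (e : ℤ)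
    (s : SymAlg k W) : F (tau k W e s) = tau k U e (F s) := by
  induction s using grade_induction with
  | homog n s hs =>
    rw [tau_of_mem _ hs, tau_of_mem _ (hF.mem _ _ hs), map_smul]
  | add s t h1 h2 => simp only [map_add, h1, h2]

theorem isCoalgOp_id : IsCoalgOp (LinearMap.id : SymAlg k W →ₗ[k] SymAlg k W) where
  mem _ _ h := h
  counit_apply _ := rfl
  comul_apply s := by rw [TensorProduct.map_id]; rfl

/-- For a primitive generator, the coproduct recursion is exactly the graded Leibniz rule. So every
chain rule for coderivations also gives a recursion in the first generator. -/
theorem isCoderOp_lgen (i : ℤ) (x : W i) : IsCoderOp i (lgen k i x) where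
  mem n s hs := by
    rw [add_comm]
    exact SetLike.mul_mem_graded (gen_mem k W i x) hs
  counit_apply s := counit_gen_mul k W _ s
  comul_apply s := comul_gen_mul i x s

theorem conv_mem {a b : SymAlg k W →ₗ[k] SymAlg k U} {d e n : ℤ}
    (ha : ∀ n, ∀ s ∈ grade k W n, a s ∈ grade k U (n + d))
    (hb : ∀ n, ∀ s ∈ grade k W n, b s ∈ grade k U (n + e))
    {s : SymAlg k W} (hs : s ∈ grade k W n) : conv a b s ∈ grade k U (n + (d + e)) := by
  have h : grade k W n ≤ (grade k U (n + (d + e))).comap (conv a b) := by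
    conv_lhs => unfold grade
    rw [Submodule.span_le]
    rintro _ ⟨l, rfl, rfl⟩
    refine conv_mon_mem a b l (grade k U (mdeg W l + (d + e))) fun l₁ l₂ _ h2 => ?_
    have h3 := SetLike.mul_mem_graded (A := grade k U) (ha _ _ (mon_mem k W l₁))
      (hb _ _ (mon_mem k W l₂))
    rwa [show mdeg W l₁ + d + (mdeg W l₂ + e) = mdeg W l + (d + e) by omega] at h3
  exact h hs

open GradedTensorProduct

variable (k U) in
/-- The inclusion of the left factor into the graded tensor square of `S(U)`. -/
abbrev inclL : SymAlg k U →ₗ[k] (grade k U ᵍ⊗[k] grade k U) :=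
  (includeLeft (grade k U) (grade k U)).toLinearMap

variable (k U) in
/-- The inclusion of the right factor into the graded tensor square of `S(U)`. -/
abbrev inclR : SymAlg k U →ₗ[k] (grade k U ᵍ⊗[k] grade k U) :=
  (includeRight (grade k U) (grade k U)).toLinearMap

theorem inclL_mul_inclR (s t : SymAlg k U) :
    inclL k U s * inclR k U t = GradedTensorProduct.of k (grade k U) (grade k U) (s ⊗ₜ t) := by
  change s ᵍ⊗ₜ[k] (1 : SymAlg k U) * (1 : SymAlg k U) ᵍ⊗ₜ[k] t = s ᵍ⊗ₜ[k] t
  rw [tmul_one_mul_one_tmul]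

theorem inclR_mul_inclL {i j : ℤ} {s t : SymAlg k U} (hs : s ∈ grade k U i) (ht : t ∈ grade k U j) :
    inclR k U s * inclL k U t = sgn k (i * j) • (inclL k U t * inclR k U s) := by
  have e := tmul_coe_mul_coe_tmul (R := k) (grade k U) (grade k U) (1 : SymAlg k U)
    (⟨_, hs⟩ : grade k U i) (⟨_, ht⟩ : grade k U j) (1 : SymAlg k U)
  rw [one_mul, mul_one, Units.smul_def, ← Int.cast_smul_eq_zsmul k] at e
  rw [inclL_mul_inclR]
  exact e

theorem comulHom_gen (x : ⨁ i, U i) :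
    comulHom k U (gen k U x) = inclL k U (gen k U x) + inclR k U (gen k U x) :=
  symLift_gen (W := U) _ _ _

theorem conv_incl (a b : SymAlg k W →ₗ[k] SymAlg k U) (s : SymAlg k W) :
    conv (inclL k U ∘ₗ a) (inclR k U ∘ₗ b) s =
      GradedTensorProduct.of k (grade k U) (grade k U) (TensorProduct.map a b (comul k W s)) := by
  exact conv_comp_comp _ _ (GradedTensorProduct.of k (grade k U) (grade k U)).toLinearMap
    (fun x y => inclL_mul_inclR x y) a b s

theorem of_comul (s : SymAlg k U) :
    GradedTensorProduct.of k (grade k U) (grade k U) (comul k U s) = comulHom k U s := by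
  unfold comul
  rw [LinearMap.comp_apply, LinearEquiv.coe_coe, LinearEquiv.apply_symm_apply]
  rfl

theorem comulHom_comp {F : SymAlg k W →ₗ[k] SymAlg k U} (hF : IsCoalgOp F) :
    (comulHom k U).toLinearMap ∘ₗ F = conv (inclL k U ∘ₗ F) (inclR k U ∘ₗ F) := by
  ext1 s
  rw [conv_incl, ← hF.comul_apply, of_comul]
  rfl

theorem conv_inclR_inclL {d : ℤ} {a F : SymAlg k W →ₗ[k] SymAlg k U}
    (hF : ∀ n, ∀ s ∈ grade k W n, F s ∈ grade k U n)
    (ha : ∀ n, ∀ s ∈ grade k W n, a s ∈ grade k U (n + d)) :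
    conv (inclR k U ∘ₗ a) (inclL k U ∘ₗ F) =
      conv (inclL k U ∘ₗ F ∘ₗ tauL k W d) (inclR k U ∘ₗ a) := by
  refine bconv_comm _ _ _ _ _ _ fun i j s hs t ht => ?_
  have e : tauL k W d t = sgn k (d * j) • t := tau_of_mem _ ht
  simp only [LinearMap.mul_apply', LinearMap.comp_apply]
  rw [inclR_mul_inclL (ha _ _ hs) (hF _ _ ht), e, map_smul, map_smul, smul_mul_assoc, smul_smul,
    ← sgn_add, ← add_mul]

theorem gen_comp_mem {d : ℤ} {b : Cochain k W U} (hb : b ∈ homDeg k W U d) (n : ℤ) (s : SymAlg k W)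
    (hs : s ∈ grade k W n) : (gen k U ∘ₗ b) s ∈ grade k U (n + d) :=
  gen_mem_grade (hb n s hs)

/-- The coderivation along a coalgebra morphism `F` with Taylor coefficients `b`. -/
theorem comul_conv_gen {d : ℤ} {F : SymAlg k W →ₗ[k] SymAlg k U} (hF : IsCoalgOp F)
    {b : Cochain k W U} (hb : b ∈ homDeg k W U d) (s : SymAlg k W) :
    comul k U (conv (gen k U ∘ₗ b) F s) =
      TensorProduct.map (conv (gen k U ∘ₗ b) F) F (comul k W s) +
      TensorProduct.map (F ∘ₗ tauL k W d) (conv (gen k U ∘ₗ b) F) (comul k W s) := by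
  apply (GradedTensorProduct.of k (grade k U) (grade k U)).injective
  rw [map_add, of_comul, ← conv_incl, ← conv_incl]
  -- The values of `b` are generators, hence primitive. Applying the multiplicative coproduct to `b
  -- * F` therefore gives two terms, according to the tensor factor that receives `b`.
  have h1 : (comulHom k U).toLinearMap ∘ₗ (gen k U ∘ₗ b) =
      inclL k U ∘ₗ (gen k U ∘ₗ b) + inclR k U ∘ₗ (gen k U ∘ₗ b) := by
    ext1 s
    exact comulHom_gen _
  have h2 : (comulHom k U).toLinearMap ∘ₗ conv (gen k U ∘ₗ b) F =
      conv (inclL k U ∘ₗ conv (gen k U ∘ₗ b) F) (inclR k U ∘ₗ F) +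
      conv (inclL k U ∘ₗ F ∘ₗ tauL k W d) (inclR k U ∘ₗ conv (gen k U ∘ₗ b) F) := by
    rw [algHom_comp_conv, h1, comulHom_comp hF, conv_eq_bconv, bconv_add_left, ← conv_eq_bconv,
      ← conv_eq_bconv, ← conv_assoc, ← conv_assoc, conv_inclR_inclL hF.mem (gen_comp_mem hb),
      conv_assoc (inclL k U ∘ₗ F ∘ₗ tauL k W d), algHom_comp_conv, algHom_comp_conv]
  exact DFunLike.congr_fun h2 s

theorem counit_conv_gen (b : Cochain k W U) (F : SymAlg k W →ₗ[k] SymAlg k U) (s : SymAlg k W) :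
    counit k U (conv (gen k U ∘ₗ b) F s) = 0 := by
  have : (counit k U).toLinearMap ∘ₗ conv (gen k U ∘ₗ b) F = 0 := by
    rw [algHom_comp_conv]
    have h : (counit k U).toLinearMap ∘ₗ gen k U ∘ₗ b = 0 := by
      ext1 s
      exact counit_gen _
    rw [h, conv_eq_bconv, bconv_zero_left]
  exact DFunLike.congr_fun this s

/-- The projection annihilates products of two or more generators, so only the scalar part of `F`
contributes. That is why compatibility with counits is all that is asked of `F`. -/
theorem proj_conv_gen (b : Cochain k W U) {F : SymAlg k W →ₗ[k] SymAlg k U}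
    (hF : ∀ s, counit k U (F s) = counit k W s) (s : SymAlg k W) :
    proj k U (conv (gen k U ∘ₗ b) F s) = b s := by
  have h : proj k U ∘ₗ conv (gen k U ∘ₗ b) F =
      bconv (LinearMap.lsmul k (⨁ i, U i)).flip b ((counit k W).toLinearMap.smulRight (1 : k)) := by
    rw [conv_eq_bconv, comp_bconv]
    refine bconv_congr fun i j s _ t _ => ?_
    simp [proj_gen_mul, hF]
  have h' := DFunLike.congr_fun h s
  rw [bconv_counit_right] at h'
  simpa using h'

theorem isCoderOp_coder {d : ℤ} {φ : Cochain k W W} (hφ : φ ∈ homDeg k W W d) :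
    IsCoderOp d (coder φ) where
  mem _ _ hs := coder_mem hφ hs
  counit_apply s := counit_conv_gen _ _ s
  comul_apply s := comul_conv_gen isCoalgOp_id hφ s

theorem proj_coder (φ : Cochain k W W) (s : SymAlg k W) : proj k W (coder φ s) = φ s :=
  proj_conv_gen φ (fun _ => rfl) s

theorem counit_coder (φ : Cochain k W W) (s : SymAlg k W) : counit k W (coder φ s) = 0 :=
  counit_conv_gen φ _ s

/-- Cocommutativity of the source and graded commutativity of the target each produce signs. Those
involving the degrees of the arguments cancel, and only the sign of exchanging the two maps remains.
-/
theorem conv_gen_swap {p q : ℤ} {a b : SymAlg k W →ₗ[k] SymAlg k U}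
    (ha : ∀ n, ∀ s ∈ grade k W n, a s ∈ grade k U (n + p))
    (hb : ∀ n, ∀ s ∈ grade k W n, b s ∈ grade k U (n + q)) :
    conv (a ∘ₗ tauL k W q) b = sgn k (p * q) • conv (b ∘ₗ tauL k W p) a := by
  rw [conv_eq_bconv, conv_eq_bconv, ← bconv_smul_right]
  refine bconv_comm _ _ _ _ _ _ fun i j s hs t ht => ?_
  simp only [LinearMap.mul_apply', LinearMap.comp_apply, LinearMap.smul_apply,
    AlgHom.toLinearMap_apply]
  rw [tau_of_mem _ hs, tau_of_mem _ ht, map_smul, map_smul, mul_comm_grade (W := U)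
    (Submodule.smul_mem _ _ (ha _ _ hs)) (hb _ _ ht), smul_mul_assoc, mul_smul_comm,
    mul_smul_comm, smul_smul, smul_smul, smul_smul, ← sgn_add, ← sgn_add, ← sgn_add]
  congr 1
  exact sgn_congr ⟨i * q, by ring⟩

theorem coder_sub (φ ψ : Cochain k W W) : coder (φ - ψ) = coder φ - coder ψ := by
  have h : φ - ψ = φ + (-1 : k) • ψ := by module
  rw [h, coder_add, coder_smul]
  module

/-- A composite of two coderivations has an extra term, in which `φ` and `ψ` act on disjoint sets of
factors. This term is graded symmetric by `conv_gen_swap`, so it disappears from the commutator. -/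
theorem coder_comp_coder {d e : ℤ} {φ ψ : Cochain k W W} (hφ : φ ∈ homDeg k W W d)
    (hψ : ψ ∈ homDeg k W W e) :
    coder φ ∘ₗ coder ψ - sgn k (d * e) • (coder ψ ∘ₗ coder φ) = coder (gerst d e φ ψ) := by
  have h1 : ∀ {d e : ℤ} {φ ψ : Cochain k W W}, φ ∈ homDeg k W W d → ψ ∈ homDeg k W W e →
      coder φ ∘ₗ coder ψ = coder (φ ∘ₗ coder ψ) +
        conv (conv ((gen k W ∘ₗ φ) ∘ₗ tauL k W e) (gen k W ∘ₗ ψ)) LinearMap.id := by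
    intro d e φ ψ hφ hψ
    rw [coder, conv_eq_bconv, (isCoderOp_coder hψ).bconv_comp, ← conv_eq_bconv, ← conv_eq_bconv,
      conv_assoc]
    rfl
  rw [h1 hφ hψ, h1 hψ hφ, conv_gen_swap (gen_comp_mem hφ) (gen_comp_mem hψ), gerst,
    coder_sub, coder_smul, conv_eq_bconv (_ • _), bconv_smul_left, ← conv_eq_bconv]
  module

section CharZero

variable [CharZero k]

/-- For an odd coderivation the square is half the graded commutator with itself. It is thus again a
coderivation, and whether it vanishes can be tested on Taylor coefficients. -/
theorem coder_sq {φ : Cochain k W W} (hφ : φ ∈ homDeg k W W (-1)) :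
    coder φ ∘ₗ coder φ = coder (φ ∘ₗ coder φ) := by
  have h := coder_comp_coder hφ hφ
  have h1 : sgn k (-1 * -1) = -1 := sgn_of_odd (by decide)
  have h2 : (2 : k) • (coder φ ∘ₗ coder φ) = (2 : k) • coder (φ ∘ₗ coder φ) := by
    rw [gerst, h1, coder_sub, coder_smul] at h
    calc _ = coder φ ∘ₗ coder φ - (-1 : k) • (coder φ ∘ₗ coder φ) := by module
      _ = _ := h
      _ = _ := by module
  exact smul_right_injective _ two_ne_zero h2

theorem isLInfty_of_comp {q : Cochain k W W} (h : q ∈ homDeg k W W (-1)) (h1 : q 1 = 0)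
    (h2 : q ∘ₗ coder q = 0) : IsLInfty q := by
  refine ⟨h, h1, ?_⟩
  rw [coder_sq h, h2]
  simp [coder, conv]

end CharZero

theorem IsLInfty.comp_coder {q : Cochain k W W} (h : IsLInfty q) : q ∘ₗ coder q = 0 := by
  ext1 s
  rw [LinearMap.comp_apply, ← proj_coder, ← LinearMap.comp_apply (coder q), h.2.2]
  simp

/-! ### The chain rule for the convolution exponential. -/

section Exp

variable {A : Type*} [Ring A] [Algebra k A]

/-- This is the power rule. The hypothesis on `a` allows its derivative to be moved to the front
past the undifferentiated factors, so that all `n + 1` terms of the Leibniz rule coincide. -/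
theorem convPow_comp {d : ℤ} {T : SymAlg k W →ₗ[k] SymAlg k W} (hT : IsCoderOp d T)
    (a : SymAlg k W →ₗ[k] A) (hc : conv (a ∘ₗ tauL k W d) (a ∘ₗ T) = conv (a ∘ₗ T) a) (n : ℕ) :
    convPow a (n + 1) ∘ₗ T = ((n + 1 : ℕ) : k) • conv (a ∘ₗ T) (convPow a n) := by
  have h0 : convPow a 0 ∘ₗ T = 0 := by
    ext1 s
    simp [convPow, hT.counit_apply]
  induction n with
  | zero =>
    change bconv _ a (convPow a 0) ∘ₗ T = _
    rw [hT.bconv_comp, h0, bconv_zero_right, add_zero, zero_add, Nat.cast_one, one_smul]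
    rfl
  | succ n ih =>
    change bconv _ a (convPow a (n + 1)) ∘ₗ T = _
    rw [hT.bconv_comp, ih, bconv_smul_right, ← conv_eq_bconv,
      ← conv_eq_bconv, ← conv_assoc, hc, conv_assoc, Nat.cast_succ (n + 1), add_smul, one_smul,
      add_comm]
    rfl

theorem reduced_of_one {a : SymAlg k W →ₗ[k] A} (ha : a 1 = 0) : reduced a = a := by
  simp [reduced, ha]

/-- The exponential is a finite sum on each element, but of varying length. Allowing every larger
truncation lets different sums be brought to comparable lengths. -/
theorem convExp_eq_sum {a : SymAlg k W →ₗ[k] A} (ha : a 1 = 0) (s : SymAlg k W) :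
    ∃ N, ∀ M, N ≤ M →
      convExp a s = ∑ n ∈ Finset.range M, (n.factorial : k)⁻¹ • convPow a n s := by
  obtain ⟨N, hN⟩ := convPow_finite a ha s
  refine ⟨N, fun M hM => ?_⟩
  change (∑ᶠ n : ℕ, (n.factorial : k)⁻¹ • convPow (reduced a) n s) = _
  rw [reduced_of_one ha]
  apply finsum_eq_finsetSum_of_support_subset
  intro n hn
  rw [Finset.coe_range, Set.mem_Iio]
  by_contra h
  exact hn (by simp only [hN n (by omega), smul_zero])

theorem conv_convExp_eq_sum {a : SymAlg k W →ₗ[k] A} (ha : a 1 = 0) (c : SymAlg k W →ₗ[k] A)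
    (s : SymAlg k W) : ∃ N, ∀ M, N ≤ M →
      conv c (convExp a) s =
        ∑ n ∈ Finset.range M, (n.factorial : k)⁻¹ • conv c (convPow a n) s := by
  -- For arbitrary tensors, a bound for a sum is the maximum of the bounds for its summands.
  have h : ∀ z, ∃ N, ∀ M, N ≤ M →
      LinearMap.mul' k A (TensorProduct.map c (convExp a) z) =
        ∑ n ∈ Finset.range M, (n.factorial : k)⁻¹ •
          LinearMap.mul' k A (TensorProduct.map c (convPow a n) z) := by
    intro z
    induction z using TensorProduct.induction_on with
    | zero => exact ⟨0, fun M _ => by simp⟩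
    | add u v hu hv =>
      obtain ⟨N, hN⟩ := hu
      obtain ⟨N', hN'⟩ := hv
      refine ⟨max N N', fun M hM => ?_⟩
      simp only [map_add, smul_add, Finset.sum_add_distrib, hN M (by omega), hN' M (by omega)]
    | tmul x y =>
      obtain ⟨N, hN⟩ := convExp_eq_sum ha y
      refine ⟨N, fun M hM => ?_⟩
      simp only [TensorProduct.map_tmul, LinearMap.mul'_apply, hN M hM, Finset.mul_sum,
        mul_smul_comm]
  exact h _

theorem convExp_comp [CharZero k] {d : ℤ} {T : SymAlg k W →ₗ[k] SymAlg k W} (hT : IsCoderOp d T)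
    {a : SymAlg k W →ₗ[k] A} (ha : a 1 = 0)
    (hc : conv (a ∘ₗ tauL k W d) (a ∘ₗ T) = conv (a ∘ₗ T) a) :
    convExp a ∘ₗ T = conv (a ∘ₗ T) (convExp a) := by
  ext1 s
  obtain ⟨N, hN⟩ := convExp_eq_sum ha (T s)
  obtain ⟨N', hN'⟩ := conv_convExp_eq_sum ha (a ∘ₗ T) s
  -- The left sum is one term longer: its zeroth term is killed by `T`, and the power rule matches
  -- term `n + 1` with term `n` on the right, the factor `n + 1` turning `1/(n+1)!` into `1/n!`.
  rw [LinearMap.comp_apply, hN (max N N' + 1) (by omega), hN' (max N N') (by omega),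
    Finset.sum_range_succ']
  have h0 : convPow a 0 (T s) = 0 := by simp [convPow, hT.counit_apply]
  rw [h0, smul_zero, add_zero]
  refine Finset.sum_congr rfl fun n _ => ?_
  rw [← LinearMap.comp_apply, convPow_comp hT a hc, LinearMap.smul_apply, smul_smul]
  congr 1
  rw [Nat.factorial_succ, Nat.cast_mul, mul_inv, mul_comm (_⁻¹), mul_assoc, inv_mul_cancel₀,
    mul_one]
  exact_mod_cast n.succ_ne_zero

theorem convExp_one {a : SymAlg k W →ₗ[k] A} (ha : a 1 = 0) : convExp a 1 = 1 := by
  obtain ⟨N, hN⟩ := convExp_eq_sum ha 1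
  rw [hN (N + 1) (by omega), Finset.sum_range_succ', Finset.sum_eq_zero]
  · simp [convPow]
  · intro n _
    have : convPow a (n + 1) 1 = 0 := by
      rw [convPow, conv_eq_bconv, bconv_one, ha]
      simp
    rw [this, smul_zero]

/-- A map satisfying the recursion of a convolution exponential is determined by it. -/
theorem eq_of_conv_recursion {G G' : SymAlg k W →ₗ[k] A} (c : ∀ i, W i → SymAlg k W →ₗ[k] A)
    (h1 : G 1 = G' 1) (hG : ∀ i x, G ∘ₗ lgen k i x = conv (c i x) G)
    (hG' : ∀ i x, G' ∘ₗ lgen k i x = conv (c i x) G') : G = G' := by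
  -- The induction is on the number of generators. After `x` has been absorbed into the coefficient,
  -- the recursion evaluates `G - G'` only on monomials no longer than the remaining list.
  have h : ∀ n, ∀ l : List (Σ i, W i), l.length < n → (G - G') (mon k W l) = 0 := by
    intro n
    induction n with
    | zero => intro l hl; omega
    | succ n ih =>
      intro l hl
      cases l with
      | nil => simp [h1]
      | cons x l =>
        have e : (G - G') (mon k W (x :: l)) = conv (c x.1 x.2) (G - G') (mon k W l) := by
          rw [conv_eq_bconv, bconv_sub_right, ← conv_eq_bconv, ← conv_eq_bconv, ← hG, ← hG',
            mon_cons]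
          rfl
        rw [e]
        refine (Submodule.mem_bot k).1 (conv_mon_mem _ _ l ⊥ fun l₁ l₂ hl' _ => ?_)
        rw [Submodule.mem_bot, ih l₂ (by simp only [List.length_cons] at hl; omega), mul_zero]
  rw [← sub_eq_zero]
  refine LinearMap.ext_on (span_mon k W) ?_
  rintro _ ⟨l, rfl⟩
  exact h _ l (Nat.lt_succ_self _)

end Exp

/-! ### Coalgebra morphisms and `L∞` maps from Taylor coefficients. -/

section CoalgHom

theorem coalgHom_comp [CharZero k] {d : ℤ} {T : SymAlg k W →ₗ[k] SymAlg k W} (hT : IsCoderOp d T)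
    {f : Cochain k W U} (hf : f ∈ homDeg k W U 0) (h1 : f 1 = 0) :
    coalgHom f ∘ₗ T = conv (gen k U ∘ₗ f ∘ₗ T) (coalgHom f) := by
  refine convExp_comp hT (by simp [h1]) ?_
  -- The commutation condition of the power rule holds without a sign because `f` has degree `0`.
  rw [conv_gen_swap (p := 0) (q := d) (gen_comp_mem hf), zero_mul, sgn_zero, one_smul]
  · congr 1
    ext1 s
    simp only [LinearMap.comp_apply, AlgHom.toLinearMap_apply]
    rw [tau_of_even (by simp)]
  · intro n s hs
    simpa using gen_comp_mem hf _ _ (hT.mem _ _ hs)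

theorem coalgHom_one {f : Cochain k W U} (h1 : f 1 = 0) : coalgHom f 1 = 1 :=
  convExp_one (by simp [h1])

theorem coalgHom_mem {f : Cochain k W U} (hf : f ∈ homDeg k W U 0) (h1 : f 1 = 0) (n : ℤ)
    (s : SymAlg k W) (hs : s ∈ grade k W n) : coalgHom f s ∈ grade k U n := by
  obtain ⟨N, hN⟩ := convExp_eq_sum (a := gen k U ∘ₗ f) (by simp [h1]) s
  rw [coalgHom, hN N le_rfl]
  refine Submodule.sum_mem _ fun r hr => Submodule.smul_mem _ _ ?_
  clear hN hr
  induction r generalizing n s with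
  | zero =>
    rcases eq_or_ne n 0 with rfl | hn
    · simp only [convPow, LinearMap.comp_apply, Algebra.linearMap_apply,
        Algebra.algebraMap_eq_smul_one]
      exact Submodule.smul_mem _ _ (mon_mem k U [])
    · simp [convPow, counit_eq_zero hn hs]
  | succ r ih =>
    have := conv_mem (d := 0) (e := 0) (gen_comp_mem hf) (b := convPow (gen k U ∘ₗ f) r)
      (fun n s hs => by simpa using ih n s hs) hs
    rw [add_zero, add_zero] at this
    exact this

theorem strictMap_one (g : ∀ i, W i →ₗ[k] U i) : strictMap g 1 = 0 := by
  simp [strictMap, proj_one]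

theorem proj_mem_homDeg : proj k W ∈ homDeg k W W 0 := by
  intro n s hs
  unfold grade at hs
  induction hs using Submodule.span_induction with
  | mem s hs =>
    obtain ⟨l, rfl, rfl⟩ := hs
    match l with
    | [] => rw [mon_nil, proj_one]; exact zero_mem _
    | x :: l =>
      rw [mon_cons, proj_gen_mul]
      cases l with
      | nil => 
        rw [mon_nil, map_one, one_smul]
        exact range_lof_congr (by simp) ⟨x.2, rfl⟩
      | cons y l => rw [mon_cons, counit_gen_mul, zero_smul]; exact zero_mem _
  | zero => rw [map_zero]; exact zero_mem _
  | add s t _ _ h1 h2 => rw [map_add]; exact add_mem h1 h2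
  | smul c s _ h => rw [map_smul]; exact Submodule.smul_mem _ c h

theorem lmap_mem_range (g : ∀ i, W i →ₗ[k] U i) {n : ℤ} {w : ⨁ i, W i}
    (hw : w ∈ LinearMap.range (DirectSum.lof k ℤ W n)) :
    DirectSum.lmap g w ∈ LinearMap.range (DirectSum.lof k ℤ U n) := by
  obtain ⟨x, rfl⟩ := hw
  exact ⟨g n x, (DirectSum.lmap_lof _ _ _).symm⟩

theorem strictMap_mem (g : ∀ i, W i →ₗ[k] U i) : strictMap g ∈ homDeg k W U 0 :=
  fun n s hs => lmap_mem_range g (proj_mem_homDeg n s hs)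

variable [CharZero k]

/-- In the sum over partitions into blocks, exactly one block contains `x`. Singling it out gives
the recursion that identifies coalgebra morphisms. -/
theorem coalgHom_comp_lgen {f : Cochain k W U} (hf : f ∈ homDeg k W U 0) (h1 : f 1 = 0) (i : ℤ)
    (x : W i) : coalgHom f ∘ₗ lgen k i x = conv (gen k U ∘ₗ f ∘ₗ lgen k i x) (coalgHom f) :=
  coalgHom_comp (isCoderOp_lgen i x) hf h1

theorem counit_coalgHom {f : Cochain k W U} (hf : f ∈ homDeg k W U 0) (h1 : f 1 = 0)
    (s : SymAlg k W) : counit k U (coalgHom f s) = counit k W s := by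
  induction s using mon_induction with
  | one => rw [coalgHom_one h1, map_one, map_one]
  | gen_mul i x s _ =>
    rw [counit_gen_mul]
    have := DFunLike.congr_fun (coalgHom_comp_lgen hf h1 i x) s
    rw [LinearMap.comp_apply, LinearMap.mulLeft_apply] at this
    rw [this, counit_conv_gen]
  | add s t e1 e2 => simp only [map_add, e1, e2]
  | smul c s e => simp only [map_smul, e]

theorem proj_coalgHom {f : Cochain k W U} (hf : f ∈ homDeg k W U 0) (h1 : f 1 = 0)
    (s : SymAlg k W) : proj k U (coalgHom f s) = f s := by
  induction s using mon_induction with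
  | one => rw [coalgHom_one h1, proj_one, h1]
  | gen_mul i x s _ =>
    have := DFunLike.congr_fun (coalgHom_comp_lgen hf h1 i x) s
    rw [LinearMap.comp_apply, LinearMap.mulLeft_apply] at this
    rw [this, proj_conv_gen _ (counit_coalgHom hf h1)]
    rfl
  | add s t e1 e2 => simp only [map_add, e1, e2]
  | smul c s e => simp only [map_smul, e]

theorem isCoalgOp_coalgHom {f : Cochain k W U} (hf : f ∈ homDeg k W U 0) (h1 : f 1 = 0) :
    IsCoalgOp (coalgHom f) where
  mem := coalgHom_mem hf h1
  counit_apply := counit_coalgHom hf h1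
  comul_apply s := by
    apply (GradedTensorProduct.of k (grade k U) (grade k U)).injective
    rw [of_comul, ← conv_incl]
    have hx : ∀ i (x : W i), (comulHom k U).toLinearMap ∘ₗ (gen k U ∘ₗ f ∘ₗ lgen k i x) =
        inclL k U ∘ₗ (gen k U ∘ₗ f ∘ₗ lgen k i x) + inclR k U ∘ₗ (gen k U ∘ₗ f ∘ₗ lgen k i x) := by
      intro i x
      ext1 s
      exact comulHom_gen _
    -- Both sides take values in the graded tensor square and agree on `1`. They satisfy the same
    -- recursion, whose coefficient is the coproduct of the block containing `x`, so uniqueness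
    -- applies.
    have e : (comulHom k U).toLinearMap ∘ₗ coalgHom f =
        conv (inclL k U ∘ₗ coalgHom f) (inclR k U ∘ₗ coalgHom f) := by
      refine eq_of_conv_recursion
        (fun i x => (comulHom k U).toLinearMap ∘ₗ (gen k U ∘ₗ f ∘ₗ lgen k i x)) ?_ ?_ ?_
      · rw [conv_eq_bconv, bconv_one]
        simp only [LinearMap.comp_apply, coalgHom_one h1, AlgHom.toLinearMap_apply, map_one,
          LinearMap.mul_apply', mul_one]
      · intro i x
        rw [LinearMap.comp_assoc, coalgHom_comp_lgen hf h1, algHom_comp_conv]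
      · intro i x
        rw [conv_eq_bconv, bconv_lgen, LinearMap.comp_assoc _ _ (inclL k U),
          LinearMap.comp_assoc _ _ (inclR k U), LinearMap.comp_assoc _ _ (inclL k U),
          coalgHom_comp_lgen hf h1, algHom_comp_conv, algHom_comp_conv, ← conv_eq_bconv,
          ← conv_eq_bconv, ← conv_eq_bconv, hx, conv_eq_bconv (_ + _), bconv_add_left, ← conv_eq_bconv,
          ← conv_eq_bconv, ← conv_assoc (inclR k U ∘ₗ _), conv_inclR_inclL (d := i)
            (coalgHom_mem hf h1), conv_assoc, conv_assoc]
        intro n s hs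
        have := gen_comp_mem hf _ _ (SetLike.mul_mem_graded (gen_mem k W i x) hs)
        rwa [show i + n + 0 = n + i by ring] at this
    exact DFunLike.congr_fun e s

theorem coder_comp_coalgOp {F : SymAlg k W →ₗ[k] SymAlg k U} (hF : IsCoalgOp F)
    (q : Cochain k U U) : coder q ∘ₗ F = conv (gen k U ∘ₗ q ∘ₗ F) F := by
  rw [coder, conv_eq_bconv, hF.bconv_comp, LinearMap.comp_assoc, LinearMap.id_comp, conv_eq_bconv]

/-- Both composites with the differentials are coderivations along `coalgHom f`. The chain rules
write each as the convolution of its Taylor coefficients with `coalgHom f`, so comparing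
coefficients is enough. -/
theorem isLInftyMap_of_comp {q : Cochain k W W} (hq : q ∈ homDeg k W W (-1)) {q' : Cochain k U U}
    {f : Cochain k W U} (hf : f ∈ homDeg k W U 0) (h1 : f 1 = 0)
    (h : q' ∘ₗ coalgHom f = f ∘ₗ coder q) : IsLInftyMap q q' f := by
  refine ⟨hf, h1, ?_⟩
  rw [coder_comp_coalgOp (isCoalgOp_coalgHom hf h1), h, coalgHom_comp (isCoderOp_coder hq) hf h1]

theorem coalgHom_strictMap (g : ∀ i, W i →ₗ[k] U i) :
    coalgHom (strictMap g) = (symMap g).toLinearMap := by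
  refine eq_of_conv_recursion (fun i x => gen k U ∘ₗ strictMap g ∘ₗ lgen k i x) ?_ ?_ ?_
  · rw [coalgHom_one (strictMap_one g), AlgHom.toLinearMap_apply, map_one]
  · intro i x
    rw [coalgHom_comp_lgen (strictMap_mem g) (strictMap_one g)]
  · intro i x
    have h : gen k U ∘ₗ strictMap g ∘ₗ lgen k i x =
        (counit k W).toLinearMap.smulRight (gen₁ k U i (g i x)) := by
      ext1 s
      simp only [LinearMap.comp_apply, strictMap, LinearMap.mulLeft_apply, proj_gen_mul, map_smul,
        DirectSum.lmap_lof, LinearMap.smulRight_apply, AlgHom.toLinearMap_apply]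
    rw [h, conv_eq_bconv, bconv_counit_left]
    ext1 s
    simp only [LinearMap.comp_apply, LinearMap.mulLeft_apply, AlgHom.toLinearMap_apply, map_mul,
      symMap_gen₁, LinearMap.mul_apply']

theorem isCoalgOp_symMap (g : ∀ i, W i →ₗ[k] U i) : IsCoalgOp (symMap g).toLinearMap := by
  rw [← coalgHom_strictMap]
  exact isCoalgOp_coalgHom (strictMap_mem g) (strictMap_one g)

theorem symMap_comp_conv_gen (g : ∀ i, W i →ₗ[k] U i)
    {T : ℤ → Type*} [∀ i, AddCommGroup (T i)] [∀ i, Module k (T i)]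
    (b : Cochain k T W) (F : SymAlg k T →ₗ[k] SymAlg k W) :
    (symMap g).toLinearMap ∘ₗ conv (gen k W ∘ₗ b) F =
      conv (gen k U ∘ₗ DirectSum.lmap g ∘ₗ b) ((symMap g).toLinearMap ∘ₗ F) := by
  rw [algHom_comp_conv]
  congr 1
  ext1 s
  simp only [LinearMap.comp_apply, AlgHom.toLinearMap_apply, symMap_gen]

theorem symMap_comp_coder {g : ∀ i, W i →ₗ[k] U i} {q : Cochain k W W} {q' : Cochain k U U}
    (h : DirectSum.lmap g ∘ₗ q = q' ∘ₗ (symMap g).toLinearMap) :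
    (symMap g).toLinearMap ∘ₗ coder q = coder q' ∘ₗ (symMap g).toLinearMap := by
  rw [coder, symMap_comp_conv_gen, h, coder_comp_coalgOp (isCoalgOp_symMap g), LinearMap.comp_id]

theorem isLInftyMap_strictMap {g : ∀ i, W i →ₗ[k] U i} {q : Cochain k W W} {q' : Cochain k U U}
    (h : DirectSum.lmap g ∘ₗ q = q' ∘ₗ (symMap g).toLinearMap) :
    IsLInftyMap q q' (strictMap g) := by
  refine ⟨strictMap_mem g, strictMap_one g, ?_⟩
  rw [coalgHom_strictMap, symMap_comp_coder h]

theorem symMap_comp_coalgHom {T : ℤ → Type*} [∀ i, AddCommGroup (T i)] [∀ i, Module k (T i)]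
    (g : ∀ i, U i →ₗ[k] T i) {f : Cochain k W U} (hf : f ∈ homDeg k W U 0) (h1 : f 1 = 0) :
    (symMap g).toLinearMap ∘ₗ coalgHom f = coalgHom (DirectSum.lmap g ∘ₗ f) := by
  have h2 : (DirectSum.lmap g ∘ₗ f) 1 = 0 := by simp [h1]
  have h3 : DirectSum.lmap g ∘ₗ f ∈ homDeg k W T 0 := fun n s hs => lmap_mem_range g (hf n s hs)
  refine eq_of_conv_recursion (fun i x => gen k T ∘ₗ (DirectSum.lmap g ∘ₗ f) ∘ₗ lgen k i x) ?_ ?_ ?_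
  · rw [LinearMap.comp_apply, coalgHom_one h1, coalgHom_one h2, AlgHom.toLinearMap_apply, map_one]
  · intro i x
    rw [LinearMap.comp_assoc, coalgHom_comp_lgen hf h1, symMap_comp_conv_gen]
    rfl
  · intro i x
    rw [coalgHom_comp_lgen h3 h2]

end CoalgHom
end Coderivations
end
end LInf

namespace LInf
noncomputable section

/-! ### Symmetrisation and the Maurer-Cartan equation in a convolution algebra. -/

section Generic

variable {k : Type*} [Field k] {W : ℤ → Type*} [∀ i, AddCommGroup (W i)] [∀ i, Module k (W i)]
  {U : ℤ → Type*} [∀ i, AddCommGroup (U i)] [∀ i, Module k (U i)]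
  {P Q R : Type*} [AddCommGroup P] [Module k P] [AddCommGroup Q] [Module k Q]
  [AddCommGroup R] [Module k R]

theorem bconv_add_map (B B' : P →ₗ[k] Q →ₗ[k] R) (a : SymAlg k W →ₗ[k] P)
    (b : SymAlg k W →ₗ[k] Q) : bconv (B + B') a b = bconv B a b + bconv B' a b := by
  have h : TensorProduct.lift (B + B') = TensorProduct.lift B + TensorProduct.lift B' := by
    ext
    simp
  simp only [bconv, h, LinearMap.add_comp]

theorem bconv_mem_homDeg {d : ℤ} {B : P →ₗ[k] Q →ₗ[k] ⨁ i, U i} {a : SymAlg k W →ₗ[k] P}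
    {b : SymAlg k W →ₗ[k] Q}
    (h : ∀ i j, ∀ s ∈ grade k W i, ∀ t ∈ grade k W j,
      B (a s) (b t) ∈ LinearMap.range (DirectSum.lof k ℤ U (i + j + d))) :
    bconv B a b ∈ homDeg k W U d := by
  intro n
  have h : grade k W n ≤ (LinearMap.range (DirectSum.lof k ℤ U (n + d))).comap (bconv B a b) := by
    conv_lhs => unfold grade
    rw [Submodule.span_le]
    rintro _ ⟨l, rfl, rfl⟩
    have h2 : Submodule.span k {z | ∃ l₁ l₂, l₁.length + l₂.length = l.length ∧
        mdeg W l₁ + mdeg W l₂ = mdeg W l ∧ mon k W l₁ ⊗ₜ[k] mon k W l₂ = z} ≤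
        (LinearMap.range (DirectSum.lof k ℤ U (mdeg W l + d))).comap
          (TensorProduct.lift B ∘ₗ TensorProduct.map a b) := by
      rw [Submodule.span_le]
      rintro _ ⟨l₁, l₂, -, h2, rfl⟩
      rw [← h2]
      exact h _ _ _ (mon_mem k W l₁) _ (mon_mem k W l₂)
    exact h2 (comul_mon k W l)
  exact h

/-- Bilinear maps whose difference is odd with respect to cocommutativity have the same
convolution. -/
theorem bconv_eq_of_antisymm [CharZero k] (B B' : P →ₗ[k] Q →ₗ[k] R) (a : SymAlg k W →ₗ[k] P)
    (b : SymAlg k W →ₗ[k] Q)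
    (h : ∀ i j, ∀ s ∈ grade k W i, ∀ t ∈ grade k W j, B (a s) (b t) - B' (a s) (b t) =
      sgn k (i * j) • (B' (a t) (b s) - B (a t) (b s))) : bconv B a b = bconv B' a b := by
  -- Cocommutativity shows that the convolution along `B - B'` equals its own negative, so it
  -- vanishes in characteristic zero.
  have h1 : bconv (B - B') a b = bconv (B' - B) a b := bconv_comm _ _ _ _ _ _ h
  have h2 : bconv (B' - B) a b + bconv (B - B') a b = 0 := by
    rw [← bconv_add_map, sub_add_sub_cancel, sub_self]
    have : TensorProduct.lift (0 : P →ₗ[k] Q →ₗ[k] R) = 0 := by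
      ext p q
      simp
    rw [bconv, this, LinearMap.zero_comp]
  rw [← h1, ← two_smul k] at h2
  have h3 := (smul_eq_zero.1 h2).resolve_left two_ne_zero
  have h4 := bconv_add_map (B - B') B' a b
  rw [h3, zero_add, sub_add_cancel] at h4
  exact h4

/-- If an odd map `X` satisfies the Maurer-Cartan equation `X T = - X * X` for an odd coderivation
`T`, then `X T² = 0`. -/
theorem comp_comp_eq_zero_of_maurerCartan {A : Type*} [Ring A] [Algebra k A]
    {T : SymAlg k W →ₗ[k] SymAlg k W} (hT : IsCoderOp (-1) T) {X : SymAlg k W →ₗ[k] A}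
    (h : X ∘ₗ T = -conv (X ∘ₗ tauL k W (-1)) X) : X ∘ₗ T ∘ₗ T = 0 := by
  have hτ : tauL k W (-1) ∘ₗ tauL k W (-1) = LinearMap.id := by
    ext1 s
    simp only [LinearMap.comp_apply, AlgHom.toLinearMap_apply, tau_tau]
    exact tau_of_even (by decide) s
  have hTτ : tauL k W (-1) ∘ₗ T = -(T ∘ₗ tauL k W (-1)) := by
    ext1 s
    have e := hT.comp_tau (-1) s
    rw [sgn_of_odd (k := k) (by decide)] at e
    simp only [LinearMap.comp_apply, LinearMap.neg_apply, AlgHom.toLinearMap_apply, e]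
    module
  -- Differentiating `Xτ * X` and using the equation again produces `(X * Xτ) * X` and `-X * (Xτ *
  -- X)`. Here `τ` anticommutes with `T` and `τ² = 1`, and associativity cancels the two terms.
  rw [← LinearMap.comp_assoc, h, LinearMap.neg_comp, conv_eq_bconv, hT.bconv_comp,
    LinearMap.comp_assoc, LinearMap.comp_assoc, hTτ, hτ, LinearMap.comp_id, LinearMap.comp_neg,
    ← LinearMap.comp_assoc, h, LinearMap.neg_comp, neg_neg, conv_eq_bconv, bconv_tau,
    LinearMap.comp_assoc, hτ, LinearMap.comp_id, bconv_neg_right, ← conv_eq_bconv,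
    ← conv_eq_bconv, ← conv_eq_bconv, ← conv_eq_bconv, conv_assoc, add_neg_cancel, neg_zero]

end Generic

/-! ### The `L∞` structure of a dg Lie algebra: degree and functoriality. -/

section Dgla

variable {k : Type*} [Field k]
  {g : ℤ → Type*} [∀ i, AddCommGroup (g i)] [∀ i, Module k (g i)]
  {g' : ℤ → Type*} [∀ i, AddCommGroup (g' i)] [∀ i, Module k (g' i)]

/-- The linear part of `dglaOp`. -/
def dglaDiff (d : ∀ i, g i →ₗ[k] g (i - 1)) : (⨁ i, Susp g i) →ₗ[k] ⨁ i, Susp g i :=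
  DirectSum.toModule k ℤ (⨁ i, Susp g i)
      (fun i => -(DirectSum.lof k ℤ (Susp g) (i - 1) ∘ₗ d (i - 1)))

/-- The quadratic part of `dglaOp`. -/
def dglaBracket (br : ∀ i j l, i + j = l → g i →ₗ[k] g j →ₗ[k] g l) :
    (⨁ i, Susp g i) →ₗ[k] (⨁ i, Susp g i) →ₗ[k] ⨁ i, Susp g i :=
  DirectSum.toModule k ℤ ((⨁ i, Susp g i) →ₗ[k] ⨁ i, Susp g i) fun i =>
    LinearMap.flip (DirectSum.toModule k ℤ (Susp g i →ₗ[k] ⨁ i, Susp g i) fun j =>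
      LinearMap.flip (sgn k (i - 1) •
        (br (i - 1) (j - 1) (i + j - 1 - 1) (by ring)).compr₂
          (DirectSum.lof k ℤ (Susp g) (i + j - 1))))

theorem dglaOp_eq (d : ∀ i, g i →ₗ[k] g (i - 1))
    (br : ∀ i j l, i + j = l → g i →ₗ[k] g j →ₗ[k] g l) :
    dglaOp g d br = dglaDiff d ∘ₗ proj k (Susp g) +
      (2 : k)⁻¹ • bconv (dglaBracket br) (proj k (Susp g)) (proj k (Susp g)) := rfl

theorem dglaDiff_lof (d : ∀ i, g i →ₗ[k] g (i - 1)) (i : ℤ) (x : Susp g i) :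
    dglaDiff d (DirectSum.lof k ℤ (Susp g) i x) =
      -DirectSum.lof k ℤ (Susp g) (i - 1) (d (i - 1) x) := by
  unfold dglaDiff
  rw [DirectSum.toModule_lof]
  rfl

theorem dglaBracket_lof (br : ∀ i j l, i + j = l → g i →ₗ[k] g j →ₗ[k] g l) (i j : ℤ)
    (x : Susp g i) (y : Susp g j) :
    dglaBracket br (DirectSum.lof k ℤ (Susp g) i x) (DirectSum.lof k ℤ (Susp g) j y) =
      sgn k (i - 1) • DirectSum.lof k ℤ (Susp g) (i + j - 1)
        (br (i - 1) (j - 1) (i + j - 1 - 1) (by ring) x y) := by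
  unfold dglaBracket
  rw [DirectSum.toModule_lof, LinearMap.flip_apply, DirectSum.toModule_lof]
  rfl

theorem dglaOp_one (d : ∀ i, g i →ₗ[k] g (i - 1))
    (br : ∀ i j l, i + j = l → g i →ₗ[k] g j →ₗ[k] g l) : dglaOp g d br 1 = 0 := by
  rw [dglaOp_eq, LinearMap.add_apply, LinearMap.smul_apply, bconv_one, LinearMap.comp_apply]
  simp [proj_one]

theorem dglaOp_mem (d : ∀ i, g i →ₗ[k] g (i - 1))
    (br : ∀ i j l, i + j = l → g i →ₗ[k] g j →ₗ[k] g l) :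
    dglaOp g d br ∈ homDeg k (Susp g) (Susp g) (-1) := by
  rw [dglaOp_eq]
  refine add_mem ?_ (Submodule.smul_mem _ _ (bconv_mem_homDeg ?_))
  · intro n s hs
    obtain ⟨x, hx⟩ := proj_mem_homDeg n s hs
    rw [LinearMap.comp_apply, ← hx, dglaDiff_lof]
    exact neg_mem (range_lof_congr (by ring) ⟨_, rfl⟩)
  · intro i j s hs t ht
    obtain ⟨x, hx⟩ := proj_mem_homDeg i s hs
    obtain ⟨y, hy⟩ := proj_mem_homDeg j t ht
    rw [← hx, ← hy, dglaBracket_lof]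
    exact Submodule.smul_mem _ _ (range_lof_congr (by ring) ⟨_, rfl⟩)

theorem dglaOp_natural [CharZero k] {d : ∀ i, g i →ₗ[k] g (i - 1)}
    {br : ∀ i j l, i + j = l → g i →ₗ[k] g j →ₗ[k] g l}
    {d' : ∀ i, g' i →ₗ[k] g' (i - 1)} {br' : ∀ i j l, i + j = l → g' i →ₗ[k] g' j →ₗ[k] g' l}
    (f : ∀ i, g i →ₗ[k] g' i) (hd : ∀ i x, f (i - 1) (d i x) = d' i (f i x))
    (hbr : ∀ i j l h x y, f l (br i j l h x y) = br' i j l h (f i x) (f j y)) :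
    DirectSum.lmap (fun i => (f (i - 1) : Susp g i →ₗ[k] Susp g' i)) ∘ₗ dglaOp g d br =
      dglaOp g' d' br' ∘ₗ (symMap fun i => (f (i - 1) : Susp g i →ₗ[k] Susp g' i)).toLinearMap := by
  set F : ∀ i, Susp g i →ₗ[k] Susp g' i := fun i => f (i - 1)
  have hp : proj k (Susp g') ∘ₗ (symMap F).toLinearMap = DirectSum.lmap F ∘ₗ proj k (Susp g) := by
    ext1 s
    exact proj_symMap F s
  have h1 : DirectSum.lmap F ∘ₗ dglaDiff d = dglaDiff d' ∘ₗ DirectSum.lmap F := by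
    refine DirectSum.linearMap_ext _ fun i => ?_
    ext1 x
    simp only [LinearMap.comp_apply, DirectSum.lmap_lof, dglaDiff_lof, map_neg]
    congr 2
    exact hd _ _
  have h2 : (dglaBracket br).compr₂ (DirectSum.lmap F) =
      (dglaBracket br').compl₁₂ (DirectSum.lmap F) (DirectSum.lmap F) := by
    refine DirectSum.linearMap_ext _ fun i => ?_
    ext1 x
    refine DirectSum.linearMap_ext _ fun j => ?_
    ext1 y
    simp only [LinearMap.comp_apply, LinearMap.compr₂_apply, LinearMap.compl₁₂_apply,
      DirectSum.lmap_lof, dglaBracket_lof, map_smul]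
    congr 2
    exact hbr _ _ _ _ _ _
  rw [dglaOp_eq, dglaOp_eq, LinearMap.add_comp, LinearMap.comp_add, LinearMap.smul_comp,
    LinearMap.comp_smul, (isCoalgOp_symMap F).bconv_comp, LinearMap.comp_assoc, hp, comp_bconv, h2,
    bconv_comp_comp, ← LinearMap.comp_assoc, h1, LinearMap.comp_assoc]

end Dgla

/-! ### The pre-Lie product of coderivations and square-zero structures from Maurer-Cartan elements.
-/

section PreLie

variable {k : Type*} [Field k] {W : ℤ → Type*} [∀ i, AddCommGroup (W i)] [∀ i, Module k (W i)]
  {E : ℤ → Type*} [∀ i, AddCommGroup (E i)] [∀ i, Module k (E i)]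

variable (k W) in
/-- The pre-Lie product `φ ∘ D_ψ` of Taylor coefficients of coderivations. -/
def preLie : Cochain k W W →ₗ[k] Cochain k W W →ₗ[k] Cochain k W W :=
  LinearMap.mk₂ k (fun φ ψ => φ ∘ₗ coder ψ) (fun _ _ _ => LinearMap.add_comp _ _ _)
    (fun _ _ _ => LinearMap.smul_comp _ _ _)
    (fun φ ψ ψ' => by rw [coder_add, LinearMap.comp_add])
    (fun c φ ψ => by rw [coder_smul, LinearMap.comp_smul])

theorem preLie_apply (φ ψ : Cochain k W W) : preLie k W φ ψ = φ ∘ₗ coder ψ := rfl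

theorem gerst_eq (d e : ℤ) (φ ψ : Cochain k W W) :
    gerst d e φ ψ = preLie k W φ ψ - sgn k (d * e) • preLie k W ψ φ := rfl

variable (k W) in
/-- The algebra of endomorphisms of the vector space `S(W)`. -/
def EndAlg : Type _ := Module.End k (SymAlg k W)

instance : Ring (EndAlg k W) := inferInstanceAs (Ring (Module.End k (SymAlg k W)))
instance : Algebra k (EndAlg k W) := inferInstanceAs (Algebra k (Module.End k (SymAlg k W)))

variable (k W) in
/-- `coder` as a linear map. -/
def coderL : Cochain k W W →ₗ[k] EndAlg k W where
  toFun := coder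
  map_add' := coder_add
  map_smul' := coder_smul

/-- For `ev : E → Hom(S(W), W)`, the map `S(E) → Hom(S(W), W)` given by `1 ↦ m`, by `ev` on `E`, and
by zero on products of several generators. -/
def pert (ev : (⨁ i, E i) →ₗ[k] Cochain k W W) (m : Cochain k W W) :
    SymAlg k E →ₗ[k] Cochain k W W :=
  ev ∘ₗ proj k E + (counit k E).toLinearMap.smulRight m

variable {ev : (⨁ i, E i) →ₗ[k] Cochain k W W} {m : Cochain k W W}

theorem pert_apply (z : SymAlg k E) : pert ev m z = ev (proj k _ z) + counit k _ z • m := rfl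

theorem pert_one : pert ev m 1 = m := by
  rw [pert_apply, proj_one, map_zero, map_one, one_smul, zero_add]

theorem pert_mem (hev : ∀ n, ∀ v ∈ LinearMap.range (DirectSum.lof k ℤ E n),
      ev v ∈ homDeg k W W (n - 1)) (hm : m ∈ homDeg k W W (-1)) {n : ℤ}
    {z : SymAlg k E} (hz : z ∈ grade k _ n) : pert ev m z ∈ homDeg k W W (n - 1) := by
  rw [pert_apply]
  refine add_mem (hev _ _ (range_lof_congr (by ring) (proj_mem_homDeg n z hz))) ?_
  rcases eq_or_ne n 0 with rfl | hn
  · rw [show (0 : ℤ) - 1 = -1 by norm_num]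
    exact Submodule.smul_mem _ _ hm
  · rw [counit_eq_zero hn hz, zero_smul]
    exact zero_mem _

theorem pert_comp_coder (q : Cochain k E E) : pert ev m ∘ₗ coder q = ev ∘ₗ q := by
  ext1 z
  rw [LinearMap.comp_apply, pert_apply, proj_coder, counit_coder, zero_smul, add_zero]
  rfl

/-- The pre-Lie product and composition of operators differ, but have the same graded commutators.
This gives access to an associative product. -/
theorem coderL_mul_coderL {d e : ℤ} {φ ψ : Cochain k W W} (hφ : φ ∈ homDeg k W W d)
    (hψ : ψ ∈ homDeg k W W e) :
    coderL k W φ * coderL k W ψ - sgn k (d * e) • (coderL k W ψ * coderL k W φ) =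
      coderL k W (preLie k W φ ψ) - sgn k (d * e) • coderL k W (preLie k W ψ φ) := by
  rw [← map_smul, ← map_sub, ← gerst_eq]
  exact coder_comp_coder hφ hψ

theorem smul_sub_smul_eq_of_sub_smul_eq {M : Type*} [AddCommGroup M] [Module k M] {A B C D : M}
    {a b c d : k} (h : A - c • C = B - c • D) (h' : a * c = -(d * b)) :
    a • A - a • B = d • (b • D - b • C) := by
  have h1 : A - B = c • (C - D) := by
    linear_combination (norm := module) h
  rw [← smul_sub, h1, smul_smul, h']
  module

/-- The convolution square of an odd family depends only on graded commutators, since the coproduct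
is cocommutative. Products with equal commutators, here that of `A` and `B` followed by `L`,
therefore have equal convolution squares. -/
theorem conv_eq_comp_bconv_of_commutator {C A : Type*} [AddCommGroup C] [Module k C] [Ring A]
    [Algebra k A] [CharZero k] (B : C →ₗ[k] C →ₗ[k] C) (L : C →ₗ[k] A) (Θ : SymAlg k E →ₗ[k] C)
    (h : ∀ i j, ∀ s ∈ grade k E i, ∀ t ∈ grade k E j,
      L (Θ s) * L (Θ t) - sgn k ((i - 1) * (j - 1)) • (L (Θ t) * L (Θ s)) =
        L (B (Θ s) (Θ t)) - sgn k ((i - 1) * (j - 1)) • L (B (Θ t) (Θ s))) :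
    conv ((L ∘ₗ Θ) ∘ₗ tauL k E (-1)) (L ∘ₗ Θ) = L ∘ₗ bconv B (Θ ∘ₗ tauL k E (-1)) Θ := by
  rw [comp_bconv, LinearMap.comp_assoc, conv_eq_bconv, bconv_comp_comp]
  refine bconv_eq_of_antisymm _ _ _ _ fun i j s hs t ht => ?_
  have e : ∀ i, ∀ s ∈ grade k E i, Θ (tauL k E (-1) s) = sgn k (-1 * i) • Θ s :=
    fun i s hs => by rw [AlgHom.toLinearMap_apply, tau_of_mem _ hs, map_smul]
  -- On degree `i` the family has degree `i - 1`, which explains the commutator sign. Modulo `2` the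
  -- exponents compare as `-i + (i-1)(j-1)` and `1 + ij - j`.
  have h3 : sgn k (-1 * i) * sgn k ((i - 1) * (j - 1)) =
      -(sgn k (i * j) * sgn k (-1 * j)) := by
    rw [← neg_one_mul (sgn k (i * j) * _), ← sgn_neg_one (k := k), ← sgn_add, ← sgn_add,
      ← sgn_add]
    exact sgn_congr ⟨1 - i, by ring⟩
  simp only [LinearMap.compl₁₂_apply, LinearMap.compr₂_apply, LinearMap.mul_apply',
    LinearMap.comp_apply, e i s hs, e j t ht, map_smul, LinearMap.smul_apply]
  exact smul_sub_smul_eq_of_sub_smul_eq (h i j s hs t ht) h3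

/-- The Maurer-Cartan equation for `pert`, in terms of coderivations. -/
theorem coderL_comp_pert [CharZero k] (hev : ∀ n, ∀ v ∈ LinearMap.range (DirectSum.lof k ℤ E n),
      ev v ∈ homDeg k W W (n - 1)) (hm : m ∈ homDeg k W W (-1)) {q : Cochain k E E}
    (hq : ev ∘ₗ q = -bconv (preLie k W) (pert ev m ∘ₗ tauL k E (-1)) (pert ev m)) :
    (coderL k W ∘ₗ pert ev m) ∘ₗ coder q =
      -conv ((coderL k W ∘ₗ pert ev m) ∘ₗ tauL k E (-1)) (coderL k W ∘ₗ pert ev m) := by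
  rw [conv_eq_comp_bconv_of_commutator (preLie k W) (coderL k W) (pert ev m) fun i j s hs t ht =>
    coderL_mul_coderL (pert_mem hev hm hs) (pert_mem hev hm ht), LinearMap.comp_assoc,
    pert_comp_coder, hq, LinearMap.comp_neg]

theorem coderL_injective : Function.Injective (coderL k W) := by
  intro φ ψ h
  ext1 s
  rw [← proj_coder φ, ← proj_coder ψ]
  exact congrArg _ (DFunLike.congr_fun (F := SymAlg k W →ₗ[k] SymAlg k W) h s)

/-- The Jacobi identity is not checked on elements. The family becomes a Maurer-Cartan element with
values in the associative algebra `End S(W)`, so composing it with `D_q²` gives zero, and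
injectivity of `ev` and of `coderL` removes the outer maps. -/
theorem isLInfty_of_maurerCartan [CharZero k]
    (hev : ∀ n, ∀ v ∈ LinearMap.range (DirectSum.lof k ℤ E n), ev v ∈ homDeg k W W (n - 1))
    (hinj : ∀ v, ev v = 0 → v = 0) (hm : m ∈ homDeg k W W (-1)) {q : Cochain k E E}
    (hq0 : q ∈ homDeg k E E (-1)) (hq1 : q 1 = 0)
    (hq : ev ∘ₗ q = -bconv (preLie k W) (pert ev m ∘ₗ tauL k E (-1)) (pert ev m)) : IsLInfty q := by
  refine isLInfty_of_comp hq0 hq1 ?_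
  ext1 s
  apply hinj
  apply coderL_injective
  have := comp_comp_eq_zero_of_maurerCartan (isCoderOp_coder hq0) (coderL_comp_pert hev hm hq)
  have h := DFunLike.congr_fun this s
  rw [LinearMap.comp_apply, LinearMap.comp_apply, LinearMap.comp_apply, ← LinearMap.comp_apply (pert ev m),
    pert_comp_coder] at h
  rw [map_zero]
  exact h

end PreLie
end
end LInf

namespace LInf
noncomputable section

/-! ### Lie subalgebras of coderivations: their `L∞` structure is governed by a Maurer-Cartan
equation. -/

section DerModel

variable {k : Type*} [Field k] {W : ℤ → Type*} [∀ i, AddCommGroup (W i)] [∀ i, Module k (W i)]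
  {g : ℤ → Type*} [∀ i, AddCommGroup (g i)] [∀ i, Module k (g i)]

/-- A graded map from `g` to the coderivations of `S(W)`, regarded as a map from the total space of
the suspension. -/
def evSusp (f : ∀ i, g i →ₗ[k] Cochain k W W) : (⨁ i, Susp g i) →ₗ[k] Cochain k W W :=
  DirectSum.toModule k ℤ _ fun i => f (i - 1)

theorem evSusp_lof (f : ∀ i, g i →ₗ[k] Cochain k W W) (i : ℤ) (x : Susp g i) :
    evSusp f (DirectSum.lof k ℤ (Susp g) i x) = f (i - 1) x := by
  unfold evSusp
  rw [DirectSum.toModule_lof]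

/-- `f` is an embedding of the dg Lie algebra `g` into the coderivations of `S(W)` with the commutator
bracket and the differential `[m, -]`. -/
structure IsDerEmbedding (m : Cochain k W W) (d : ∀ i, g i →ₗ[k] g (i - 1))
    (br : ∀ i j l, i + j = l → g i →ₗ[k] g j →ₗ[k] g l) (f : ∀ i, g i →ₗ[k] Cochain k W W) :
    Prop where
  mem : ∀ i x, f i x ∈ homDeg k W W i
  injective : ∀ i, Function.Injective (f i)
  map_d : ∀ i x, f (i - 1) (d i x) = gerst (-1) i m (f i x)
  map_br : ∀ i j l h x y, f l (br i j l h x y) = gerst i j (f i x) (f j y)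

variable {m : Cochain k W W} {d : ∀ i, g i →ₗ[k] g (i - 1)}
  {br : ∀ i j l, i + j = l → g i →ₗ[k] g j →ₗ[k] g l} {f : ∀ i, g i →ₗ[k] Cochain k W W}

theorem eq_zero_of_component {n : ℤ} {w : ⨁ i, W i}
    (hw : w ∈ LinearMap.range (DirectSum.lof k ℤ W n)) (h : w n = 0) : w = 0 := by
  obtain ⟨x, rfl⟩ := hw
  rw [DirectSum.lof_eq_of, DirectSum.of_eq_same] at h
  rw [h, map_zero]

/-- On a homogeneous argument, the summands of `v` take values in distinct degrees and cannot
interfere. Vanishing of the total operator can then be tested summand by summand. -/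
theorem evSusp_component (hf : ∀ i x, f i x ∈ homDeg k W W i) (v : ⨁ i, Susp g i) {n : ℤ}
    {s : SymAlg k W} (hs : s ∈ grade k W n) (i : ℤ) :
    (evSusp f v s) (n + (i - 1)) = (f (i - 1) (v i) s) (n + (i - 1)) := by
  induction v using DirectSum.induction_on with
  | zero =>
    rw [map_zero, DirectSum.zero_apply]
    exact (congrArg (fun φ : Cochain k W W => (φ s) (n + (i - 1))) (map_zero (f (i - 1)))).symm
  | add v w h1 h2 =>
    rw [map_add, LinearMap.add_apply, DirectSum.add_apply, h1, h2, DirectSum.add_apply]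
    have : f (i - 1) (v i + w i) = f (i - 1) (v i) + f (i - 1) (w i) := map_add _ _ _
    rw [this]
    rfl
  | of j φ =>
    have e : evSusp f (DirectSum.of (Susp g) j φ) = f (j - 1) φ := evSusp_lof f j φ
    rw [e]
    rcases eq_or_ne i j with rfl | hij
    · rw [DirectSum.of_eq_same]
    · rw [DirectSum.of_eq_of_ne _ _ _ hij]
      obtain ⟨x, hx⟩ := hf (j - 1) φ n s hs
      have : f (i - 1) 0 = 0 := map_zero _
      rw [← hx, DirectSum.lof_eq_of, DirectSum.of_eq_of_ne _ _ _ (by omega), this]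
      rfl

theorem apply_eq_zero_of_evSusp (hf : ∀ i x, f i x ∈ homDeg k W W i) {v : ⨁ i, Susp g i} {n : ℤ}
    {s : SymAlg k W} (hs : s ∈ grade k W n) (h : evSusp f v s = 0) (i : ℤ) :
    f (i - 1) (v i) s = 0 := by
  refine eq_zero_of_component (hf _ _ n s hs) ?_
  rw [← evSusp_component hf v hs, h]
  rfl

theorem evSusp_mem (hf : ∀ i x, f i x ∈ homDeg k W W i) (n : ℤ) (v : ⨁ i, Susp g i)
    (hv : v ∈ LinearMap.range (DirectSum.lof k ℤ (Susp g) n)) :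
    evSusp f v ∈ homDeg k W W (n - 1) := by
  obtain ⟨x, rfl⟩ := hv
  rw [evSusp_lof]
  exact hf _ x

theorem exists_proj_eq_lof {n : ℤ} {s : SymAlg k W} (hs : s ∈ grade k W n) :
    ∃ x : W n, proj k W s = DirectSum.lof k ℤ W n x := by
  obtain ⟨x, hx⟩ := range_lof_congr (add_zero n) (proj_mem_homDeg n s hs)
  exact ⟨x, hx.symm⟩

theorem smul_bracket_identity {M : Type*} [AddCommGroup M] [Module k M] {X Y : M} {a b c d : k}
    (h : a = -(d * b * c)) (h' : a * c = -(d * b)) :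
    -a • (X - c • Y) - a • (-2 : k) • X = d • (b • (-2 : k) • Y - -b • (Y - c • X)) := by
  have e : ∀ X Y : M, -a • (X - c • Y) - a • (-2 : k) • X = a • X + (a * c) • Y := fun X Y => by
    module
  rw [e, h', h]
  module

namespace IsDerEmbedding

variable (H : IsDerEmbedding m d br f)
include H

theorem eq_zero (v : ⨁ i, Susp g i) (hv : evSusp f v = 0) : v = 0 := by
  refine DFinsupp.ext fun i => ?_
  apply H.injective (i - 1)
  refine (linearMap_ext_grade fun n s hs => ?_).trans (map_zero _).symm
  exact apply_eq_zero_of_evSusp H.mem hs (by rw [hv]; rfl) i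

theorem evSusp_diff (s : SymAlg k (Susp g)) :
    evSusp f (dglaDiff d (proj k (Susp g) s)) =
      -preLie k W m (evSusp f (proj k _ s)) - preLie k W (evSusp f (proj k _ (tau k _ (-1) s))) m := by
  induction s using grade_induction with
  | add s t h1 h2 =>
    simp only [map_add, h1, h2, LinearMap.add_apply]
    abel
  | homog n s hs =>
    obtain ⟨x, hx⟩ := exists_proj_eq_lof hs
    have h1 : sgn k (-1 * (n - 1)) = -sgn k (-1 * n) := by
      rw [show -1 * (n - 1) = -1 * n + 1 by ring, sgn_add, sgn_of_odd odd_one, mul_neg_one]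
    rw [tau_of_mem _ hs, map_smul, hx, dglaDiff_lof, map_neg, map_smul, evSusp_lof, evSusp_lof,
      H.map_d, gerst_eq, map_smul, LinearMap.smul_apply, h1]
    module

/-- Under the cocommutative coproduct the two terms of the commutator contribute equally. The
resulting factor `2` cancels the `1/2` in `dglaOp`. -/
theorem evSusp_bracket [CharZero k] :
    bconv ((dglaBracket br).compr₂ (evSusp f)) (proj k _) (proj k _) =
      -((2 : k) • bconv (preLie k W) ((evSusp f ∘ₗ proj k _) ∘ₗ tauL k _ (-1))
        (evSusp f ∘ₗ proj k _)) := by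
  have h1 : ∀ n, sgn k (n - 1) = -sgn k (-1 * n) := fun n => by
    rw [← neg_one_mul (sgn k _), ← sgn_neg_one (k := k), ← sgn_add]
    exact sgn_congr ⟨n, by ring⟩
  have h : bconv (((dglaBracket br).compr₂ (evSusp f)).compl₁₂ (proj k _) (proj k _))
        LinearMap.id LinearMap.id =
      bconv (((preLie k W).compr₂ ((-2 : k) • LinearMap.id)).compl₁₂
        ((evSusp f ∘ₗ proj k _) ∘ₗ tauL k _ (-1)) (evSusp f ∘ₗ proj k _))
        LinearMap.id LinearMap.id := by
    refine bconv_eq_of_antisymm _ _ _ _ fun i j s hs t ht => ?_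
    obtain ⟨x, hx⟩ := exists_proj_eq_lof hs
    obtain ⟨y, hy⟩ := exists_proj_eq_lof ht
    have h2 : sgn k (-1 * i) = -(sgn k (i * j) * sgn k (-1 * j) * sgn k ((i - 1) * (j - 1))) := by
      rw [← neg_one_mul (_ * _), ← sgn_neg_one (k := k), ← sgn_add, ← sgn_add, ← sgn_add]
      exact sgn_congr ⟨j - i * j, by ring⟩
    have h3 : sgn k (-1 * i) * sgn k ((i - 1) * (j - 1)) = -(sgn k (i * j) * sgn k (-1 * j)) := by
      rw [← neg_one_mul (_ * _), ← sgn_neg_one (k := k), ← sgn_add, ← sgn_add, ← sgn_add]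
      exact sgn_congr ⟨1 - i, by ring⟩
    simp only [LinearMap.compl₁₂_apply, LinearMap.compr₂_apply, LinearMap.comp_apply,
      LinearMap.id_apply, AlgHom.toLinearMap_apply, tau_of_mem _ hs, tau_of_mem _ ht, map_smul, hx,
      hy, dglaBracket_lof, evSusp_lof, H.map_br, gerst_eq, LinearMap.smul_apply, h1,
      mul_comm (j - 1) (i - 1)]
    generalize preLie k W (f (i - 1) x) (f (j - 1) y) = X
    generalize preLie k W (f (j - 1) y) (f (i - 1) x) = Y
    exact smul_bracket_identity h2 h3
  rw [← bconv_comp_comp, ← bconv_comp_comp, LinearMap.comp_id, LinearMap.comp_id,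
    LinearMap.comp_id] at h
  rw [h, ← comp_bconv]
  ext1 s
  simp

/-- Expanding the square of `ev + ε m` gives four terms. The pure `m` term vanishes by `hm`, the two
mixed terms form the differential `[m, -]`, and the remaining one is the bracket. -/
theorem evSusp_comp_dglaOp [CharZero k] (hm : m ∘ₗ coder m = 0) :
    evSusp f ∘ₗ dglaOp g d br =
      -bconv (preLie k W) (pert (evSusp f) m ∘ₗ tauL k _ (-1)) (pert (evSusp f) m) := by
  have hτ : pert (evSusp f) m ∘ₗ tauL k _ (-1) = (evSusp f ∘ₗ proj k _) ∘ₗ tauL k _ (-1) +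
      (counit k (Susp g)).toLinearMap.smulRight m := by
    ext1 z
    simp only [LinearMap.comp_apply, LinearMap.add_apply, AlgHom.toLinearMap_apply, pert_apply,
      counit_tau, LinearMap.smulRight_apply]
  have hmm : preLie k W m m = 0 := hm
  rw [hτ, pert, bconv_add_left, bconv_add_right, bconv_add_right, bconv_counit_left,
    bconv_counit_left, bconv_counit_right, dglaOp_eq, LinearMap.comp_add, LinearMap.comp_smul,
    comp_bconv, H.evSusp_bracket]
  ext1 s
  simp only [LinearMap.add_apply, LinearMap.comp_apply, H.evSusp_diff, LinearMap.smul_apply,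
    LinearMap.neg_apply, LinearMap.smulRight_apply, LinearMap.flip_apply, map_smul, hmm,
    AlgHom.toLinearMap_apply, smul_neg, smul_zero, add_zero,
    inv_smul_smul₀ (two_ne_zero (α := k))]
  abel

theorem isLInfty [CharZero k] (hm : IsLInfty m) : IsLInfty (dglaOp g d br) :=
  isLInfty_of_maurerCartan (evSusp_mem H.mem) H.eq_zero hm.1 (dglaOp_mem d br) (dglaOp_one d br)
    (H.evSusp_comp_dglaOp hm.comp_coder)

end IsDerEmbedding
end DerModel
end
end LInf

namespace LInf
noncomputable section

/-! ### The structure on the total space of an extension. -/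

section Extensions

variable {k : Type*} [Field k] {W : ℤ → Type*} [∀ i, AddCommGroup (W i)] [∀ i, Module k (W i)]
  {E : ℤ → Type*} [∀ i, AddCommGroup (E i)] [∀ i, Module k (E i)]
  {T : ℤ → Type*} [∀ i, AddCommGroup (T i)] [∀ i, Module k (T i)]

theorem lmap_comp_lmap (g : ∀ i, E i →ₗ[k] T i) (f : ∀ i, W i →ₗ[k] E i) :
    DirectSum.lmap g ∘ₗ DirectSum.lmap f = DirectSum.lmap fun i => g i ∘ₗ f i := by
  refine DirectSum.linearMap_ext _ fun i => ?_
  ext1 x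
  simp only [LinearMap.comp_apply, DirectSum.lmap_lof]

theorem lmap_id : DirectSum.lmap (fun i => (LinearMap.id : W i →ₗ[k] W i)) = LinearMap.id := by
  refine DirectSum.linearMap_ext _ fun i => ?_
  ext1 x
  simp only [LinearMap.comp_apply, DirectSum.lmap_lof, LinearMap.id_apply]

theorem lmap_zero : DirectSum.lmap (fun i => (0 : W i →ₗ[k] E i)) = 0 := by
  refine DirectSum.linearMap_ext _ fun i => ?_
  ext1 x
  simp only [LinearMap.comp_apply, DirectSum.lmap_lof, LinearMap.zero_apply, map_zero]

theorem lmap_add (f g : ∀ i, W i →ₗ[k] E i) :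
    DirectSum.lmap (fun i => f i + g i) = DirectSum.lmap f + DirectSum.lmap g := by
  refine DirectSum.linearMap_ext _ fun i => ?_
  ext1 x
  simp only [LinearMap.comp_apply, DirectSum.lmap_lof, LinearMap.add_apply, map_add]

/-- The graded vector space `T` is the direct sum of `W` and `E`. -/
structure IsSplit (jW : ∀ i, W i →ₗ[k] T i) (jE : ∀ i, E i →ₗ[k] T i) (ρ : ∀ i, T i →ₗ[k] W i)
    (π : ∀ i, T i →ₗ[k] E i) : Prop where
  ρ_jW : ∀ i, ρ i ∘ₗ jW i = LinearMap.id
  π_jE : ∀ i, π i ∘ₗ jE i = LinearMap.id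
  ρ_jE : ∀ i, ρ i ∘ₗ jE i = 0
  π_jW : ∀ i, π i ∘ₗ jW i = 0
  total : ∀ i, jW i ∘ₗ ρ i + jE i ∘ₗ π i = LinearMap.id

variable (k W) in
/-- Evaluation of Taylor coefficients, as a bilinear map. -/
def applyL : Cochain k W W →ₗ[k] SymAlg k W →ₗ[k] ⨁ i, W i := LinearMap.id

theorem applyL_apply (φ : Cochain k W W) (s : SymAlg k W) : applyL k W φ s = φ s := rfl

variable (k W) in
/-- Evaluation of coderivations, as a bilinear map. -/
def coderB : Cochain k W W →ₗ[k] SymAlg k W →ₗ[k] SymAlg k W where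
  toFun := coder
  map_add' := coder_add
  map_smul' := coder_smul

/-- The structure on the total space of an extension. -/
def extStr (jW : ∀ i, W i →ₗ[k] T i) (jE : ∀ i, E i →ₗ[k] T i) (ρ : ∀ i, T i →ₗ[k] W i)
    (π : ∀ i, T i →ₗ[k] E i) (Θ : SymAlg k E →ₗ[k] Cochain k W W) (q : Cochain k E E) :
    Cochain k T T :=
  DirectSum.lmap jW ∘ₗ bconv (applyL k W) (Θ ∘ₗ (symMap π).toLinearMap) (symMap ρ).toLinearMap +
    DirectSum.lmap jE ∘ₗ q ∘ₗ (symMap π).toLinearMap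

/-- The coderivation along `f` with Taylor coefficients `a(x')(f(x''))`. -/
theorem conv_gen_bconv_applyL {F : SymAlg k T →ₗ[k] SymAlg k W} (hF : IsCoalgOp F)
    (a : SymAlg k T →ₗ[k] Cochain k W W) :
    conv (gen k W ∘ₗ bconv (applyL k W) a F) F = bconv (coderB k W) a F := by
  -- Coassociativity groups the two copies of `F` into the coproduct of `F`. This bilinear map
  -- applies the coefficients to one leg and multiplies by the other, which on a coproduct is the
  -- coderivation itself.
  let B₃ : Cochain k W W →ₗ[k] (SymAlg k W ⊗[k] SymAlg k W) →ₗ[k] SymAlg k W :=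
    LinearMap.mk₂ k (fun φ z => LinearMap.mul' k _ (TensorProduct.map (gen k W ∘ₗ φ) LinearMap.id z))
      (fun φ ψ z => by
        rw [LinearMap.comp_add, TensorProduct.map_add_left, LinearMap.add_apply, map_add])
      (fun c φ z => by
        rw [LinearMap.comp_smul, TensorProduct.map_smul_left, LinearMap.smul_apply, map_smul])
      (fun φ z w => by simp only [map_add])
      (fun c φ z => by simp only [map_smul])
  have hcomul : ∀ s, bconv (R := SymAlg k W ⊗[k] SymAlg k W)
      (TensorProduct.mk k (SymAlg k W) (SymAlg k W)) F F s = comul k W (F s) := by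
    intro s
    rw [hF.comul_apply]
    have : TensorProduct.lift (TensorProduct.mk k (SymAlg k W) (SymAlg k W)) = LinearMap.id := by
      ext x y
      rfl
    rw [bconv, this]
    rfl
  have h : bconv (LinearMap.mul k (SymAlg k W)) (bconv ((applyL k W).compr₂ (gen k W)) a F) F =
      bconv B₃ a (bconv (R := SymAlg k W ⊗[k] SymAlg k W)
        (TensorProduct.mk k (SymAlg k W) (SymAlg k W)) F F) :=
    bconv_assoc _ _ _ _ (fun p q r => by simp [B₃, applyL]) _ _ _
  rw [conv_eq_bconv, comp_bconv, h]
  refine bconv_congr fun i j s _ t _ => ?_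
  rw [hcomul]
  rfl

variable {jW : ∀ i, W i →ₗ[k] T i} {jE : ∀ i, E i →ₗ[k] T i} {ρ : ∀ i, T i →ₗ[k] W i}
  {π : ∀ i, T i →ₗ[k] E i} {ev : (⨁ i, E i) →ₗ[k] Cochain k W W} {m : Cochain k W W}
  {q : Cochain k E E}

theorem IsSplit.lmap_ρ_extStr (h : IsSplit jW jE ρ π) (Θ : SymAlg k E →ₗ[k] Cochain k W W) :
    DirectSum.lmap ρ ∘ₗ extStr jW jE ρ π Θ q =
      bconv (applyL k W) (Θ ∘ₗ (symMap π).toLinearMap) (symMap ρ).toLinearMap := by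
  rw [extStr, LinearMap.comp_add, ← LinearMap.comp_assoc, ← LinearMap.comp_assoc, lmap_comp_lmap,
    lmap_comp_lmap]
  simp only [h.ρ_jW, h.ρ_jE, lmap_id, lmap_zero, LinearMap.id_comp, LinearMap.zero_comp, add_zero]

theorem IsSplit.lmap_π_extStr (h : IsSplit jW jE ρ π) (Θ : SymAlg k E →ₗ[k] Cochain k W W) :
    DirectSum.lmap π ∘ₗ extStr jW jE ρ π Θ q = q ∘ₗ (symMap π).toLinearMap := by
  rw [extStr, LinearMap.comp_add, ← LinearMap.comp_assoc, ← LinearMap.comp_assoc, lmap_comp_lmap,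
    lmap_comp_lmap]
  simp only [h.π_jW, h.π_jE, lmap_id, lmap_zero, LinearMap.id_comp, LinearMap.zero_comp, zero_add]

theorem extStr_mem (hev : ∀ n, ∀ v ∈ LinearMap.range (DirectSum.lof k ℤ E n),
      ev v ∈ homDeg k W W (n - 1)) (hm : m ∈ homDeg k W W (-1)) (hq : q ∈ homDeg k E E (-1)) :
    extStr jW jE ρ π (pert ev m) q ∈ homDeg k T T (-1) := by
  have h : bconv (applyL k W) (pert ev m ∘ₗ (symMap π).toLinearMap) (symMap ρ).toLinearMap ∈
      homDeg k T W (-1) :=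
    bconv_mem_homDeg fun i j s hs t ht => range_lof_congr (by ring)
      (pert_mem hev hm (symMap_mem π hs) _ _ (symMap_mem ρ ht))
  exact add_mem (fun n s hs => lmap_mem_range jW (h n s hs))
    (fun n s hs => lmap_mem_range jE (hq n _ (symMap_mem π hs)))

theorem extStr_one (hm : m 1 = 0) (hq : q 1 = 0) : extStr jW jE ρ π (pert ev m) q 1 = 0 := by
  rw [extStr, LinearMap.add_apply, LinearMap.comp_apply, LinearMap.comp_apply, LinearMap.comp_apply,
    bconv_one, LinearMap.comp_apply, AlgHom.toLinearMap_apply, AlgHom.toLinearMap_apply,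
    map_one (symMap π), map_one (symMap ρ), pert_one, hq, applyL_apply, hm, map_zero, map_zero,
    add_zero]

/-- In the fiber component of the square, `D_Q` acts either on the base argument of the family or on
the fiber argument. The first contribution is minus the pre-Lie square by `hMC`. The second is plus
the same square, since the pre-Lie product is substitution of a coderivation. The base component is
`q ∘ D_q`. -/
theorem IsSplit.isLInfty_extStr [CharZero k] (h : IsSplit jW jE ρ π)
    (hev : ∀ n, ∀ v ∈ LinearMap.range (DirectSum.lof k ℤ E n), ev v ∈ homDeg k W W (n - 1))
    (hm : IsLInfty m) (hq : IsLInfty q)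
    (hMC : ev ∘ₗ q = -bconv (preLie k W) (pert ev m ∘ₗ tauL k E (-1)) (pert ev m)) :
    IsLInfty (extStr jW jE ρ π (pert ev m) q) := by
  have hmem := extStr_mem (jW := jW) (jE := jE) (ρ := ρ) (π := π) hev hm.1 hq.1
  refine isLInfty_of_comp hmem (extStr_one hm.2.1 hq.2.1) ?_
  set Q := extStr jW jE ρ π (pert ev m) q with hQ
  have hπ : (symMap π).toLinearMap ∘ₗ coder Q = coder q ∘ₗ (symMap π).toLinearMap :=
    symMap_comp_coder (h.lmap_π_extStr _)
  have hρ : (symMap ρ).toLinearMap ∘ₗ coder Q =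
      bconv (coderB k W) (pert ev m ∘ₗ (symMap π).toLinearMap) (symMap ρ).toLinearMap := by
    rw [coder, symMap_comp_conv_gen, hQ, h.lmap_ρ_extStr, LinearMap.comp_id,
      conv_gen_bconv_applyL (isCoalgOp_symMap ρ)]
  have hτ : tauL k E (-1) ∘ₗ (symMap π).toLinearMap = (symMap π).toLinearMap ∘ₗ tauL k T (-1) := by
    ext1 s
    exact ((isCoalgOp_symMap π).comp_tau (-1) s).symm
  have hW : bconv (applyL k W) (pert ev m ∘ₗ (symMap π).toLinearMap) (symMap ρ).toLinearMap ∘ₗ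
      coder Q = 0 := by
    have hassoc := bconv_assoc (applyL k W) (preLie k W) (applyL k W) (coderB k W)
      (fun _ _ _ => rfl) ((pert ev m ∘ₗ (symMap π).toLinearMap) ∘ₗ tauL k T (-1))
      (pert ev m ∘ₗ (symMap π).toLinearMap) (symMap ρ).toLinearMap
    rw [(isCoderOp_coder hmem).bconv_comp, hρ, ← hassoc, LinearMap.comp_assoc, hπ,
      ← LinearMap.comp_assoc, pert_comp_coder, hMC, LinearMap.neg_comp,
      (isCoalgOp_symMap π).bconv_comp, LinearMap.comp_assoc, hτ, bconv_neg_left,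
      ← LinearMap.comp_assoc, neg_add_cancel]
  have hE : (q ∘ₗ (symMap π).toLinearMap) ∘ₗ coder Q = 0 := by
    rw [LinearMap.comp_assoc, hπ, ← LinearMap.comp_assoc, hq.comp_coder, LinearMap.zero_comp]
  change (DirectSum.lmap jW ∘ₗ bconv (applyL k W) (pert ev m ∘ₗ (symMap π).toLinearMap)
    (symMap ρ).toLinearMap + DirectSum.lmap jE ∘ₗ q ∘ₗ (symMap π).toLinearMap) ∘ₗ coder Q = 0
  rw [LinearMap.add_comp, LinearMap.comp_assoc, LinearMap.comp_assoc, hW, hE,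
    LinearMap.comp_zero, LinearMap.comp_zero, add_zero]

theorem IsSplit.isLInftyMap_π [CharZero k] (h : IsSplit jW jE ρ π)
    (Θ : SymAlg k E →ₗ[k] Cochain k W W) :
    IsLInftyMap (extStr jW jE ρ π Θ q) q (strictMap π) :=
  isLInftyMap_strictMap (h.lmap_π_extStr _)

/-- On products of fiber elements the base argument reduces to the counit, so only the value `m` of
the family at `1` survives. -/
theorem IsSplit.isLInftyMap_jW [CharZero k] (h : IsSplit jW jE ρ π) (hq : q 1 = 0) :
    IsLInftyMap m (extStr jW jE ρ π (pert ev m) q) (strictMap jW) := by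
  refine isLInftyMap_strictMap ?_
  have hρ : (symMap ρ).toLinearMap ∘ₗ (symMap jW).toLinearMap = LinearMap.id := by
    ext1 s
    simp only [LinearMap.comp_apply, AlgHom.toLinearMap_apply, symMap_comp, h.ρ_jW, symMap_id,
      LinearMap.id_apply]
  have hπ : (symMap π).toLinearMap ∘ₗ (symMap jW).toLinearMap =
      (counit k W).toLinearMap.smulRight 1 := by
    ext1 s
    simp only [LinearMap.comp_apply, AlgHom.toLinearMap_apply, symMap_comp, h.π_jW, symMap_zero,
      LinearMap.smulRight_apply, Algebra.algebraMap_eq_smul_one]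
  have hpert : (pert ev m ∘ₗ (symMap π).toLinearMap) ∘ₗ (symMap jW).toLinearMap =
      (counit k W).toLinearMap.smulRight m := by
    rw [LinearMap.comp_assoc, hπ]
    ext1 s
    simp only [LinearMap.comp_apply, LinearMap.smulRight_apply, map_smul, pert_one]
  have hE : (q ∘ₗ (symMap π).toLinearMap) ∘ₗ (symMap jW).toLinearMap = 0 := by
    rw [LinearMap.comp_assoc, hπ]
    ext1 s
    simp only [LinearMap.comp_apply, LinearMap.smulRight_apply, map_smul, hq, smul_zero,
      LinearMap.zero_apply]
  rw [extStr, LinearMap.add_comp, LinearMap.comp_assoc, (isCoalgOp_symMap jW).bconv_comp, hpert, hρ,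
    LinearMap.comp_assoc, hE, LinearMap.comp_zero, add_zero, bconv_counit_left, LinearMap.comp_id]
  rfl

end Extensions
end
end LInf

namespace LInf
noncomputable section

/-! ### Rescaling by the number of factors. -/

section Scale

variable {k : Type*} [Field k] {W : ℤ → Type*} [∀ i, AddCommGroup (W i)] [∀ i, Module k (W i)]
  {U : ℤ → Type*} [∀ i, AddCommGroup (U i)] [∀ i, Module k (U i)]
  {P Q R : Type*} [AddCommGroup P] [Module k P] [AddCommGroup Q] [Module k Q]
  [AddCommGroup R] [Module k R]

variable (k W) in
/-- The endomorphism `s ↦ cⁿ s` on `Sⁿ(W)`. -/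
def scale (c : k) : SymAlg k W →ₐ[k] SymAlg k W := symMap fun _ => c • LinearMap.id

variable (k W) in
/-- The endomorphism `scale` as a linear map. -/
abbrev scaleL (c : k) : SymAlg k W →ₗ[k] SymAlg k W := (scale k W c).toLinearMap

theorem lmap_smul_id (c : k) :
    DirectSum.lmap (fun i => c • (LinearMap.id : W i →ₗ[k] W i)) = c • LinearMap.id := by
  refine DirectSum.linearMap_ext _ fun i => ?_
  ext1 x
  simp only [LinearMap.comp_apply, DirectSum.lmap_lof, LinearMap.smul_apply, LinearMap.id_apply,
    map_smul]

theorem scale_gen_mul (c : k) (i : ℤ) (x : W i) (s : SymAlg k W) :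
    scale k W c (gen₁ k W i x * s) = c • (gen₁ k W i x * scale k W c s) := by
  rw [map_mul, scale, symMap_gen, lmap_smul_id, LinearMap.smul_apply, LinearMap.id_apply, map_smul,
    smul_mul_assoc]

theorem scale_mem (c : k) {n : ℤ} {s : SymAlg k W} (hs : s ∈ grade k W n) :
    scale k W c s ∈ grade k W n := symMap_mem _ hs

theorem isCoalgOp_scale [CharZero k] (c : k) : IsCoalgOp (scaleL k W c) := isCoalgOp_symMap _

theorem scale_one_apply (s : SymAlg k W) : scale k W 1 s = s := by
  rw [scale]
  simp only [one_smul]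
  exact symMap_id s

theorem conv_tau_lgen {a b : SymAlg k W →ₗ[k] SymAlg k W}
    (ha : ∀ n, ∀ s ∈ grade k W n, a s ∈ grade k W n) (i : ℤ) (x : W i) :
    conv (a ∘ₗ tauL k W i) (lgen k i x ∘ₗ b) = lgen k i x ∘ₗ conv a b := by
  rw [conv_eq_bconv, conv_eq_bconv, comp_bconv]
  refine bconv_congr fun p q s hs t _ => ?_
  simp only [LinearMap.comp_apply, AlgHom.toLinearMap_apply, tau_of_mem i hs, map_smul,
    LinearMap.smul_apply, LinearMap.mul_apply', LinearMap.mulLeft_apply, LinearMap.compr₂_apply]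
  rw [← mul_assoc, mul_comm_grade (ha p s hs) (gen_mem k W i x), smul_mul_assoc, smul_smul,
    mul_comm p i, sgn_mul_self, one_smul, mul_assoc]

/-- This is the binomial theorem: each factor goes left with weight `c` or right with weight `d`,
and multiplying back restores the product. -/
theorem conv_scale_scale (c d : k) : conv (scaleL k W c) (scaleL k W d) = scaleL k W (c + d) := by
  ext1 s
  induction s using mon_induction with
  | one =>
    rw [conv_eq_bconv, bconv_one, AlgHom.toLinearMap_apply, AlgHom.toLinearMap_apply,
      AlgHom.toLinearMap_apply, map_one (scale k W c), map_one (scale k W d),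
      map_one (scale k W (c + d)), LinearMap.mul_apply', one_mul]
  | gen_mul i x s ih =>
    have hc : scaleL k W c ∘ₗ lgen k i x = c • (lgen k i x ∘ₗ scaleL k W c) := by
      ext1 s
      exact scale_gen_mul c i x s
    have hd : scaleL k W d ∘ₗ lgen k i x = d • (lgen k i x ∘ₗ scaleL k W d) := by
      ext1 s
      exact scale_gen_mul d i x s
    have h1 : conv (lgen k i x ∘ₗ scaleL k W c) (scaleL k W d) =
        lgen k i x ∘ₗ conv (scaleL k W c) (scaleL k W d) := by
      rw [conv_eq_bconv, conv_eq_bconv, comp_bconv]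
      exact bconv_congr fun _ _ _ _ _ _ => mul_assoc _ _ _
    rw [conv_eq_bconv, bconv_gen_mul, hc, hd, bconv_smul_left, bconv_smul_right, ← conv_eq_bconv,
      ← conv_eq_bconv, h1, conv_tau_lgen fun n s hs => scale_mem c hs, AlgHom.toLinearMap_apply,
      scale_gen_mul, LinearMap.smul_apply, LinearMap.smul_apply, LinearMap.comp_apply, ih, add_smul]
    rfl
  | add s t hs ht => rw [map_add, map_add, hs, ht]
  | smul c s hs => rw [map_smul, map_smul, hs]

theorem conv_counit_right (a : SymAlg k W →ₗ[k] SymAlg k W) :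
    conv a ((counit k W).toLinearMap.smulRight 1) = a := by
  rw [conv_eq_bconv, bconv_counit_right]
  ext1 s
  exact mul_one _

/-- The convolution selects one factor and rescales the others, so it acts on `n`-fold products as
`n c^(n-1)`, the derivative of `cⁿ`. The recursion is the Leibniz rule for that derivative. -/
theorem conv_scale_gen_proj_gen_mul (c : k) (i : ℤ) (x : W i) (s : SymAlg k W) :
    conv (scaleL k W c) (gen k W ∘ₗ proj k W) (gen₁ k W i x * s) =
      c • (gen₁ k W i x * conv (scaleL k W c) (gen k W ∘ₗ proj k W) s) +
        gen₁ k W i x * scale k W c s := by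
  have hc : scaleL k W c ∘ₗ lgen k i x = c • (lgen k i x ∘ₗ scaleL k W c) := by
    ext1 s
    exact scale_gen_mul c i x s
  have hp : (gen k W ∘ₗ proj k W) ∘ₗ lgen k i x =
      lgen k i x ∘ₗ (counit k W).toLinearMap.smulRight 1 := by
    ext1 s
    simp only [LinearMap.comp_apply, LinearMap.mulLeft_apply, proj_gen_mul, map_smul,
      LinearMap.smulRight_apply, AlgHom.toLinearMap_apply, mul_one]
  have h1 : conv (lgen k i x ∘ₗ scaleL k W c) (gen k W ∘ₗ proj k W) =
      lgen k i x ∘ₗ conv (scaleL k W c) (gen k W ∘ₗ proj k W) := by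
    rw [conv_eq_bconv, conv_eq_bconv, comp_bconv]
    exact bconv_congr fun _ _ _ _ _ _ => mul_assoc _ _ _
  rw [conv_eq_bconv, bconv_gen_mul, hc, hp, bconv_smul_left, ← conv_eq_bconv, ← conv_eq_bconv, h1,
    conv_tau_lgen fun n s hs => scale_mem c hs, conv_counit_right]
  rfl

theorem scale_comp_coder [CharZero k] (c : k) (φ : Cochain k W W) :
    scaleL k W c ∘ₗ coder φ = c • conv (gen k W ∘ₗ φ) (scaleL k W c) := by
  refine (symMap_comp_conv_gen (fun _ => c • LinearMap.id) φ LinearMap.id).trans ?_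
  rw [lmap_smul_id, LinearMap.comp_id, conv_eq_bconv, conv_eq_bconv, ← bconv_smul_left]
  congr 1
  ext1 s
  simp only [LinearMap.comp_apply, LinearMap.smul_apply, LinearMap.id_apply, map_smul]

end Scale

/-! ### The Maurer-Cartan equation for the rescaled adjoint family. -/

section Translate

variable {k : Type*} [Field k] {W : ℤ → Type*} [∀ i, AddCommGroup (W i)] [∀ i, Module k (W i)]
  {U : ℤ → Type*} [∀ i, AddCommGroup (U i)] [∀ i, Module k (U i)]

/-- The bilinear map `s, t ↦ φ(st)`. -/
def translate (φ : Cochain k W W) : SymAlg k W →ₗ[k] Cochain k W W :=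
  (LinearMap.mul k (SymAlg k W)).compr₂ φ

theorem translate_apply (φ : Cochain k W W) (s t : SymAlg k W) : translate φ s t = φ (s * t) := rfl

variable (k W) in
/-- The Taylor coefficients `ε w` of a constant coderivation. -/
def constCochain : (⨁ i, W i) →ₗ[k] Cochain k W W :=
  LinearMap.smulRightₗ (counit k W).toLinearMap

theorem constCochain_apply (w : ⨁ i, W i) (s : SymAlg k W) :
    constCochain k W w s = counit k W s • w := rfl

/-- A constant coefficient consumes no arguments, so its coderivation inserts `w`. Precomposing `m(x
-)` with it therefore gives `m(x w -)`. -/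
theorem coder_constCochain (w : ⨁ i, W i) (s : SymAlg k W) :
    coder (constCochain k W w) s = gen k W w * s := by
  have h : gen k W ∘ₗ constCochain k W w = (counit k W).toLinearMap.smulRight (gen k W w) := by
    ext1 s
    simp only [LinearMap.comp_apply, constCochain_apply, map_smul]
    rfl
  rw [coder, h, conv_eq_bconv, bconv_counit_left]
  rfl

theorem constCochain_comp_coder (w : ⨁ i, W i) (φ : Cochain k W W) :
    constCochain k W w ∘ₗ coder φ = 0 := by
  ext1 s
  rw [LinearMap.comp_apply, constCochain_apply, counit_coder, zero_smul, LinearMap.zero_apply]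

/-- A coderivation applied to a product. -/
theorem coder_mul (s y : SymAlg k W) : ∀ {d : ℤ} {φ : Cochain k W W} (_ : φ ∈ homDeg k W W d),
    coder φ (s * y) = bconv ((LinearMap.mul k (SymAlg k W)).compl₂ ((coderB k W).flip y))
      (tauL k W d) (translate φ) s := by
  induction s using mon_induction with
  | one =>
    intro d φ _
    rw [bconv_one, AlgHom.toLinearMap_apply, map_one (tau k W d), one_mul]
    have : translate φ 1 = φ := by
      ext1 t
      rw [translate_apply, one_mul]
    rw [this]
    exact (one_mul _).symm
  | gen_mul i x s ih =>
    intro d φ hφ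
    -- The generator `x` either stays outside `φ` or becomes one of its inputs. The second case
    -- needs the induction hypothesis for `φ(x -)`, of a different degree.
    have hφx : φ ∘ₗ lgen k i x ∈ homDeg k W W (d + i) := fun n t ht =>
      range_lof_congr (by ring) (hφ _ _ (SetLike.mul_mem_graded (gen_mem k W i x) ht))
    have hc : coder φ (gen₁ k W i x * (s * y)) =
        sgn k (d * i) • (gen₁ k W i x * coder φ (s * y)) + coder (φ ∘ₗ lgen k i x) (s * y) := by
      have h := bconv_gen_mul (LinearMap.mul k (SymAlg k W)) (gen k W ∘ₗ φ) LinearMap.id i x (s * y)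
      have h2 : bconv (LinearMap.mul k (SymAlg k W)) ((gen k W ∘ₗ φ) ∘ₗ tauL k W i)
          (LinearMap.id ∘ₗ lgen k i x) = sgn k (d * i) • (lgen k i x ∘ₗ coder φ) := by
        rw [coder, conv_eq_bconv, comp_bconv, ← bconv_smul_left]
        refine bconv_congr fun p q u hu v _ => ?_
        simp only [LinearMap.comp_apply, AlgHom.toLinearMap_apply, tau_of_mem i hu, map_smul,
          LinearMap.smul_apply, LinearMap.mul_apply', LinearMap.mulLeft_apply,
          LinearMap.compr₂_apply, LinearMap.id_apply]
        rw [← mul_assoc, mul_comm_grade (gen_mem_grade (hφ p u hu)) (gen_mem k W i x),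
          smul_mul_assoc, smul_smul, mul_assoc, ← sgn_add]
        congr 1
        exact sgn_congr ⟨i * p, by ring⟩
      rw [h2] at h
      refine h.trans ?_
      rw [add_comm]
      rfl
    have h1 : tauL k W d ∘ₗ lgen k i x = sgn k (d * i) • (lgen k i x ∘ₗ tauL k W d) :=
      tauL_comp_lgen d i x
    have h2 : tauL k W d ∘ₗ tauL k W i = tauL k W (d + i) := by
      ext1 s
      exact tau_tau d i s
    have h3 : translate φ ∘ₗ lgen k i x = translate (φ ∘ₗ lgen k i x) := by
      ext1 s
      ext1 t
      simp only [LinearMap.comp_apply, translate_apply, LinearMap.mulLeft_apply, mul_assoc]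
    have h4 : bconv ((LinearMap.mul k (SymAlg k W)).compl₂ ((coderB k W).flip y))
        (lgen k i x ∘ₗ tauL k W d) (translate φ) =
        lgen k i x ∘ₗ bconv ((LinearMap.mul k (SymAlg k W)).compl₂ ((coderB k W).flip y))
          (tauL k W d) (translate φ) := by
      rw [comp_bconv]
      exact bconv_congr fun _ _ _ _ _ _ => mul_assoc _ _ _
    rw [mul_assoc, hc, ih hφ, ih hφx, bconv_gen_mul, h1, h2, h3, bconv_smul_left, h4]
    rfl
  | add s t hs ht =>
    intro d φ hφ
    rw [add_mul, map_add, map_add, hs hφ, ht hφ]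
  | smul c s hs =>
    intro d φ hφ
    rw [smul_mul_assoc, map_smul, map_smul, hs hφ]

theorem bconv_preLie_constCochain_left {V : ℤ → Type*} [∀ i, AddCommGroup (V i)]
    [∀ i, Module k (V i)] (a : SymAlg k V →ₗ[k] ⨁ i, W i) (b : SymAlg k V →ₗ[k] Cochain k W W) :
    bconv (preLie k W) (constCochain k W ∘ₗ a) b = 0 := by
  rw [← bconv_zero_left (preLie k W) b]
  refine bconv_congr fun i j s _ t _ => ?_
  rw [LinearMap.comp_apply, preLie_apply, constCochain_comp_coder, LinearMap.zero_apply, map_zero,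
    LinearMap.zero_apply]

theorem bconv_preLie_constCochain_right {V : ℤ → Type*} [∀ i, AddCommGroup (V i)]
    [∀ i, Module k (V i)] (m : Cochain k W W) (a : SymAlg k V →ₗ[k] SymAlg k W)
    (b : SymAlg k V →ₗ[k] ⨁ i, W i) :
    bconv (preLie k W) (translate m ∘ₗ a) (constCochain k W ∘ₗ b) =
      translate m ∘ₗ conv a (gen k W ∘ₗ b) := by
  rw [conv_eq_bconv, comp_bconv]
  refine bconv_congr fun i j s _ t _ => ?_
  ext1 y
  simp only [LinearMap.comp_apply, preLie_apply, translate_apply, coder_constCochain,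
    LinearMap.compr₂_apply, LinearMap.mul_apply', mul_assoc]

theorem bconv_applyL_constCochain {V : ℤ → Type*} [∀ i, AddCommGroup (V i)]
    [∀ i, Module k (V i)] (a : SymAlg k V →ₗ[k] ⨁ i, W i) {F : SymAlg k V →ₗ[k] SymAlg k W}
    (hF : ∀ s, counit k W (F s) = counit k V s) :
    bconv (applyL k W) (constCochain k W ∘ₗ a) F = a := by
  have h : bconv (applyL k W) (constCochain k W ∘ₗ a) F =
      bconv (LinearMap.lsmul k (⨁ i, W i)).flip a ((counit k V).toLinearMap.smulRight 1) := by
    refine bconv_congr fun i j s _ t _ => ?_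
    rw [LinearMap.comp_apply, applyL_apply, constCochain_apply, hF, LinearMap.flip_apply,
      LinearMap.lsmul_apply, LinearMap.smulRight_apply, AlgHom.toLinearMap_apply, smul_eq_mul,
      mul_one]
  rw [h, bconv_counit_right]
  ext1 s
  exact one_smul k _

variable [CharZero k] {m : Cochain k W W}

/-- This is `m ∘ D_m = 0` on the product `F(s) y`, with `D_m` of the product expanded by
`coder_mul`. -/
theorem bconv_preLie_translate (hm : IsLInfty m) {F : SymAlg k W →ₗ[k] SymAlg k W}
    (hF : IsCoalgOp F) :
    bconv (preLie k W) ((translate m ∘ₗ F) ∘ₗ tauL k W (-1)) (translate m ∘ₗ F) = 0 := by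
  ext1 s
  ext1 y
  have h1 : LinearMap.applyₗ y ∘ₗ bconv (preLie k W) ((translate m ∘ₗ F) ∘ₗ tauL k W (-1))
      (translate m ∘ₗ F) = (m ∘ₗ bconv ((LinearMap.mul k (SymAlg k W)).compl₂ ((coderB k W).flip y))
      (tauL k W (-1)) (translate m)) ∘ₗ F := by
    refine Eq.trans ?_ (LinearMap.comp_assoc _ _ _).symm
    rw [hF.bconv_comp, comp_bconv, comp_bconv]
    refine bconv_congr fun i j s hs t _ => ?_
    have := hF.comp_tau (-1) s
    simp only [LinearMap.comp_apply, AlgHom.toLinearMap_apply, ← this]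
    rfl
  have h2 : m (coder m (F s * y)) = 0 := LinearMap.congr_fun hm.comp_coder _
  rw [coder_mul _ _ hm.1] at h2
  exact (LinearMap.congr_fun h1 s).trans h2

/-- The family of derivations `y ↦ m(c^{|x|} x y) - c ε(y) m(x)`, `x ∈ S(W)`, where `|x|` is the
number of factors of `x`. -/
def scaledTwist (m : Cochain k W W) (c : k) : SymAlg k W →ₗ[k] Cochain k W W :=
  translate m ∘ₗ scaleL k W c - c • (constCochain k W ∘ₗ m)

/-- Of the four products, translate with translate vanishes by `bconv_preLie_translate`, and those
with a constant on the left vanish because coderivations have no counit part. The last inserts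
`m(x'')` into `m(c^{|x'|} x' -)` with weight `-c`. On the right, rescaling after `D_m` gives the
inserted generator the same weight `c`, which explains the coefficient of the constant term. -/
theorem bconv_preLie_scaledTwist (hm : IsLInfty m) (c : k) :
    bconv (preLie k W) (scaledTwist m c ∘ₗ tauL k W (-1)) (scaledTwist m c) =
      -(scaledTwist m c ∘ₗ coder m) := by
  have h0 : scaledTwist m c ∘ₗ tauL k W (-1) = (translate m ∘ₗ scaleL k W c) ∘ₗ tauL k W (-1) -
      c • (constCochain k W ∘ₗ m ∘ₗ tauL k W (-1)) := rfl
  have hswap : conv (scaleL k W c ∘ₗ tauL k W (-1)) (gen k W ∘ₗ m) =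
      conv (gen k W ∘ₗ m) (scaleL k W c) := by
    rw [conv_gen_swap (p := 0) (q := -1) (fun n s hs => by simpa using scale_mem c hs)
      (gen_comp_mem hm.1)]
    ext1 s
    have h : (gen k W ∘ₗ m) ∘ₗ tauL k W 0 = gen k W ∘ₗ m := by
      ext1 s
      rw [LinearMap.comp_apply, AlgHom.toLinearMap_apply, tau_of_even Even.zero]
    rw [h, LinearMap.smul_apply, zero_mul, sgn_zero, one_smul]
  have hD : scaledTwist m c ∘ₗ coder m =
      c • (translate m ∘ₗ conv (gen k W ∘ₗ m) (scaleL k W c)) := by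
    ext1 s
    have h1 : scale k W c (coder m s) = c • conv (gen k W ∘ₗ m) (scaleL k W c) s :=
      LinearMap.congr_fun (scale_comp_coder c m) s
    have h2 : m (coder m s) = 0 := LinearMap.congr_fun hm.comp_coder s
    simp only [scaledTwist, LinearMap.comp_apply, LinearMap.sub_apply, LinearMap.smul_apply,
      AlgHom.toLinearMap_apply, h1, h2, map_smul, map_zero, smul_zero, sub_zero]
  rw [hD, h0, bconv_sub_left, bconv_smul_left, bconv_preLie_constCochain_left, scaledTwist,
    bconv_sub_right, bconv_smul_right, bconv_preLie_translate hm (isCoalgOp_scale c),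
    LinearMap.comp_assoc, bconv_preLie_constCochain_right, hswap]
  ext1 s
  simp only [LinearMap.sub_apply, LinearMap.smul_apply, LinearMap.neg_apply, LinearMap.zero_apply,
    smul_zero, sub_zero, zero_sub]

/-- The translate part is the binomial theorem inside `m`. In the constant part only the counit of
the second factor is seen, so `d` plays no role there. -/
theorem bconv_applyL_scaledTwist (c d : k) :
    bconv (applyL k W) (scaledTwist m c) (scaleL k W d) = m ∘ₗ scaleL k W (c + d) - c • m := by
  rw [scaledTwist, bconv_sub_left, bconv_smul_left,
    bconv_applyL_constCochain _ fun s => counit_symMap _ s, ← conv_scale_scale, conv_eq_bconv,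
    comp_bconv]
  congr 1
  exact bconv_congr fun _ _ _ _ _ _ => rfl

end Translate
end
end LInf

namespace LInf
noncomputable section

/-! ### Polynomial families and their derivatives. -/

section Polynomials

variable {k : Type*} [Field k] {M N : Type*} [AddCommGroup M] [Module k M] [AddCommGroup N]
  [Module k N]

theorem polyEval_single (t : k) (n : ℕ) (v : M) :
    polyEval M t (Finsupp.single n v) = t ^ n • v := by
  simp [polyEval]

theorem polyDeriv_single (t : k) (n : ℕ) (v : M) :
    polyDeriv M t (Finsupp.single n v) = ((n : k) * t ^ (n - 1)) • v := by
  simp [polyDeriv]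

/-- A linear map applied to the coefficients of a polynomial. -/
abbrev polyMap (g : M →ₗ[k] N) : (ℕ →₀ M) →ₗ[k] (ℕ →₀ N) := Finsupp.mapRange.linearMap g

theorem polyEval_polyMap (g : M →ₗ[k] N) (t : k) (p : ℕ →₀ M) :
    polyEval N t (polyMap g p) = g (polyEval M t p) := by
  induction p using Finsupp.induction_linear with
  | zero => simp only [map_zero]
  | add p q hp hq => simp only [map_add, hp, hq]
  | single n v =>
    rw [Finsupp.mapRange.linearMap_apply, Finsupp.mapRange_single, polyEval_single, polyEval_single,
      map_smul]

theorem polyDeriv_polyMap (g : M →ₗ[k] N) (t : k) (p : ℕ →₀ M) :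
    polyDeriv N t (polyMap g p) = g (polyDeriv M t p) := by
  induction p using Finsupp.induction_linear with
  | zero => simp only [map_zero]
  | add p q hp hq => simp only [map_add, hp, hq]
  | single n v =>
    rw [Finsupp.mapRange.linearMap_apply, Finsupp.mapRange_single, polyDeriv_single,
      polyDeriv_single, map_smul]

variable (k M) in
/-- Multiplication of a polynomial by the variable. -/
def polyShift : (ℕ →₀ M) →ₗ[k] (ℕ →₀ M) := Finsupp.lmapDomain M k Nat.succ

theorem polyShift_single (n : ℕ) (v : M) :
    polyShift k M (Finsupp.single n v) = Finsupp.single (n + 1) v := Finsupp.mapDomain_single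

theorem polyEval_polyShift (t : k) (p : ℕ →₀ M) :
    polyEval M t (polyShift k M p) = t • polyEval M t p := by
  induction p using Finsupp.induction_linear with
  | zero => simp only [map_zero, smul_zero]
  | add p q hp hq => simp only [map_add, hp, hq, smul_add]
  | single n v => rw [polyShift_single, polyEval_single, polyEval_single, smul_smul, pow_succ']

theorem polyDeriv_polyShift (t : k) (p : ℕ →₀ M) :
    polyDeriv M t (polyShift k M p) = polyEval M t p + t • polyDeriv M t p := by
  induction p using Finsupp.induction_linear with
  | zero => simp only [map_zero, smul_zero, add_zero]
  | add p q hp hq =>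
    simp only [map_add, hp, hq, smul_add]
    abel
  | single n v =>
    rw [polyShift_single, polyEval_single, polyDeriv_single, polyDeriv_single, smul_smul, ← add_smul]
    congr 1
    -- At `n = 0` the truncated exponent `n - 1` is harmless, because its coefficient vanishes.
    rcases n with _ | n
    · simp
    · rw [Nat.add_sub_cancel, Nat.add_sub_cancel]
      push_cast
      ring

variable {W : ℤ → Type*} [∀ i, AddCommGroup (W i)] [∀ i, Module k (W i)]

theorem polyMap_polyShift (g : M →ₗ[k] N) (p : ℕ →₀ M) :
    polyMap g (polyShift k M p) = polyShift k N (polyMap g p) := by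
  induction p using Finsupp.induction_linear with
  | zero => simp only [map_zero]
  | add p q hp hq => simp only [map_add, hp, hq]
  | single n v =>
    rw [polyShift_single, Finsupp.mapRange.linearMap_apply, Finsupp.mapRange.linearMap_apply,
      Finsupp.mapRange_single, Finsupp.mapRange_single, polyShift_single]

variable (k W) in
/-- Multiplication by `(1 - t) x`, for a generator `x`, on polynomials with coefficients in
`S(W)`. -/
def genPoly : (⨁ i, W i) →ₗ[k] Module.End k (ℕ →₀ SymAlg k W) where
  toFun x := polyMap (LinearMap.mulLeft k (gen k W x)) ∘ₗ (LinearMap.id - polyShift k _)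
  map_add' x y := by
    refine LinearMap.ext fun p => Finsupp.ext fun n => ?_
    exact (congrArg (· * _) (map_add (gen k W) x y)).trans (add_mul _ _ _)
  map_smul' c x := by
    refine LinearMap.ext fun p => Finsupp.ext fun n => ?_
    exact (congrArg (· * _) (map_smul (gen k W) c x)).trans (smul_mul_assoc _ _ _)

theorem genPoly_apply (x : ⨁ i, W i) (p : ℕ →₀ SymAlg k W) :
    genPoly k W x p = polyMap (LinearMap.mulLeft k (gen k W x)) (p - polyShift k _ p) := rfl

theorem mul_mul_sub_mul {A : Type*} [Ring A] (x y u v : A) :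
    x * (y * u - y * v) = x * y * (u - v) := by rw [← mul_sub, mul_assoc]

theorem sub_smul_self (t : k) (v : M) : v - t • v = (1 - t) • v := by module

theorem mul_neg_sub_mul_add_smul {A : Type*} [Ring A] [Algebra k A] (t : k) (x c e : A) :
    x * -c - (x * e + t • (x * -c)) = -((1 - t) • (x * c) + x * e) := by
  rw [mul_neg]
  module

theorem genPoly_genPoly (x y : ⨁ i, W i) (p : ℕ →₀ SymAlg k W) :
    genPoly k W x (genPoly k W y p) = polyMap (LinearMap.mulLeft k (gen k W x * gen k W y))
      (p - polyShift k _ p - polyShift k _ (p - polyShift k _ p)) := by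
  rw [genPoly_apply, genPoly_apply, ← polyMap_polyShift]
  refine Finsupp.ext fun n => ?_
  exact mul_mul_sub_mul _ _ _ _

variable (k W) in
/-- The polynomial family of endomorphisms `scale (1 - t)` of `S(W)`. -/
def scalePoly : SymAlg k W →ₗ[k] (ℕ →₀ SymAlg k W) :=
  -- The universal property makes `S(W)` act on polynomials with `x` acting as `(1 - t) x`. Applying
  -- this action to the constant polynomial `1` gives the family.
  LinearMap.applyₗ (Finsupp.single 0 1) ∘ₗ (symLift (genPoly k W) (by
    intro i j x y
    refine LinearMap.ext fun p => ?_
    rw [Module.End.mul_apply, LinearMap.smul_apply, Module.End.mul_apply, genPoly_genPoly,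
      genPoly_genPoly, gen_comm]
    refine Finsupp.ext fun n => ?_
    exact smul_mul_assoc (sgn k (i * j)) (gen₁ k W j y * gen₁ k W i x) _)).toLinearMap

theorem scalePoly_one : scalePoly k W 1 = Finsupp.single 0 1 := by
  rw [scalePoly, LinearMap.comp_apply, AlgHom.toLinearMap_apply, map_one (symLift _ _)]
  rfl

theorem scalePoly_gen_mul (x : ⨁ i, W i) (s : SymAlg k W) :
    scalePoly k W (gen k W x * s) = polyMap (LinearMap.mulLeft k (gen k W x))
      (scalePoly k W s - polyShift k _ (scalePoly k W s)) := by
  rw [scalePoly, LinearMap.comp_apply, AlgHom.toLinearMap_apply, map_mul (symLift _ _), symLift_gen]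
  rfl

theorem polyEval_scalePoly (t : k) (s : SymAlg k W) :
    polyEval _ t (scalePoly k W s) = scale k W (1 - t) s := by
  induction s using mon_induction with
  | one => rw [scalePoly_one, polyEval_single, pow_zero, one_smul, map_one (scale k W (1 - t))]
  | gen_mul i x s ih =>
    rw [scalePoly_gen_mul, polyEval_polyMap, map_sub, polyEval_polyShift, ih, scale_gen_mul,
      LinearMap.mulLeft_apply, mul_sub, mul_smul_comm]
    exact sub_smul_self t _
  | add s t hs ht => simp only [map_add, hs, ht]
  | smul c s hs => simp only [map_smul, hs]

/-- The convolution is the derivative of `scale` in its parameter, and the sign comes from the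
parameter `1 - t`. -/
theorem polyDeriv_scalePoly (t : k) (s : SymAlg k W) :
    polyDeriv _ t (scalePoly k W s) =
      -conv (scaleL k W (1 - t)) (gen k W ∘ₗ proj k W) s := by
  induction s using mon_induction with
  | one =>
    rw [scalePoly_one, polyDeriv_single, conv_eq_bconv, bconv_one, LinearMap.comp_apply, proj_one,
      map_zero, map_zero, neg_zero, Nat.cast_zero, zero_mul, zero_smul]
  | gen_mul i x s ih =>
    rw [scalePoly_gen_mul, polyDeriv_polyMap, map_sub, polyDeriv_polyShift, ih,
      polyEval_scalePoly, conv_scale_gen_proj_gen_mul, LinearMap.mulLeft_apply, mul_sub, mul_add,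
      mul_smul_comm]
    exact mul_neg_sub_mul_add_smul t _ _ _
  | add s t hs ht => simp only [map_add, hs, ht, neg_add]
  | smul c s hs => simp only [map_smul, hs, smul_neg]

end Polynomials

/-! ### The path from the adjoint family to the fiber inclusion. -/

section PathHomotopy

variable {k : Type*} [Field k] {W : ℤ → Type*} [∀ i, AddCommGroup (W i)] [∀ i, Module k (W i)]
  {E : ℤ → Type*} [∀ i, AddCommGroup (E i)] [∀ i, Module k (E i)]
  {T : ℤ → Type*} [∀ i, AddCommGroup (T i)] [∀ i, Module k (T i)]

theorem bconv_comp_conv_gen {U : ℤ → Type*} [∀ i, AddCommGroup (U i)] [∀ i, Module k (U i)]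
    {P Q R : Type*} [AddCommGroup P] [Module k P] [AddCommGroup Q] [Module k Q]
    [AddCommGroup R] [Module k R] {d : ℤ} {F : SymAlg k W →ₗ[k] SymAlg k U} (hF : IsCoalgOp F)
    {b : Cochain k W U} (hb : b ∈ homDeg k W U d) (B : P →ₗ[k] Q →ₗ[k] R) (p : SymAlg k U →ₗ[k] P)
    (q : SymAlg k U →ₗ[k] Q) :
    bconv B p q ∘ₗ conv (gen k U ∘ₗ b) F =
      bconv B (p ∘ₗ conv (gen k U ∘ₗ b) F) (q ∘ₗ F) +
        bconv B (p ∘ₗ F ∘ₗ tauL k W d) (q ∘ₗ conv (gen k U ∘ₗ b) F) := by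
  ext1 s
  simp only [bconv, LinearMap.comp_apply, LinearMap.add_apply, comul_conv_gen hF hb s, map_add]
  rw [← LinearMap.comp_apply (TensorProduct.map p q), ← LinearMap.comp_apply (TensorProduct.map p q),
    ← TensorProduct.map_comp, ← TensorProduct.map_comp]

/-- Lifts along `ev` of the families `translate m` and `constCochain`. -/
structure IsDerSection (ev : (⨁ i, E i) →ₗ[k] Cochain k W W) (m : Cochain k W W)
    (tr : Cochain k W E) (cst : (⨁ i, W i) →ₗ[k] ⨁ i, E i) : Prop where
  tr_mem : tr ∈ homDeg k W E 0
  ev_tr : ev ∘ₗ tr = translate m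
  cst_mem : ∀ n, ∀ w ∈ LinearMap.range (DirectSum.lof k ℤ W n),
    cst w ∈ LinearMap.range (DirectSum.lof k ℤ E (n + 1))
  ev_cst : ev ∘ₗ cst = constCochain k W

/-- The Taylor coefficients of the map to derivations given by `scaledTwist m c` without its
constant term. -/
def twistPath (m : Cochain k W W) (tr : Cochain k W E) (cst : (⨁ i, W i) →ₗ[k] ⨁ i, E i) (c : k) :
    Cochain k W E :=
  tr ∘ₗ scaleL k W c - c • (cst ∘ₗ m) - (counit k W).toLinearMap.smulRight (tr 1)

variable [CharZero k] {ev : (⨁ i, E i) →ₗ[k] Cochain k W W} {m : Cochain k W W}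
  {q : Cochain k E E} {tr : Cochain k W E} {cst : (⨁ i, W i) →ₗ[k] ⨁ i, E i}
  {jW : ∀ i, W i →ₗ[k] T i} {jE : ∀ i, E i →ₗ[k] T i} {ρ : ∀ i, T i →ₗ[k] W i}
  {π : ∀ i, T i →ₗ[k] E i}

theorem twistPath_mem (hs : IsDerSection ev m tr cst) (hm : m ∈ homDeg k W W (-1)) (c : k) :
    twistPath m tr cst c ∈ homDeg k W E 0 := by
  refine sub_mem (sub_mem ?_ (Submodule.smul_mem _ _ ?_)) ?_
  · exact fun n s h => hs.tr_mem n _ (scale_mem c h)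
  · exact fun n s h => range_lof_congr (by ring) (hs.cst_mem _ _ (hm n s h))
  · exact counit_smulRight_mem (hs.tr_mem 0 1 SetLike.GradedOne.one_mem)

theorem twistPath_one (hm : m 1 = 0) (c : k) : twistPath m tr cst c 1 = 0 := by
  simp only [twistPath, LinearMap.sub_apply, LinearMap.comp_apply, AlgHom.toLinearMap_apply,
    LinearMap.smul_apply, LinearMap.smulRight_apply, map_one (scale k W c), map_one (counit k W),
    hm, map_zero, smul_zero, sub_zero, one_smul, sub_self]

theorem ev_twistPath (hs : IsDerSection ev m tr cst) (c : k) (s : SymAlg k W) :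
    ev (twistPath m tr cst c s) = scaledTwist m c s - counit k W s • m := by
  have h1 : ∀ s, ev (tr s) = translate m s := LinearMap.congr_fun hs.ev_tr
  have h2 : ∀ w, ev (cst w) = constCochain k W w := LinearMap.congr_fun hs.ev_cst
  have h3 : translate m 1 = m := by
    ext1 t
    rw [translate_apply, one_mul]
  simp only [twistPath, scaledTwist, LinearMap.sub_apply, LinearMap.comp_apply,
    LinearMap.smul_apply, LinearMap.smulRight_apply, AlgHom.toLinearMap_apply, map_sub, map_smul,
    h1, h2, h3]

/-- The map `pert` sees only the Taylor coefficients and the counit. Its value `m` at `1` restores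
exactly the term that was removed to make `twistPath` vanish on `1`. -/
theorem pert_comp_coalgHom_twistPath (hs : IsDerSection ev m tr cst) (hm : IsLInfty m) (c : k) :
    pert ev m ∘ₗ coalgHom (twistPath m tr cst c) = scaledTwist m c := by
  ext1 s
  rw [LinearMap.comp_apply, pert_apply, proj_coalgHom (twistPath_mem hs hm.1 c)
    (twistPath_one hm.2.1 c), counit_coalgHom (twistPath_mem hs hm.1 c) (twistPath_one hm.2.1 c),
    ev_twistPath hs, sub_add_cancel]

/-- After applying the injective `ev`, the `L∞` equation becomes the Maurer-Cartan equation
`bconv_preLie_scaledTwist`. -/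
theorem comp_coalgHom_twistPath (hs : IsDerSection ev m tr cst) (hm : IsLInfty m)
    (hinj : ∀ v, ev v = 0 → v = 0)
    (hMC : ev ∘ₗ q = -bconv (preLie k W) (pert ev m ∘ₗ tauL k E (-1)) (pert ev m)) (c : k) :
    q ∘ₗ coalgHom (twistPath m tr cst c) = twistPath m tr cst c ∘ₗ coder m := by
  have hF := isCoalgOp_coalgHom (twistPath_mem hs hm.1 c) (twistPath_one (tr := tr) (cst := cst)
    hm.2.1 c)
  have hτ : (pert ev m ∘ₗ tauL k E (-1)) ∘ₗ coalgHom (twistPath m tr cst c) =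
      scaledTwist m c ∘ₗ tauL k W (-1) := by
    rw [← pert_comp_coalgHom_twistPath hs hm]
    ext1 s
    exact congrArg (pert ev m) (hF.comp_tau (-1) s).symm
  have h : (ev ∘ₗ q) ∘ₗ coalgHom (twistPath m tr cst c) = scaledTwist m c ∘ₗ coder m := by
    rw [hMC, LinearMap.neg_comp, hF.bconv_comp, hτ, pert_comp_coalgHom_twistPath hs hm,
      bconv_preLie_scaledTwist hm]
    ext1 s
    exact neg_neg (scaledTwist m c (coder m s))
  ext1 s
  refine sub_eq_zero.1 (hinj _ ?_)
  rw [map_sub, sub_eq_zero, LinearMap.comp_apply, LinearMap.comp_apply, ev_twistPath hs,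
    counit_coder, zero_smul, sub_zero]
  exact LinearMap.congr_fun h s

/-- The path of maps to the total space of an extension over `twistPath`. -/
def extPath (m : Cochain k W W) (tr : Cochain k W E) (cst : (⨁ i, W i) →ₗ[k] ⨁ i, E i)
    (jW : ∀ i, W i →ₗ[k] T i) (jE : ∀ i, E i →ₗ[k] T i) (t : k) : Cochain k W T :=
  DirectSum.lmap jW ∘ₗ (t • proj k W) + DirectSum.lmap jE ∘ₗ twistPath m tr cst (1 - t)

theorem extPath_mem (hs : IsDerSection ev m tr cst) (hm : m ∈ homDeg k W W (-1)) (t : k) :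
    extPath m tr cst jW jE t ∈ homDeg k W T 0 :=
  add_mem (fun n s h => lmap_mem_range jW (Submodule.smul_mem _ t (proj_mem_homDeg n s h)))
    (fun n s h => lmap_mem_range jE (twistPath_mem hs hm _ n s h))

theorem extPath_one (hm : m 1 = 0) (t : k) : extPath m tr cst jW jE t 1 = 0 := by
  simp only [extPath, LinearMap.add_apply, LinearMap.comp_apply, LinearMap.smul_apply, proj_one,
    twistPath_one hm, smul_zero, map_zero, add_zero]

theorem IsSplit.lmap_ρ_extPath (h : IsSplit jW jE ρ π) (t : k) :
    DirectSum.lmap ρ ∘ₗ extPath m tr cst jW jE t = t • proj k W := by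
  rw [extPath, LinearMap.comp_add, ← LinearMap.comp_assoc, ← LinearMap.comp_assoc, lmap_comp_lmap,
    lmap_comp_lmap]
  simp only [h.ρ_jW, h.ρ_jE, lmap_id, lmap_zero, LinearMap.id_comp, LinearMap.zero_comp, add_zero]

theorem IsSplit.lmap_π_extPath (h : IsSplit jW jE ρ π) (t : k) :
    DirectSum.lmap π ∘ₗ extPath m tr cst jW jE t = twistPath m tr cst (1 - t) := by
  rw [extPath, LinearMap.comp_add, ← LinearMap.comp_assoc, ← LinearMap.comp_assoc, lmap_comp_lmap,
    lmap_comp_lmap]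
  simp only [h.π_jW, h.π_jE, lmap_id, lmap_zero, LinearMap.id_comp, LinearMap.zero_comp, zero_add]

theorem IsSplit.symMap_ρ_coalgHom_extPath (h : IsSplit jW jE ρ π) (hs : IsDerSection ev m tr cst)
    (hm : IsLInfty m) (t : k) :
    (symMap ρ).toLinearMap ∘ₗ coalgHom (extPath m tr cst jW jE t) = scaleL k W t := by
  have hst : t • proj k W = strictMap fun i => t • (LinearMap.id : W i →ₗ[k] W i) := by
    rw [strictMap, lmap_smul_id]
    rfl
  rw [symMap_comp_coalgHom ρ (extPath_mem hs hm.1 t) (extPath_one hm.2.1 t), h.lmap_ρ_extPath, hst,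
    coalgHom_strictMap]
  rfl

theorem IsSplit.symMap_π_coalgHom_extPath (h : IsSplit jW jE ρ π) (hs : IsDerSection ev m tr cst)
    (hm : IsLInfty m) (t : k) :
    (symMap π).toLinearMap ∘ₗ coalgHom (extPath m tr cst jW jE t) =
      coalgHom (twistPath m tr cst (1 - t)) := by
  rw [symMap_comp_coalgHom π (extPath_mem hs hm.1 t) (extPath_one hm.2.1 t), h.lmap_π_extPath]

theorem IsSplit.isLInftyMap_extPath (h : IsSplit jW jE ρ π) (hs : IsDerSection ev m tr cst)
    (hm : IsLInfty m) (hinj : ∀ v, ev v = 0 → v = 0)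
    (hMC : ev ∘ₗ q = -bconv (preLie k W) (pert ev m ∘ₗ tauL k E (-1)) (pert ev m)) (t : k) :
    IsLInftyMap m (extStr jW jE ρ π (pert ev m) q) (extPath m tr cst jW jE t) := by
  refine isLInftyMap_of_comp hm.1 (extPath_mem hs hm.1 t) (extPath_one hm.2.1 t) ?_
  have hF := isCoalgOp_coalgHom (extPath_mem (jW := jW) (jE := jE) hs hm.1 t)
    (extPath_one hm.2.1 t)
  -- The weights of base and fiber add up to `1`. What is left is the coefficient needed for the
  -- fiber component `t x` to be compatible with `D_m`.
  have h1 : m ∘ₗ scaleL k W (1 - t + t) - (1 - t) • m = t • m := by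
    ext1 s
    rw [sub_add_cancel, LinearMap.sub_apply, LinearMap.comp_apply, AlgHom.toLinearMap_apply,
      scale_one_apply, LinearMap.smul_apply, LinearMap.smul_apply, sub_smul, one_smul,
      sub_sub_cancel]
  rw [extStr, LinearMap.add_comp, LinearMap.comp_assoc, hF.bconv_comp, LinearMap.comp_assoc,
    LinearMap.comp_assoc, LinearMap.comp_assoc, h.symMap_π_coalgHom_extPath hs hm,
    h.symMap_ρ_coalgHom_extPath hs hm, pert_comp_coalgHom_twistPath hs hm,
    bconv_applyL_scaledTwist, h1, comp_coalgHom_twistPath hs hm hinj hMC]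
  ext1 s
  simp only [extPath, LinearMap.add_apply, LinearMap.comp_apply, LinearMap.smul_apply, proj_coder]

/-- By the Maurer-Cartan equation, `q` substitutes the constant derivations into the family and
conversely. The converse order vanishes, and the other inserts one unscaled factor among factors
scaled by `c`, which is the derivative of the translate part in `c`. -/
theorem comp_conv_gen_twistPath (hs : IsDerSection ev m tr cst) (hm : IsLInfty m)
    (hinj : ∀ v, ev v = 0 → v = 0)
    (hMC : ev ∘ₗ q = -bconv (preLie k W) (pert ev m ∘ₗ tauL k E (-1)) (pert ev m)) (c : k) :
    q ∘ₗ conv (gen k E ∘ₗ cst ∘ₗ proj k W) (coalgHom (twistPath m tr cst c)) =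
      -(tr ∘ₗ conv (scaleL k W c) (gen k W ∘ₗ proj k W)) := by
  have hf := twistPath_mem hs hm.1 c
  have h1 := twistPath_one (tr := tr) (cst := cst) hm.2.1 c
  have hF := isCoalgOp_coalgHom hf h1
  have hb : cst ∘ₗ proj k W ∈ homDeg k W E 1 := fun n s h =>
    range_lof_congr (by ring) (hs.cst_mem _ _ (proj_mem_homDeg n s h))
  set G := coalgHom (twistPath m tr cst c) with hG
  set C := conv (gen k E ∘ₗ cst ∘ₗ proj k W) G with hC
  have hpC : ∀ s, pert ev m (C s) = constCochain k W (proj k W s) := by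
    intro s
    rw [pert_apply, hC, counit_conv_gen, proj_conv_gen _ fun s => counit_coalgHom hf h1 s, zero_smul,
      add_zero]
    exact LinearMap.congr_fun hs.ev_cst _
  have hτC : (pert ev m ∘ₗ tauL k E (-1)) ∘ₗ C =
      constCochain k W ∘ₗ (-(proj k W ∘ₗ tauL k W (-1))) := by
    refine linearMap_ext_grade fun n s hn => ?_
    have hCs : C s ∈ grade k E (n + (1 + 0)) :=
      conv_mem (gen_comp_mem hb) (fun n s h => by simpa using coalgHom_mem hf h1 n s h) hn
    simp only [LinearMap.comp_apply, AlgHom.toLinearMap_apply, LinearMap.neg_apply, tau_of_mem _ hCs,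
      tau_of_mem _ hn, map_smul, hpC, map_neg]
    rw [show -1 * (n + (1 + 0)) = -1 + -1 * n by ring, sgn_add, sgn_neg_one, neg_one_mul]
    exact neg_smul (sgn k (-1 * n)) (constCochain k W (proj k W s))
  -- The sign of the odd element in the Maurer-Cartan equation cancels the sign of moving the degree
  -- `1` map past the first factor.
  have hτG : (pert ev m ∘ₗ tauL k E (-1)) ∘ₗ G ∘ₗ tauL k W 1 = scaledTwist m c := by
    rw [← pert_comp_coalgHom_twistPath hs hm]
    ext1 s
    simp only [LinearMap.comp_apply, AlgHom.toLinearMap_apply]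
    rw [hF.comp_tau, tau_tau, tau_of_even (by decide)]
  have hpC' : pert ev m ∘ₗ C = constCochain k W ∘ₗ proj k W := LinearMap.ext hpC
  have hsc : bconv (preLie k W) (scaledTwist m c) (constCochain k W ∘ₗ proj k W) =
      translate m ∘ₗ conv (scaleL k W c) (gen k W ∘ₗ proj k W) := by
    rw [scaledTwist, bconv_sub_left, bconv_smul_left, bconv_preLie_constCochain_left,
      bconv_preLie_constCochain_right]
    ext1 s
    simp only [LinearMap.sub_apply, LinearMap.zero_apply, smul_zero, sub_zero]
  have key : (ev ∘ₗ q) ∘ₗ C = -(translate m ∘ₗ conv (scaleL k W c) (gen k W ∘ₗ proj k W)) := by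
    rw [hMC, LinearMap.neg_comp, hC, bconv_comp_conv_gen hF hb, ← hC, hτC, hτG, hpC',
      bconv_preLie_constCochain_left, hsc, zero_add]
  ext1 s
  refine sub_eq_zero.1 (hinj _ ?_)
  rw [map_sub, sub_eq_zero, LinearMap.neg_apply, map_neg]
  have htr : ∀ s, ev (tr s) = translate m s := LinearMap.congr_fun hs.ev_tr
  refine (LinearMap.congr_fun key s).trans ?_
  rw [LinearMap.neg_apply, LinearMap.comp_apply, LinearMap.comp_apply, htr]

/-- The fiber component of the structure evaluates the constant derivation attached to `x`, which
returns `x`: the velocity of the fiber component `t x`. The base component is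
`comp_conv_gen_twistPath`. -/
theorem IsSplit.extStr_comp_conv_gen (h : IsSplit jW jE ρ π) (hs : IsDerSection ev m tr cst)
    (hm : IsLInfty m) (hinj : ∀ v, ev v = 0 → v = 0)
    (hMC : ev ∘ₗ q = -bconv (preLie k W) (pert ev m ∘ₗ tauL k E (-1)) (pert ev m)) (t : k) :
    extStr jW jE ρ π (pert ev m) q ∘ₗ conv (gen k T ∘ₗ DirectSum.lmap jE ∘ₗ cst ∘ₗ proj k W)
        (coalgHom (extPath m tr cst jW jE t)) =
      DirectSum.lmap jW ∘ₗ proj k W -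
        DirectSum.lmap jE ∘ₗ tr ∘ₗ conv (scaleL k W (1 - t)) (gen k W ∘ₗ proj k W) := by
  have hf := twistPath_mem hs hm.1 (1 - t)
  have h1 := twistPath_one (tr := tr) (cst := cst) hm.2.1 (1 - t)
  have hF := isCoalgOp_coalgHom (extPath_mem (jW := jW) (jE := jE) hs hm.1 t)
    (extPath_one hm.2.1 t)
  have hb : DirectSum.lmap jE ∘ₗ cst ∘ₗ proj k W ∈ homDeg k W T 1 := fun n s h =>
    lmap_mem_range jE (range_lof_congr (by ring) (hs.cst_mem _ _ (proj_mem_homDeg n s h)))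
  have hρC : (symMap ρ).toLinearMap ∘ₗ conv (gen k T ∘ₗ DirectSum.lmap jE ∘ₗ cst ∘ₗ proj k W)
      (coalgHom (extPath m tr cst jW jE t)) = 0 := by
    rw [symMap_comp_conv_gen, ← LinearMap.comp_assoc _ _ (DirectSum.lmap ρ), lmap_comp_lmap]
    simp only [h.ρ_jE, lmap_zero, LinearMap.zero_comp, LinearMap.comp_zero]
    rw [conv_eq_bconv, bconv_zero_left]
  have hπC : (symMap π).toLinearMap ∘ₗ conv (gen k T ∘ₗ DirectSum.lmap jE ∘ₗ cst ∘ₗ proj k W)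
      (coalgHom (extPath m tr cst jW jE t)) =
      conv (gen k E ∘ₗ cst ∘ₗ proj k W) (coalgHom (twistPath m tr cst (1 - t))) := by
    rw [symMap_comp_conv_gen, ← LinearMap.comp_assoc _ _ (DirectSum.lmap π), lmap_comp_lmap,
      h.symMap_π_coalgHom_extPath hs hm]
    simp only [h.π_jE, lmap_id, LinearMap.id_comp]
  have hpC : pert ev m ∘ₗ conv (gen k E ∘ₗ cst ∘ₗ proj k W)
      (coalgHom (twistPath m tr cst (1 - t))) = constCochain k W ∘ₗ proj k W := by
    ext1 s
    rw [LinearMap.comp_apply, pert_apply, counit_conv_gen,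
      proj_conv_gen _ fun s => counit_coalgHom hf h1 s, zero_smul, add_zero]
    exact LinearMap.congr_fun hs.ev_cst _
  rw [extStr, LinearMap.add_comp, LinearMap.comp_assoc, bconv_comp_conv_gen hF hb,
    LinearMap.comp_assoc, LinearMap.comp_assoc, LinearMap.comp_assoc, hρC, hπC, hpC,
    h.symMap_ρ_coalgHom_extPath hs hm, bconv_zero_right, add_zero,
    bconv_applyL_constCochain _ fun s => counit_symMap _ s, LinearMap.comp_assoc _ _ q, hπC,
    comp_conv_gen_twistPath hs hm hinj hMC, LinearMap.comp_neg]
  exact (sub_eq_add_neg _ _).symm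

/-- The polynomial family `extPath`. -/
def extPoly (m : Cochain k W W) (tr : Cochain k W E) (cst : (⨁ i, W i) →ₗ[k] ⨁ i, E i)
    (jW : ∀ i, W i →ₗ[k] T i) (jE : ∀ i, E i →ₗ[k] T i) : SymAlg k W →ₗ[k] (ℕ →₀ ⨁ i, T i) :=
  Finsupp.lsingle 1 ∘ₗ DirectSum.lmap jW ∘ₗ proj k W +
    (polyMap (DirectSum.lmap jE ∘ₗ tr) ∘ₗ scalePoly k W -
    (Finsupp.lsingle 0 - Finsupp.lsingle 1) ∘ₗ DirectSum.lmap jE ∘ₗ cst ∘ₗ m -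
    Finsupp.lsingle 0 ∘ₗ DirectSum.lmap jE ∘ₗ (counit k W).toLinearMap.smulRight (tr 1))

theorem polyEval_extPoly (t : k) :
    polyEval _ t ∘ₗ extPoly m tr cst jW jE = extPath m tr cst jW jE t := by
  ext1 s
  simp only [extPoly, extPath, twistPath, LinearMap.comp_apply, LinearMap.add_apply,
    LinearMap.sub_apply, map_add, map_sub, Finsupp.lsingle_apply, polyEval_single,
    polyEval_polyMap, polyEval_scalePoly, LinearMap.smul_apply, map_smul, pow_zero, pow_one,
    one_smul, sub_smul, AlgHom.toLinearMap_apply]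

theorem polyDeriv_extPoly (t : k) :
    polyDeriv _ t ∘ₗ extPoly m tr cst jW jE = DirectSum.lmap jW ∘ₗ proj k W -
      DirectSum.lmap jE ∘ₗ tr ∘ₗ conv (scaleL k W (1 - t)) (gen k W ∘ₗ proj k W) +
      DirectSum.lmap jE ∘ₗ cst ∘ₗ m := by
  ext1 s
  simp only [extPoly, LinearMap.comp_apply, LinearMap.add_apply,
    LinearMap.sub_apply, map_add, map_sub, map_neg, Finsupp.lsingle_apply, polyDeriv_single,
    polyDeriv_polyMap, polyDeriv_scalePoly, Nat.cast_zero, Nat.cast_one, zero_mul, one_mul,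
    Nat.sub_self, pow_zero, zero_smul, one_smul]
  abel

/-- The homotopy between the endpoints of `extPath`. -/
theorem IsSplit.homotopic_extPath (h : IsSplit jW jE ρ π) (hs : IsDerSection ev m tr cst)
    (hm : IsLInfty m) (hinj : ∀ v, ev v = 0 → v = 0)
    (hMC : ev ∘ₗ q = -bconv (preLie k W) (pert ev m ∘ₗ tauL k E (-1)) (pert ev m)) :
    Homotopic m (extStr jW jE ρ π (pert ev m) q) (extPath m tr cst jW jE 0)
      (extPath m tr cst jW jE 1) := by
  -- The `dt` component is constant in `t`: a generator goes to its constant derivation, longer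
  -- products go to zero.
  refine ⟨extPoly m tr cst jW jE, Finsupp.lsingle 0 ∘ₗ DirectSum.lmap jE ∘ₗ cst ∘ₗ proj k W,
    polyEval_extPoly 0, polyEval_extPoly 1, fun t => ?_⟩
  have hb : polyEval _ t ∘ₗ Finsupp.lsingle 0 ∘ₗ DirectSum.lmap jE ∘ₗ cst ∘ₗ proj k W =
      DirectSum.lmap jE ∘ₗ cst ∘ₗ proj k W := by
    ext1 s
    simp only [LinearMap.comp_apply, Finsupp.lsingle_apply, polyEval_single, pow_zero, one_smul]
  rw [hb, polyEval_extPoly, polyDeriv_extPoly]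
  refine ⟨h.isLInftyMap_extPath hs hm hinj hMC t, fun n s hn => lmap_mem_range jE
    (range_lof_congr (by ring) (hs.cst_mem _ _ (proj_mem_homDeg n s hn))), ?_, ?_⟩
  · simp only [LinearMap.comp_apply, proj_one, map_zero]
  -- Precomposing the `dt` component with `D_m` supplies the last term of the derivative, which
  -- comes from the summand `-(1-t) ε(y) m(x)`.
  · rw [h.extStr_comp_conv_gen hs hm hinj hMC]
    congr 1
    ext1 s
    simp only [LinearMap.comp_apply, proj_coder]

end PathHomotopy
end
end LInf

namespace LInf
noncomputable section

/-! ### The quasi-isomorphism and the two squares. -/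

section Equivalence

variable {k : Type*} [Field k] {W : ℤ → Type*} [∀ i, AddCommGroup (W i)] [∀ i, Module k (W i)]
  {E : ℤ → Type*} [∀ i, AddCommGroup (E i)] [∀ i, Module k (E i)]
  {E' : ℤ → Type*} [∀ i, AddCommGroup (E' i)] [∀ i, Module k (E' i)]
  {T : ℤ → Type*} [∀ i, AddCommGroup (T i)] [∀ i, Module k (T i)]

theorem bconv_gen {P Q R : Type*} [AddCommGroup P] [Module k P] [AddCommGroup Q] [Module k Q]
    [AddCommGroup R] [Module k R] (B : P →ₗ[k] Q →ₗ[k] R) (a : SymAlg k W →ₗ[k] P)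
    (b : SymAlg k W →ₗ[k] Q) (x : ⨁ i, W i) :
    bconv B a b (gen k W x) = B (a (gen k W x)) (b 1) + B (a 1) (b (gen k W x)) := by
  induction x using DirectSum.induction_on with
  | zero => simp only [map_zero, LinearMap.zero_apply, add_zero]
  | add x y hx hy =>
    simp only [map_add, LinearMap.add_apply, hx, hy]
    abel
  | of i x =>
    have h := bconv_gen_mul B a b i x 1
    simp only [mul_one, bconv_one, LinearMap.comp_apply, LinearMap.mulLeft_apply,
      AlgHom.toLinearMap_apply, map_one (tau k W i)] at h
    exact h

theorem coder_gen (φ : Cochain k W W) (x : ⨁ i, W i) (h : φ 1 = 0) :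
    coder φ (gen k W x) = gen k W (φ (gen k W x)) := by
  rw [coder, conv_eq_bconv, bconv_gen]
  simp only [LinearMap.comp_apply, LinearMap.id_apply, LinearMap.mul_apply', mul_one, h, map_zero,
    LinearMap.zero_apply, add_zero]

theorem lmap_injective {f : ∀ i, W i →ₗ[k] E i} (hf : ∀ i, Function.Injective (f i)) :
    Function.Injective (DirectSum.lmap f) := by
  intro v w h
  refine DFinsupp.ext fun i => hf i ?_
  have := congrArg (fun u : ⨁ i, E i => u i) h
  simpa only [DirectSum.lmap_apply] using this

theorem mem_range_lof_of_lmap {f : ∀ i, W i →ₗ[k] E i} (hf : ∀ i, Function.Injective (f i)) {n : ℤ}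
    {v : ⨁ i, W i} (h : DirectSum.lmap f v ∈ LinearMap.range (DirectSum.lof k ℤ E n)) :
    v ∈ LinearMap.range (DirectSum.lof k ℤ W n) := by
  obtain ⟨x, hx⟩ := h
  refine ⟨v n, lmap_injective hf ?_⟩
  rw [DirectSum.lmap_lof, ← DirectSum.lmap_apply, ← hx, DirectSum.lof_apply]

variable [CharZero k]

theorem proj_eq_strictMap : proj k W = strictMap fun i => (LinearMap.id : W i →ₗ[k] W i) := by
  rw [strictMap, lmap_id, LinearMap.id_comp]

theorem coalgHom_proj : coalgHom (proj k W) = LinearMap.id := by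
  rw [proj_eq_strictMap, coalgHom_strictMap]
  ext1 s
  exact symMap_id s

theorem isLInftyMap_proj (q : Cochain k W W) : IsLInftyMap q q (proj k W) := by
  rw [proj_eq_strictMap]
  refine isLInftyMap_strictMap ?_
  ext1 s
  rw [lmap_id, LinearMap.comp_apply, LinearMap.comp_apply, AlgHom.toLinearMap_apply, symMap_id]
  rfl

theorem isQuasiIso_proj (q : Cochain k W W) : IsQuasiIso q q (proj k W) := by
  refine ⟨fun x _ ⟨y, hy⟩ => ⟨y, by rwa [proj_gen] at hy⟩, fun y hy => ⟨y, 0, hy, ?_⟩⟩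
  rw [proj_gen, map_zero, map_zero, add_zero]

theorem strictMap_comp_coalgHom (f : ∀ i, E i →ₗ[k] T i) {h : Cochain k W E}
    (hh : h ∈ homDeg k W E 0) (h1 : h 1 = 0) :
    compMap (strictMap f) h = DirectSum.lmap f ∘ₗ h := by
  ext1 s
  rw [compMap, strictMap, LinearMap.comp_apply, LinearMap.comp_apply, proj_coalgHom hh h1]
  rfl

theorem Homotopic.refl {q : Cochain k W W} {q' : Cochain k E E} {f : Cochain k W E}
    (hf : IsLInftyMap q q' f) : Homotopic q q' f f := by
  have ha : ∀ t, polyEval _ t ∘ₗ Finsupp.lsingle 0 ∘ₗ f = f := fun t => by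
    ext1 s
    simp only [LinearMap.comp_apply, Finsupp.lsingle_apply, polyEval_single, pow_zero, one_smul]
  refine ⟨Finsupp.lsingle 0 ∘ₗ f, 0, ha 0, ha 1, fun t => ?_⟩
  rw [ha, LinearMap.comp_zero]
  refine ⟨hf, zero_mem _, rfl, ?_⟩
  rw [LinearMap.comp_zero, conv_eq_bconv, bconv_zero_left, LinearMap.comp_zero, LinearMap.zero_comp,
    add_zero]
  ext1 s
  simp only [LinearMap.comp_apply, Finsupp.lsingle_apply, polyDeriv_single, Nat.cast_zero, zero_mul,
    zero_smul, LinearMap.zero_apply]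

variable {ev : (⨁ i, E i) →ₗ[k] Cochain k W W} {m : Cochain k W W}
  {q : Cochain k E E} {q' : Cochain k E' E'} {incl : ∀ i, E' i →ₗ[k] E i}
  {tr : Cochain k W E} {cst : (⨁ i, W i) →ₗ[k] ⨁ i, E i} {tc : Cochain k W E'}
  {jW : ∀ i, W i →ₗ[k] T i} {jE : ∀ i, E i →ₗ[k] T i} {ρ : ∀ i, T i →ₗ[k] W i}
  {π : ∀ i, T i →ₗ[k] E i}

/-- The elements of `E` whose image under `ev` vanishes on `1` are those of the `L∞` subalgebra
`E'`. -/
structure IsReduction (ev : (⨁ i, E i) →ₗ[k] Cochain k W W) (q : Cochain k E E)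
    (q' : Cochain k E' E') (incl : ∀ i, E' i →ₗ[k] E i) : Prop where
  injective : ∀ i, Function.Injective (incl i)
  comp : DirectSum.lmap incl ∘ₗ q' = q ∘ₗ (symMap incl).toLinearMap
  ev_one : ∀ v, ev (DirectSum.lmap incl v) 1 = 0
  exists_lift : ∀ v, ev v 1 = 0 → ∃ v', DirectSum.lmap incl v' = v

/-- Without fiber arguments, the fiber component of the structure is the constant term of a
derivation, which is zero here. -/
theorem IsSplit.isLInftyMap_reduction (h : IsSplit jW jE ρ π) (hr : IsReduction ev q q' incl)
    (hm : m 1 = 0) :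
    IsLInftyMap q' (extStr jW jE ρ π (pert ev m) q) (strictMap fun i => jE i ∘ₗ incl i) := by
  refine isLInftyMap_strictMap ?_
  have hρ : (symMap ρ).toLinearMap ∘ₗ (symMap fun i => jE i ∘ₗ incl i).toLinearMap =
      (counit k E').toLinearMap.smulRight 1 := by
    ext1 s
    simp only [LinearMap.comp_apply, AlgHom.toLinearMap_apply, symMap_comp, ← LinearMap.comp_assoc,
      h.ρ_jE, LinearMap.zero_comp, symMap_zero, LinearMap.smulRight_apply,
      Algebra.algebraMap_eq_smul_one]
  have hπ : (symMap π).toLinearMap ∘ₗ (symMap fun i => jE i ∘ₗ incl i).toLinearMap =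
      (symMap incl).toLinearMap := by
    ext1 s
    simp only [LinearMap.comp_apply, AlgHom.toLinearMap_apply, symMap_comp, ← LinearMap.comp_assoc,
      h.π_jE, LinearMap.id_comp]
  have hzero : (applyL k W).flip 1 ∘ₗ pert ev m ∘ₗ (symMap incl).toLinearMap = 0 := by
    ext1 s
    simp only [LinearMap.comp_apply, AlgHom.toLinearMap_apply, LinearMap.flip_apply, applyL_apply,
      pert_apply, LinearMap.add_apply, LinearMap.smul_apply, hm, smul_zero, add_zero, proj_symMap,
      hr.ev_one, LinearMap.zero_apply]
  rw [extStr, LinearMap.add_comp, LinearMap.comp_assoc, (isCoalgOp_symMap _).bconv_comp,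
    LinearMap.comp_assoc, LinearMap.comp_assoc, LinearMap.comp_assoc, hρ, hπ, bconv_counit_right,
    hzero, LinearMap.comp_zero, zero_add, ← hr.comp, ← LinearMap.comp_assoc, lmap_comp_lmap]

theorem pert_gen (v : ⨁ i, E i) : pert ev m (gen k E v) = ev v := by
  rw [pert_apply, proj_gen, counit_gen, zero_smul, add_zero]

theorem extStr_gen (y : ⨁ i, T i) :
    extStr jW jE ρ π (pert ev m) q (gen k T y) =
      DirectSum.lmap jW (ev (DirectSum.lmap π y) 1 + m (gen k W (DirectSum.lmap ρ y))) +
        DirectSum.lmap jE (q (gen k E (DirectSum.lmap π y))) := by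
  rw [extStr, LinearMap.add_apply, LinearMap.comp_apply, LinearMap.comp_apply, LinearMap.comp_apply,
    bconv_gen]
  simp only [LinearMap.comp_apply, AlgHom.toLinearMap_apply, symMap_gen, map_one (symMap π),
    map_one (symMap ρ), pert_one, applyL_apply, pert_gen]

/-- This is the Maurer-Cartan equation on a generator, evaluated at `1`. The term in which `m` comes
first and `v` is applied afterwards drops out because `m` has no constant term. -/
theorem ev_gen_one (hm : m 1 = 0)
    (hMC : ev ∘ₗ q = -bconv (preLie k W) (pert ev m ∘ₗ tauL k E (-1)) (pert ev m))
    (v : ⨁ i, E i) : ev (q (gen k E v)) 1 = -m (gen k W (ev v 1)) := by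
  have h := congrArg (fun φ : Cochain k W W => φ 1) (LinearMap.congr_fun hMC (gen k E v))
  simp only [LinearMap.comp_apply, LinearMap.neg_apply, bconv_gen, LinearMap.add_apply,
    preLie_apply, coder_one, pert_one, AlgHom.toLinearMap_apply, map_one (tau k E (-1)), hm,
    pert_gen, map_zero, zero_add] at h
  exact h

theorem IsLInfty.apply_gen_apply_gen (hq : IsLInfty q) (v : ⨁ i, E i) :
    q (gen k E (q (gen k E v))) = 0 := by
  rw [← coder_gen q v hq.2.1]
  exact LinearMap.congr_fun hq.comp_coder _

/-- The differential of the constant derivation with value `w` has fiber component `w`. Subtracting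
it from an element with fiber component `w` leaves a pure derivation, whose constant term is the
fiber component of the differential of the original element. If that is zero, the remainder lies in
the subalgebra. This one correction yields both halves. -/
theorem IsSplit.isQuasiIso_reduction (h : IsSplit jW jE ρ π) (hr : IsReduction ev q q' incl)
    (hs : IsDerSection ev m tr cst) (hm : IsLInfty m) (hq : IsLInfty q)
    (hMC : ev ∘ₗ q = -bconv (preLie k W) (pert ev m ∘ₗ tauL k E (-1)) (pert ev m)) :
    IsQuasiIso q' (extStr jW jE ρ π (pert ev m) q) (strictMap fun i => jE i ∘ₗ incl i) := by
  have hβ : ∀ x, strictMap (fun i => jE i ∘ₗ incl i) (gen k E' x) =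
      DirectSum.lmap jE (DirectSum.lmap incl x) := fun x => by
    rw [strictMap, LinearMap.comp_apply, proj_gen, ← lmap_comp_lmap, LinearMap.comp_apply]
  have hρW : ∀ w, DirectSum.lmap ρ (DirectSum.lmap jW w) = w := fun w => by
    rw [← LinearMap.comp_apply, lmap_comp_lmap]
    simp only [h.ρ_jW, lmap_id, LinearMap.id_apply]
  have hρE : ∀ v, DirectSum.lmap ρ (DirectSum.lmap jE v) = 0 := fun w => by
    rw [← LinearMap.comp_apply, lmap_comp_lmap]
    simp only [h.ρ_jE, lmap_zero, LinearMap.zero_apply]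
  have hπE : ∀ v, DirectSum.lmap π (DirectSum.lmap jE v) = v := fun w => by
    rw [← LinearMap.comp_apply, lmap_comp_lmap]
    simp only [h.π_jE, lmap_id, LinearMap.id_apply]
  have hπW : ∀ w, DirectSum.lmap π (DirectSum.lmap jW w) = 0 := fun w => by
    rw [← LinearMap.comp_apply, lmap_comp_lmap]
    simp only [h.π_jW, lmap_zero, LinearMap.zero_apply]
  have hc : ∀ w, ev (cst w) 1 = w := fun w => by
    have : ev (cst w) = constCochain k W w := LinearMap.congr_fun hs.ev_cst w
    rw [this, constCochain_apply, map_one (counit k W), one_smul]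
  have hq' : ∀ v, DirectSum.lmap incl (q' (gen k E' v)) = q (gen k E (DirectSum.lmap incl v)) :=
    fun v => by
      rw [← symMap_gen]
      exact LinearMap.congr_fun hr.comp _
  have hlift : ∀ u w, ev u 1 + m (gen k W w) = 0 →
      ∃ z, DirectSum.lmap incl z = u - q (gen k E (cst w)) := fun u w huw => by
    refine hr.exists_lift _ ?_
    rw [map_sub, LinearMap.sub_apply, ev_gen_one hm.2.1 hMC, hc, sub_neg_eq_add, huw]
  have hqu : ∀ u w, q (gen k E (u - q (gen k E (cst w)))) = q (gen k E u) := fun u w => by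
    rw [map_sub, map_sub, hq.apply_gen_apply_gen, sub_zero]
  constructor
  · rintro x - ⟨y, hy⟩
    rw [hβ, extStr_gen] at hy
    have h1 := congrArg (DirectSum.lmap ρ) hy
    have h2 := congrArg (DirectSum.lmap π) hy
    rw [map_add, hρE, hρW, hρE, add_zero] at h1
    rw [map_add, hπE, hπW, hπE, zero_add] at h2
    obtain ⟨z, hz⟩ := hlift _ _ h1.symm
    refine ⟨z, lmap_injective hr.injective ?_⟩
    rw [hq', hz, hqu, h2]
  · intro y hy
    rw [extStr_gen] at hy
    have h1 := congrArg (DirectSum.lmap ρ) hy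
    have h2 := congrArg (DirectSum.lmap π) hy
    rw [map_add, hρW, hρE, add_zero, map_zero] at h1
    rw [map_add, hπE, hπW, map_zero, zero_add] at h2
    obtain ⟨x, hx⟩ := hlift _ _ h1
    -- The primitive is the constant derivation with value the fiber component of `y`.
    refine ⟨x, DirectSum.lmap jE (cst (DirectSum.lmap ρ y)), lmap_injective hr.injective ?_, ?_⟩
    · rw [hq', hx, hqu, h2, map_zero]
    · have hy' : y = DirectSum.lmap jW (DirectSum.lmap ρ y) + DirectSum.lmap jE (DirectSum.lmap π y) := by
        rw [← LinearMap.comp_apply, ← LinearMap.comp_apply (DirectSum.lmap jE), lmap_comp_lmap,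
          lmap_comp_lmap, ← LinearMap.add_apply, ← lmap_add]
        simp only [h.total, lmap_id, LinearMap.id_apply]
      rw [hβ, hx, extStr_gen, hπE, hρE, hc, map_zero, map_zero, add_zero, map_sub]
      nth_rewrite 1 [hy']
      abel

theorem isLInftyMap_of_lmap_comp (hr : IsReduction ev q q' incl) (hm : m ∈ homDeg k W W (-1))
    {f : Cochain k W E} (hf : f ∈ homDeg k W E 0) (hf1 : f 1 = 0)
    (hfm : q ∘ₗ coalgHom f = f ∘ₗ coder m) (htc : DirectSum.lmap incl ∘ₗ tc = f) :
    IsLInftyMap m q' tc := by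
  have hinj := lmap_injective hr.injective
  have hmem : tc ∈ homDeg k W E' 0 := fun n s hs => by
    refine mem_range_lof_of_lmap hr.injective ?_
    rw [← LinearMap.comp_apply, htc]
    exact hf n s hs
  have h1 : tc 1 = 0 := hinj (by rw [← LinearMap.comp_apply, htc, hf1, map_zero])
  refine isLInftyMap_of_comp hm hmem h1 ?_
  have h : DirectSum.lmap incl ∘ₗ (q' ∘ₗ coalgHom tc) = DirectSum.lmap incl ∘ₗ (tc ∘ₗ coder m) := by
    rw [← LinearMap.comp_assoc, hr.comp, LinearMap.comp_assoc, symMap_comp_coalgHom incl hmem h1,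
      ← LinearMap.comp_assoc, htc, hfm]
  ext1 s
  exact hinj (LinearMap.congr_fun h s)

theorem extPath_zero :
    extPath m tr cst jW jE 0 = DirectSum.lmap jE ∘ₗ twistPath m tr cst 1 := by
  rw [extPath, zero_smul, LinearMap.comp_zero, zero_add, sub_zero]

/-- Rescaling by `0` is the counit, so the translate part reduces to its value at `1`, which
`twistPath` subtracts. -/
theorem extPath_at_one : extPath m tr cst jW jE 1 = strictMap jW := by
  have h : twistPath m tr cst 0 = 0 := by
    ext1 s
    have h0 : scale k W 0 s = counit k W s • 1 := by
      rw [scale]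
      simp only [zero_smul]
      rw [symMap_zero, Algebra.algebraMap_eq_smul_one]
    simp only [twistPath, LinearMap.sub_apply, LinearMap.comp_apply, AlgHom.toLinearMap_apply, h0,
      map_smul, zero_smul, LinearMap.smulRight_apply, sub_zero, sub_self,
      LinearMap.zero_apply]
  rw [extPath, sub_self, h, LinearMap.comp_zero, add_zero, one_smul]
  rfl

/-- The endpoints of `extPath` are the two sides of the square under the fiber. The square over the
base commutes on the nose, so a constant homotopy serves there. -/
theorem IsSplit.isSeqHomotopyEquiv (h : IsSplit jW jE ρ π) (hr : IsReduction ev q q' incl)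
    (hs : IsDerSection ev m tr cst) (hm : IsLInfty m) (hq : IsLInfty q)
    (hinj : ∀ v, ev v = 0 → v = 0)
    (hMC : ev ∘ₗ q = -bconv (preLie k W) (pert ev m ∘ₗ tauL k E (-1)) (pert ev m))
    (htc : DirectSum.lmap incl ∘ₗ tc = twistPath m tr cst 1) (htc' : IsLInftyMap m q' tc) :
    IsSeqHomotopyEquiv m q' q tc (strictMap incl) m (extStr jW jE ρ π (pert ev m) q) q
      (strictMap jW) (strictMap π) (proj k W) (strictMap fun i => jE i ∘ₗ incl i) (proj k E) := by
  have hβ := h.isLInftyMap_reduction (jW := jW) hr hm.2.1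
  refine ⟨⟨isLInftyMap_proj m, isQuasiIso_proj m⟩,
    ⟨hβ, h.isQuasiIso_reduction hr hs hm hq hMC⟩,
    ⟨isLInftyMap_proj q, isQuasiIso_proj q⟩, ?_, ?_⟩
  · have h1 : compMap (strictMap fun i => jE i ∘ₗ incl i) tc = extPath m tr cst jW jE 0 := by
      rw [strictMap_comp_coalgHom _ htc'.1 htc'.2.1, extPath_zero, ← htc, ← lmap_comp_lmap,
        LinearMap.comp_assoc]
    have h2 : compMap (strictMap jW) (proj k W) = extPath m tr cst jW jE 1 := by
      rw [extPath_at_one, compMap, coalgHom_proj, LinearMap.comp_id]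
    rw [h1, h2]
    exact h.homotopic_extPath hs hm hinj hMC
  · have h1 : compMap (proj k E) (strictMap incl) = strictMap incl := by
      rw [proj_eq_strictMap, strictMap_comp_coalgHom _ (strictMap_mem incl) (strictMap_one incl),
        lmap_id, LinearMap.id_comp]
    have h2 : compMap (strictMap π) (strictMap fun i => jE i ∘ₗ incl i) = strictMap incl := by
      rw [strictMap_comp_coalgHom _ (strictMap_mem _) (strictMap_one _), strictMap,
        ← LinearMap.comp_assoc, lmap_comp_lmap]
      simp only [← LinearMap.comp_assoc, h.π_jE, LinearMap.id_comp]
      rfl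
    rw [h1, h2]
    exact Homotopic.refl (isLInftyMap_strictMap hr.comp)

end Equivalence
end
end LInf

namespace LInf
noncomputable section

/-! ### Lifting families of coderivations to graded spaces of derivations. -/

section DerFamilies

variable {k : Type*} [Field k] {W : ℤ → Type*} [∀ i, AddCommGroup (W i)] [∀ i, Module k (W i)]
  {g : ℤ → Type*} [∀ i, AddCommGroup (g i)] [∀ i, Module k (g i)]
  {g' : ℤ → Type*} [∀ i, AddCommGroup (g' i)] [∀ i, Module k (g' i)]

/-- The constant coderivations, lifted along a section `L` of the evaluation. -/
def constLift (L : ∀ i, homDeg k W W i →ₗ[k] g i) : (⨁ i, W i) →ₗ[k] ⨁ i, Susp g i :=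
  DirectSum.toModule k ℤ _ fun i => DirectSum.lof k ℤ (Susp g) (i + 1) ∘ₗ L (i + 1 - 1) ∘ₗ
    (constCochain k W ∘ₗ DirectSum.lof k ℤ W i).codRestrict (homDeg k W W (i + 1 - 1))
      fun x => counit_smulRight_mem (range_lof_congr (by ring) ⟨x, rfl⟩)

variable {m : Cochain k W W}

theorem translate_mem (hm : m ∈ homDeg k W W (-1)) (n : ℤ) (s : grade k W n) :
    translate m s ∈ homDeg k W W (n - 1) := fun _ _ ht =>
  range_lof_congr (by ring) (hm _ _ (SetLike.mul_mem_graded s.2 ht))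

/-- The coderivations `translate m s`, lifted along a section `L` of the evaluation. -/
def translateLift (hm : m ∈ homDeg k W W (-1)) (L : ∀ i, homDeg k W W i →ₗ[k] g i) :
    Cochain k W (Susp g) :=
  DirectSum.lmap (M := fun n => grade k W n) (N := Susp g) (fun n =>
      L (n - 1) ∘ₗ (translate m ∘ₗ (grade k W n).subtype).codRestrict (homDeg k W W (n - 1))
        (translate_mem hm n)) ∘ₗ
    (DirectSum.decomposeLinearEquiv (grade k W)).toLinearMap

theorem translateLift_of_mem (hm : m ∈ homDeg k W W (-1)) (L : ∀ i, homDeg k W W i →ₗ[k] g i)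
    {n : ℤ} {s : SymAlg k W} (hs : s ∈ grade k W n) :
    translateLift hm L s = DirectSum.lof k ℤ (Susp g) n
      (L (n - 1) ⟨translate m s, translate_mem hm n ⟨s, hs⟩⟩) := by
  rw [translateLift, LinearMap.comp_apply, LinearEquiv.coe_coe,
    DirectSum.decomposeLinearEquiv_apply, DirectSum.decompose_of_mem _ hs]
  exact DirectSum.lmap_lof _ _ _

theorem evSusp_lmap_decompose (f' : ∀ i, g' i →ₗ[k] Cochain k W W)
    (G : ∀ n, grade k W n →ₗ[k] Susp g' n) {n : ℤ} {s : SymAlg k W} (hs : s ∈ grade k W n) :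
    evSusp f' ((DirectSum.lmap G ∘ₗ (DirectSum.decomposeLinearEquiv (grade k W)).toLinearMap) s) =
      f' (n - 1) (G n ⟨s, hs⟩) := by
  rw [LinearMap.comp_apply, LinearEquiv.coe_coe,
    DirectSum.decomposeLinearEquiv_apply, DirectSum.decompose_of_mem _ hs]
  exact (congrArg _ (DirectSum.lmap_lof _ _ _)).trans (evSusp_lof f' n _)

theorem isDerSection_lift (hm : m ∈ homDeg k W W (-1)) {f : ∀ i, g i →ₗ[k] Cochain k W W}
    {L : ∀ i, homDeg k W W i →ₗ[k] g i} (hL : ∀ i φ, f i (L i φ) = φ.1) :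
    IsDerSection (evSusp f) m (translateLift hm L) (constLift L) where
  tr_mem n s hs := by
    rw [translateLift_of_mem hm L hs]
    exact range_lof_congr (add_zero n).symm ⟨_, rfl⟩
  ev_tr := linearMap_ext_grade fun n s hs => by
    rw [LinearMap.comp_apply, translateLift_of_mem hm L hs, evSusp_lof, hL]
  cst_mem n w hw := by
    obtain ⟨x, rfl⟩ := hw
    rw [constLift, DirectSum.toModule_lof]
    exact ⟨_, rfl⟩
  ev_cst := by
    refine DirectSum.linearMap_ext _ fun i => ?_
    ext1 x
    rw [LinearMap.comp_apply, LinearMap.comp_apply, constLift, DirectSum.toModule_lof,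
      LinearMap.comp_apply, evSusp_lof, LinearMap.comp_apply, hL]
    rfl

theorem evSusp_lmap {f : ∀ i, g i →ₗ[k] Cochain k W W} {f' : ∀ i, g' i →ₗ[k] Cochain k W W}
    {incl : ∀ i, g' i →ₗ[k] g i} (hincl : ∀ i x, f i (incl i x) = f' i x) (v : ⨁ i, Susp g' i) :
    evSusp f (DirectSum.lmap (fun i => (incl (i - 1) : Susp g' i →ₗ[k] Susp g i)) v) =
      evSusp f' v := by
  induction v using DirectSum.induction_on with
  | zero => simp only [map_zero]
  | add v w hv hw => simp only [map_add, hv, hw]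
  | of i x =>
    rw [← DirectSum.lof_eq_of k, DirectSum.lmap_lof, evSusp_lof, evSusp_lof, hincl]

theorem isReduction_evSusp [CharZero k] {d : ∀ i, g i →ₗ[k] g (i - 1)}
    {br : ∀ i j l, i + j = l → g i →ₗ[k] g j →ₗ[k] g l}
    {d' : ∀ i, g' i →ₗ[k] g' (i - 1)} {br' : ∀ i j l, i + j = l → g' i →ₗ[k] g' j →ₗ[k] g' l}
    {f : ∀ i, g i →ₗ[k] Cochain k W W} {f' : ∀ i, g' i →ₗ[k] Cochain k W W}
    (H : IsDerEmbedding m d br f) (H' : IsDerEmbedding m d' br' f') {incl : ∀ i, g' i →ₗ[k] g i}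
    (hincl : ∀ i x, f i (incl i x) = f' i x) (hone : ∀ i x, f' i x 1 = 0)
    (hlift : ∀ i x, f i x 1 = 0 → ∃ x', incl i x' = x) :
    IsReduction (evSusp f) (dglaOp g d br) (dglaOp g' d' br')
      (fun i => (incl (i - 1) : Susp g' i →ₗ[k] Susp g i)) where
  injective i x y h := H'.injective _ (by rw [← hincl, ← hincl, h])
  comp := dglaOp_natural incl
    (fun i x => H.injective _ (by rw [hincl, H.map_d, H'.map_d, hincl]))
    (fun i j l h x y => H.injective _ (by rw [hincl, H.map_br, H'.map_br, hincl, hincl]))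
  ev_one v := by
    rw [evSusp_lmap hincl]
    induction v using DirectSum.induction_on with
    | zero => rw [map_zero, LinearMap.zero_apply]
    | add v w hv hw => rw [map_add, LinearMap.add_apply, hv, hw, add_zero]
    | of i x => rw [← DirectSum.lof_eq_of k, evSusp_lof, hone]
  exists_lift v hv := by
    classical
    -- Since `1` is homogeneous, vanishing of the total constant term forces it for each component.
    -- The lifts are chosen degreewise and assembled over the finite support.
    choose x' hx' using fun i => hlift (i - 1) (v i)
      (apply_eq_zero_of_evSusp H.mem SetLike.GradedOne.one_mem hv i)
    refine ⟨DirectSum.mk (Susp g') (DFinsupp.support v) fun i => x' i.1, DFinsupp.ext fun i => ?_⟩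
    rw [DirectSum.lmap_apply]
    by_cases hi : i ∈ DFinsupp.support v
    · rw [DirectSum.mk_apply_of_mem hi]
      exact hx' i
    · rw [DirectSum.mk_apply_of_notMem hi, map_zero]
      exact (DFinsupp.notMem_support_iff.1 hi).symm

theorem lmap_comp_eq_twistPath [CharZero k] {d : ∀ i, g i →ₗ[k] g (i - 1)}
    {br : ∀ i j l, i + j = l → g i →ₗ[k] g j →ₗ[k] g l}
    {f : ∀ i, g i →ₗ[k] Cochain k W W} {f' : ∀ i, g' i →ₗ[k] Cochain k W W}
    (H : IsDerEmbedding m d br f) {incl : ∀ i, g' i →ₗ[k] g i}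
    (hincl : ∀ i x, f i (incl i x) = f' i x) {tr : Cochain k W (Susp g)}
    {cst : (⨁ i, W i) →ₗ[k] ⨁ i, Susp g i} (hs : IsDerSection (evSusp f) m tr cst)
    {tc : Cochain k W (Susp g')}
    (htc : ∀ n, ∀ s ∈ grade k W n, evSusp f' (tc s) =
      scaledTwist m 1 s - counit k W s • m) :
    DirectSum.lmap (fun i => (incl (i - 1) : Susp g' i →ₗ[k] Susp g i)) ∘ₗ tc =
      twistPath m tr cst 1 := by
  refine linearMap_ext_grade fun n s hn => sub_eq_zero.1 (H.eq_zero _ ?_)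
  rw [map_sub, sub_eq_zero, LinearMap.comp_apply, evSusp_lmap hincl, htc n s hn, ev_twistPath hs]

end DerFamilies

/-! ### Instances for the full and the truncated Chevalley-Eilenberg complexes. -/

section ChevalleyEilenberg

variable {k : Type*} [Field k] {V : ℤ → Type*} [∀ i, AddCommGroup (V i)] [∀ i, Module k (V i)]
  {m : Cochain k (Susp V) (Susp V)}

variable (k V) in
/-- The inclusion of the derivations into the Taylor coefficients. -/
def derIncl (i : ℤ) : Der k V i →ₗ[k] Cochain k (Susp V) (Susp V) := (der k V i).subtype

variable (k V) in
/-- The inclusion of the derivations with vanishing constant term into the Taylor coefficients. -/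
def derBarIncl (i : ℤ) : DerBar k V i →ₗ[k] Cochain k (Susp V) (Susp V) := (derBar k V i).subtype

theorem isDerEmbedding_der (hm : IsLInfty m) :
    IsDerEmbedding (g := Der k V) m
      (fun i => gerstBracket (der k V) der_gerst (-1) i (i - 1) (by ring) ⟨m, hm.1⟩)
      (gerstBracket (der k V) der_gerst) (derIncl k V) where
  mem _ x := x.2
  injective _ := Subtype.val_injective
  map_d _ _ := rfl
  map_br _ _ _ _ _ _ := rfl

theorem isDerEmbedding_derBar (hm : IsLInfty m) :
    IsDerEmbedding (g := DerBar k V) m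
      (fun i => gerstBracket (derBar k V) derBar_gerst (-1) i (i - 1) (by ring)
        ⟨m, hm.1, hm.2.1⟩)
      (gerstBracket (derBar k V) derBar_gerst) (derBarIncl k V) where
  mem _ x := x.2.1
  injective _ := Subtype.val_injective
  map_d _ _ := rfl
  map_br _ _ _ _ _ _ := rfl

theorem isSplit_extension (U : ℤ → Type*) [∀ i, AddCommGroup (U i)] [∀ i, Module k (U i)] :
    IsSplit (k := k) (inFib (V := V) (U := U)) (inBase (V := V) (U := U))
      (prFib (V := V) (U := U)) (prBase (V := V) (U := U)) where
  ρ_jW _ := rfl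
  π_jE _ := rfl
  ρ_jE _ := rfl
  π_jW _ := rfl
  total _ := LinearMap.ext fun _ => Prod.ext (add_zero _) (zero_add _)

theorem evSusp_toTruncCE (hm : IsLInfty m) {n : ℤ}
    {s : SymAlg k (Susp V)} (hs : s ∈ grade k (Susp V) n) :
    evSusp (g := DerBar k V) (derBarIncl k V) (toTruncCE hm s) = twist m s := by
  have h := evSusp_lmap_decompose (k := k) (W := Susp V) (g' := DerBar k V) (derBarIncl k V)
    (fun n => (twist m ∘ₗ (grade k (Susp V) n).subtype).codRestrict (derBar k V (n - 1))
      (twist_mem hm n)) hs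
  exact h

end ChevalleyEilenberg

end
end LInf

namespace LInf
noncomputable section

/-! ### Identification of the universal extension with the general model. -/

section UniversalExtension

theorem lift_comp_map_eq_bconv {k : Type*} [Field k] {W T : ℤ → Type*} [∀ i, AddCommGroup (W i)]
    [∀ i, Module k (W i)] [∀ i, AddCommGroup (T i)] [∀ i, Module k (T i)] {A : Type*}
    [AddCommGroup A] [Module k A] (e : A →ₗ[k] Cochain k W W) (a : SymAlg k T →ₗ[k] A)
    (b : SymAlg k T →ₗ[k] SymAlg k W) :
    TensorProduct.lift e ∘ₗ TensorProduct.map a b ∘ₗ comul k T =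
      bconv (applyL k W) (e ∘ₗ a) b :=
  bconv_congr (B := e) (B' := applyL k W) fun _ _ _ _ _ _ => rfl

variable {k : Type*} [Field k] {V : ℤ → Type*} [∀ i, AddCommGroup (V i)] [∀ i, Module k (V i)]
  {U : ℤ → Type*} [∀ i, AddCommGroup (U i)] [∀ i, Module k (U i)]

/-- The summand `ε(u) m(x)` is absorbed into the family as its value at `u = 1`, so fiber structure
and perturbation are treated together. -/
theorem extOp_eq_extStr (m : Cochain k (Susp V) (Susp V)) (q : Cochain k (Susp U) (Susp U))
    (f : Cochain k (Susp U) (Susp (Der k V))) :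
    extOp m q f = extStr (W := Susp V) (E := Susp U) (T := Susp fun i => V i × U i)
      (inFib (V := V) (U := U)) (inBase (V := V) (U := U))
      (prFib (V := V) (U := U)) (prBase (V := V) (U := U))
      (evalDer k V ∘ₗ f + (counit k (Susp U)).toLinearMap.smulRight m) q := by
  have h : (evalDer k V ∘ₗ f + (counit k (Susp U)).toLinearMap.smulRight m) ∘ₗ
        (symMap (prBase (V := V) (U := U))).toLinearMap =
      evalDer k V ∘ₗ f ∘ₗ (symMap (prBase (V := V) (U := U))).toLinearMap +
        (counit k (Susp fun i => V i × U i)).toLinearMap.smulRight m := by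
    ext1 s
    simp only [LinearMap.comp_apply, LinearMap.add_apply, AlgHom.toLinearMap_apply,
      counit_symMap, LinearMap.smulRight_apply]
  have h2 := lift_comp_map_eq_bconv (W := Susp V) (evalDer k V)
    (f ∘ₗ (symMap (prBase (V := V) (U := U))).toLinearMap)
    (symMap (prFib (V := V) (U := U))).toLinearMap
  rw [extStr, h, bconv_add_left, bconv_counit_left, ← h2,
    add_comm (TensorProduct.lift _ ∘ₗ _)]
  rfl

theorem twist_eq_scaledTwist (m : Cochain k (Susp V) (Susp V)) (s : SymAlg k (Susp V)) :
    twist m s = scaledTwist m 1 s - counit k (Susp V) s • m := by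
  ext1 t
  rw [twist_apply, scaledTwist]
  simp only [LinearMap.sub_apply, LinearMap.comp_apply, LinearMap.smul_apply,
    AlgHom.toLinearMap_apply, scale_one_apply, translate_apply, constCochain_apply, one_smul]

theorem universalOp_eq_extStr {m : Cochain k (Susp V) (Susp V)} (hm : IsLInfty m) :
    universalOp hm = extStr (W := Susp V) (E := Susp (Der k V))
      (T := Susp fun i => V i × Der k V i)
      (inFib (V := V) (U := Der k V)) (inBase (V := V) (U := Der k V))
      (prFib (V := V) (U := Der k V)) (prBase (V := V) (U := Der k V))
      (pert (E := Susp (Der k V)) (evSusp (g := Der k V) (derIncl k V)) m) (ceOp hm) := by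
  have h := extOp_eq_extStr (U := Der k V) m (ceOp hm) (proj k (Susp (Der k V)))
  exact h

end UniversalExtension

end
end LInf

theorem theorem4p1 {k : Type*} [Field k] [CharZero k]
    {I : ℤ → Type*} [∀ i, AddCommGroup (I i)] [∀ i, Module k (I i)]
    (m : LInf.Cochain k (LInf.Susp I) (LInf.Susp I)) (hm : LInf.IsLInfty m) :
    -- the two Chevalley-Eilenberg dg Lie algebras
    LInf.IsLInfty (LInf.ceBarOp hm) ∧ LInf.IsLInfty (LInf.ceOp hm) ∧
    -- the sequence from `I` through the truncated to the full Chevalley-Eilenberg complex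
    LInf.IsLInftyMap m (LInf.ceBarOp hm) (LInf.toTruncCE hm) ∧
    LInf.IsLInftyMap (LInf.ceBarOp hm) (LInf.ceOp hm) (LInf.strictMap LInf.ceInclusion) ∧
    -- the universal extension
    LInf.IsLInfty (LInf.universalOp hm) ∧
    LInf.IsLInftyMap m (LInf.universalOp hm) (LInf.strictMap (LInf.inFib (V := I) (U := LInf.Der k I))) ∧
    LInf.IsLInftyMap (LInf.universalOp hm) (LInf.ceOp hm) (LInf.strictMap (LInf.prBase (V := I) (U := LInf.Der k I))) ∧
    -- the two sequences are homotopy equivalent, through the identity on fiber and base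
    ∃ β : LInf.Cochain k (LInf.Susp (LInf.DerBar k I))
        (LInf.Susp fun i => I i × LInf.Der k I i),
      LInf.IsSeqHomotopyEquiv
        m (LInf.ceBarOp hm) (LInf.ceOp hm)
        (LInf.toTruncCE hm) (LInf.strictMap LInf.ceInclusion)
        m (LInf.universalOp hm) (LInf.ceOp hm)
        (LInf.strictMap (LInf.inFib (V := I) (U := LInf.Der k I))) (LInf.strictMap (LInf.prBase (V := I) (U := LInf.Der k I)))
        (LInf.proj k (LInf.Susp I)) β (LInf.proj k (LInf.Susp (LInf.Der k I))) := by
  have H := LInf.isDerEmbedding_der hm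
  have H' := LInf.isDerEmbedding_derBar hm
  have hsplit := LInf.isSplit_extension (k := k) (V := I) (LInf.Der k I)
  have hq := H.isLInfty hm
  have hMC := H.evSusp_comp_dglaOp hm.comp_coder
  -- The section is the identity because the full complex contains all homogeneous coderivations,
  -- constant ones included. The truncated complex has no such section, so the path is built in the
  -- full one.
  have hs := LInf.isDerSection_lift (g := LInf.Der k I) hm.1 (f := LInf.derIncl k I)
    (L := fun i => (LinearMap.id : LInf.Der k I i →ₗ[k] LInf.Der k I i)) fun _ _ => rfl
  have hr := LInf.isReduction_evSusp (g := LInf.Der k I) (g' := LInf.DerBar k I) H H'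
    (incl := fun i => Submodule.inclusion (LInf.derBar_le i)) (fun _ _ => rfl) (fun _ x => x.2.2)
    (fun _ x hx => ⟨⟨x.1, x.2, hx⟩, rfl⟩)
  have htw : ∀ n, ∀ s ∈ LInf.grade k (LInf.Susp I) n,
      LInf.evSusp (g := LInf.DerBar k I) (LInf.derBarIncl k I) (LInf.toTruncCE hm s) =
        LInf.scaledTwist m 1 s - LInf.counit k (LInf.Susp I) s • m := fun n s hn => by
    rw [LInf.evSusp_toTruncCE hm hn]
    exact LInf.twist_eq_scaledTwist m s
  have htc := LInf.lmap_comp_eq_twistPath (g := LInf.Der k I) (g' := LInf.DerBar k I) H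
    (incl := fun i => Submodule.inclusion (LInf.derBar_le i)) (fun _ _ => rfl) hs htw
  have hι := LInf.isLInftyMap_of_lmap_comp hr hm.1 (LInf.twistPath_mem hs hm.1 1)
    (LInf.twistPath_one hm.2.1 1) (LInf.comp_coalgHom_twistPath hs hm H.eq_zero hMC 1) htc
  have hev := LInf.evSusp_mem (g := LInf.Der k I) (f := LInf.derIncl k I) H.mem
  have hext := hsplit.isLInfty_extStr hev hm hq hMC
  have hequiv := hsplit.isSeqHomotopyEquiv hr hs hm hq H.eq_zero hMC htc hι
  rw [LInf.universalOp_eq_extStr hm]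
  exact ⟨H'.isLInfty hm, hq, hι, LInf.isLInftyMap_strictMap hr.comp, hext,
    hsplit.isLInftyMap_jW hq.2.1, hsplit.isLInftyMap_π _, _, hequiv⟩
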